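/- **Setting.** Four branches $k\in\{1,2,3,4\}$, one lane each, lead to an intersection of length $\Delta>0$. Vehicles have length $L>0$, do not turn, and satisfy $\dot x=v$, $\dot v=u$ (Carathéodory sense), where $x$ is the position of the front ($x=0$: beginning of the intersection). Data: $u_m<0<u_M$, speed limit $v^M$, nominal speed $0<\nu^{nom}\le v^M$, $\sigma_0>1$, $W_T\ge0$. A branch consists of the staging zone $[-(L_s+L_m+L_e),-(L_m+L_e))$, the mid zone $[-(L_m+L_e),-L_e)$ and the exit zone $[-L_e,0]$ (all lengths positive). At time $0$ all vehicles present are in the staging zones; later vehicles appear at the beginning $-(L_s+L_m+L_e)$ of a branch (finitely many up to any time). Vehicle $j-1$ denotes the vehicle immediately in front of $j$ on its branch, and $$\mathcal D(v_1,v_2)=L+\max\{0,\tfrac{v_2^2-v_1^2}{-2u_m}\},\quad \sigma_j=\frac{x_{j-1}-x_j}{\mathcal D(v_{j-1},v_j)},\quad T^{nom}=\frac{\mathcal D(\nu^{nom},v^M)}{\nu^{nom}} .$$ With $\underline v=\frac{-u_mv^M}{-u_m+\sigma_0u_M}$ and $T^{fol}(v)=\frac{(\nu^{nom})^2-v^2}{2u_Mv^M}+\frac{\sigma_0\mathcal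 D(v,v^M)}{v^M}-\frac{\nu^{nom}-v}{u_M}$, let $T^{iat}_0=\sigma_0T^{nom}$ if $\underline v\ge\nu^{nom}$ and $T^{iat}_0=\max\{\sigma_0T^{nom},T^{fol}(\underline v)\}$ otherwise. Fix any number $T^{iat}\ge T^{iat}_0$ and, for a bubble $i$ of $m_i$ vehicles, put $\bar\tau^{occ}_i=(m_i-1)T^{iat}+\max\{\frac{L+\Delta}{\nu^{nom}},T^{iat}\}$. **Clustering.** At each $t_s=sT_{cs}$, $s=0,1,2,\dots$, where $0<T_{cs}<L_s/v^M$, the $n$ vehicles of branch $k$ that are in the staging zone and not yet in a bubble are partitioned into $\min\{n,\bar N_k\}$ clusters ($\bar N_k\ge1$) such that the sum of squared distances of the positions to the cluster centers is minimal. Each cluster is a new bubble; its vehicles, from the front, are $(i,1),\dots,(i,m_i)$, and $x_i=x_{i,1}$ is its position. The list $\mathcal L$ of bubbles scheduled at $t_s$ is formed from the previous list, taken in its order of passage: bubbles whose position is no longer in the staging or mid zone are removed; if the number $M$ of new bubbles plus the number of those left exceeds $\bar N$, the first (as many as the excess) are removed too; the new bubbles are added. The number $\tau^{min}$, initially $0$,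 becomes the maximum of its old value and of $\tau_i+\bar\tau^{occ}_i$ over the bubbles $i$ just removed. **Scheduling.** For $i\in\mathcal L$ let $d_i=-x_i(t_s)$. The variables are average velocities $\bar v_i>0$, with approach times $\tau_i=t_s+d_i/\bar v_i$. Let $\tau^e_{i,j}$ be the time at which $(i,j)$ reaches $0$ under maximum acceleration up to speed $v^M$ and zero acceleration thereafter, $\tau^l_{i,j}$ the time at which it reaches $0$ under maximum braking ($\infty$ if it stops before), $\tau^e_i=\max_j(\tau^e_{i,j}-(j-1)T^{nom})$, $\tau^l_i=\min_j(\tau^l_{i,j}-(j-1)T^{nom})$, $\bar v^M_i=\frac{d_i}{\tau^e_i-t_s}$, $\bar v^m_i=\frac{d_i}{\tau^l_i-t_s}$. The constraints are $\bar v_i\in[\bar v_i^m,\bar v_i^M]$, $\tau_i\ge\tau^{min}$, and the no-collision constraints: (N1) $\tau_q\ge\tau_i+\bar\tau^{occ}_i$ if $q$ is the immediate follower of $i$ on the same branch; (N2) $\tau_i\ge\tau_q+\bar\tau^{occ}_q$ or $\tau_q\ge\tau_i+\bar\tau^{occ}_i$ if $i,q$ are on different branches. The simplified cost is $\mathcal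 C_{\mathcal L}=\sum_{i\in\mathcal L}\phi_i(\bar v_i)$, $\phi_i(\bar v)=m_i(W_T\frac{d_i}{\bar v}+F_i(\bar v))$, where every $F_i$ (which may depend on $s$) is nonincreasing on $[0,v^M]$. The schedule is computed by branch and bound. Let $\hat v_i=\min\{\bar v_i^M,\frac{d_i}{\tau^{min}-t_s}\}$ if $\tau^{min}>t_s$, and $\hat v_i=\bar v_i^M$ otherwise. For an order $P$ of passage, the first bubble gets $\hat v_i$ and a bubble $i$ that follows $q$ gets $\min\{\hat v_i,\frac{\bar v_q}{c_{qi}+b_{qi}\bar v_q}\}$, $c_{qi}=\frac{d_q}{d_i}$, $b_{qi}=\frac{\bar\tau^{occ}_q}{d_i}$; the cost of $P$ is the sum of the $\phi_i$ at these velocities. The nodes of the search tree are the partial orders of passage (lists) that respect the order on each branch; the children of a node extend it by the first remaining bubble of some branch. The lower bound of a node is the cost of its list plus the sum of $\phi_i$ over the remaining bubbles, at the velocities given on each branch separately by the same recursion, continued from the last bubble of the node. The search starts from an arbitrary complete order that respects the branch orders, as best order, and from the root; it explores the open nodes one by one in any sequence: a complete order replaces the best order if its cost is smaller; an incomplete node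 other than the root is discarded if its lower bound exceeds the best cost, and otherwise is replaced by its children. When no open node is left, the best order and its velocities are the schedule. The approach time $\tau_i$ in force at time $t$ is that of the latest scheduling of $i$, and $\tau_{i,j}=\tau_i+(j-1)T^{nom}$. **Control.** Until a vehicle is clustered, its motion is only subject to $v\in[0,v^M]$, $u\in[u_m,u_M]$. From then on it uses the following controller. For position $x$ and speed $v$ at time $t$, consider velocity profiles on $[t,\tau]$ that change (at rate $u_m$ or $u_M$) from $v$ to a speed $\nu\in[0,v^M]$, stay there, then change (at rate $u_m$ or $u_M$) to a final speed in $[\nu^{nom},v^M]$, and cover exactly the distance $-x$. The value $g_{uc}(\tau,t,x,v)$ is the initial acceleration of such a profile that minimizes $\int|u|$, and $g_{uc}=u_M$ if $t\ge\tau$ or there is none. Let $g_{us}=u_{j-1}$ if $v_j=0$ and $g_{us}=\big(\frac{v_{j-1}}{v_j}(1+\sigma_j\frac{u_{j-1}}{-u_m})-1\big)\frac{-u_m}{\sigma_j}$ otherwise, $g_{sf}=\min\{g_{uc},g_{us}\}$ and $\mathcal C_s=\{(v_1,v_2,\sigma):v_2\ge v_1,\ \sigma\in[1,\sigma_0]\}$.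 The controller is $g=g_{sf}$ if $(v_{j-1},v_j,\sigma_j)\in\mathcal C_s$ and $g=g_{uc}$ otherwise (in particular for the first vehicle of a branch), with $u_j=g$ if $v_j<v^M$, and $u_j=g$ saturated to $[u_m,0]$ if $v_j=v^M$. The selection between $g_{sf}$ and $g_{uc}$ is made in the sense of a switching rule: for every $t$ there is $\varepsilon>0$ such that the one selected at time $t$ is applied on $[t,t+\varepsilon)$. The vehicles remain under this law after they have crossed. **Theorem.** Assume $L_e\ge\frac{(v^M)^2}{-2u_m}+\frac{(\nu^{nom})^2}{2u_M}$, and that at each $t_s$ every newly clustered vehicle $j$ that has a predecessor satisfies $\sigma_j(t_s)\ge1$. Then for every evolution of this closed-loop system: (i) every vehicle belongs to some bubble and every bubble is scheduled at least once; at each $t_s$ every execution of the branch and bound is finite, and the schedule is an order of the bubbles of $\mathcal L$ whose velocities satisfy all constraints and minimize $\mathcal C_{\mathcal L}$ among all velocities that do; (ii) after each scheduling, the approach times in force of all bubbles formed so far satisfy (N1) and (N2), and for each bubble $i$ the time from the first to the last moment at which one of its vehicles is in the intersection ($0\le x\le\Delta+L$) is at most $\bar\tau_i^{occ}$; (iii)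 $\sigma_j(t)\ge1$ for every vehicle $j$ that has a predecessor and for all $t$ from the time at which $j$ is clustered; (iv) every bubble $i$ is scheduled a last time, and with the resulting $\tau_i$: its lead vehicle reaches $x=0$ exactly at $\tau_i$, which is the first moment at which the bubble uses the intersection; the bubble uses the intersection only within $[\tau_i,\tau_i+\bar\tau_i^{occ}]$; each of its vehicles completes the crossing (reaches $x=\Delta+L$) and has speed at least $\nu^{nom}$ at all times at which $x\ge0$. -/

import Mathlib

open Set MeasureTheory

noncomputable section

namespace Intersection

/-! ### System parameters -/

/-- The data of the intersection, of its branches, of the vehicles and of the design. -/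
structure Params where
  /-- vehicle length -/
  L : ℝ
  /-- length of the intersection -/
  Δ : ℝ
  /-- minimum (braking) acceleration -/
  uMin : ℝ
  /-- maximum acceleration -/
  uMax : ℝ
  /-- speed limit -/
  vMax : ℝ
  /-- nominal speed when entering the intersection -/
  νnom : ℝ
  /-- bound on the safety ratio in the coupling set -/
  σ₀ : ℝ
  /-- length of the staging zone -/
  Ls : ℝ
  /-- length of the mid zone -/
  Lm : ℝ
  /-- length of the exit zone -/
  Le : ℝ
  /-- period of the clustering and of the scheduling -/
  Tcs : ℝ
  /-- weight of the travel time in the cost -/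
  WT : ℝ
  /-- maximal number of bubbles handed to the scheduler -/
  Nbar : ℕ
  /-- maximal number of new bubbles on a branch at a clustering instance -/
  NbarBranch : Fin 4 → ℕ
  L_pos : 0 < L
  Δ_pos : 0 < Δ
  uMin_neg : uMin < 0
  uMax_pos : 0 < uMax
  νnom_pos : 0 < νnom
  νnom_le : νnom ≤ vMax
  one_lt_σ₀ : 1 < σ₀
  Ls_pos : 0 < Ls
  Lm_pos : 0 < Lm
  Le_pos : 0 < Le
  Tcs_pos : 0 < Tcs
  Tcs_lt : Tcs < Ls / vMax
  WT_nonneg : 0 ≤ WT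
  NbarBranch_pos : ∀ k, 1 ≤ NbarBranch k

namespace Params

variable (p : Params)

/-- The clustering and scheduling instance `t_s = s T_cs`. -/
def instant (s : ℕ) : ℝ := s * p.Tcs

/-- Position of the beginning of a branch. -/
def start : ℝ := -(p.Ls + p.Lm + p.Le)

def stagingZone : Set ℝ := Ico p.start (-(p.Lm + p.Le))

def midZone : Set ℝ := Ico (-(p.Lm + p.Le)) (-p.Le)

/-- Safe-following distance `𝒟(v₁, v₂)`; `v₁` is the speed of the preceding vehicle. -/
def safeDist (v₁ v₂ : ℝ) : ℝ :=
  p.L + max 0 (1 / (-2 * p.uMin) * (v₂ ^ 2 - v₁ ^ 2))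

/-- Nominal inter-vehicle approach time. -/
def Tnom : ℝ := p.safeDist p.νnom p.vMax / p.νnom

/-- The speed `v̲`. -/
def vLow : ℝ := -p.uMin * p.vMax / (-p.uMin + p.σ₀ * p.uMax)

def Tfol (v : ℝ) : ℝ :=
  (p.νnom ^ 2 - v ^ 2) / (2 * p.uMax * p.vMax) + p.σ₀ * p.safeDist v p.vMax / p.vMax
    - (p.νnom - v) / p.uMax

open Classical in
/-- The upper bound on the inter-approach times. -/
def Tiat : ℝ :=
  if p.νnom ≤ p.vLow then p.σ₀ * p.Tnom else max (p.σ₀ * p.Tnom) (p.Tfol p.vLow)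

/-- Upper bound on the occupancy time of a bubble of `m` vehicles, computed with the bound `T` on
the inter-approach times. -/
def occBound (T : ℝ) (m : ℕ) : ℝ :=
  ((m : ℝ) - 1) * T + max ((p.L + p.Δ) / p.νnom) T

open Classical in
/-- Time needed to cover the distance `d` from speed `v` with maximum acceleration until the speed
is `vMax`, and with zero acceleration thereafter. -/
def earliestDuration (d v : ℝ) : ℝ :=
  if d ≤ (p.vMax ^ 2 - v ^ 2) / (2 * p.uMax) then
    (√(v ^ 2 + 2 * p.uMax * d) - v) / p.uMax
  else
    (p.vMax - v) / p.uMax + (d - (p.vMax ^ 2 - v ^ 2) / (2 * p.uMax)) / p.vMax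

open Classical in
/-- Time needed to cover the distance `d` from speed `v` with maximum deceleration; it is infinite
if the vehicle stops before. -/
def latestDuration (d v : ℝ) : EReal :=
  if v ^ 2 / (-2 * p.uMin) < d then ⊤
  else (((v - √(v ^ 2 + 2 * p.uMin * d)) / (-p.uMin) : ℝ) : EReal)

/-! ### The local controller -/

/-- Duration of a change of speed from `a` to `b` with full braking or full acceleration. -/
def rampTime (a b : ℝ) : ℝ := max ((b - a) / p.uMax) ((b - a) / p.uMin)

/-- Distance covered meanwhile. -/
def rampDist (a b : ℝ) : ℝ := (a + b) / 2 * p.rampTime a b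

/-- Duration of the cruise phase of a velocity profile of duration `T`. -/
def holdTime (T v ν w : ℝ) : ℝ := T - p.rampTime v ν - p.rampTime ν w

/-- The piecewise linear velocity profile that starts from speed `v`, ramps to the cruising speed
`ν` (which is `ν^l` if `ν ≤ v`, and `ν^u` if `v ≤ ν`), cruises, and finally ramps to the terminal
speed `w`, is admissible and covers exactly the distance `d` in time `T`. -/
structure IsProfile (T d v ν w : ℝ) : Prop where
  cruise_mem : ν ∈ Icc 0 p.vMax
  final_mem : w ∈ Icc p.νnom p.vMax
  hold_nonneg : 0 ≤ p.holdTime T v ν w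
  dist_eq : p.rampDist v ν + ν * p.holdTime T v ν w + p.rampDist ν w = d

/-- The integral of `|u|` along the profile. -/
def profileCost (v ν w : ℝ) : ℝ := |ν - v| + |w - ν|

/-- `q = (ν, w)` is an optimal profile. -/
def IsOptimalProfile (T d v : ℝ) (q : ℝ × ℝ) : Prop :=
  p.IsProfile T d v q.1 q.2 ∧
    ∀ ν w, p.IsProfile T d v ν w → profileCost v q.1 q.2 ≤ profileCost v ν w

open Classical in
/-- The acceleration at the beginning of a profile. -/
def initialAccel (T v : ℝ) (q : ℝ × ℝ) : ℝ :=
  if q.1 < v then p.uMin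
  else if v < q.1 then p.uMax
  else if 0 < p.holdTime T v q.1 q.2 then 0
  else if q.2 < q.1 then p.uMin
  else if q.1 < q.2 then p.uMax
  else 0

open Classical in
/-- The uncoupled controller `g_uc`: feedback form of the optimal profile that reaches position
`0` at time `τ`, and `uMax` if there is none. -/
def guc (τ t x v : ℝ) : ℝ :=
  if h : 0 < τ - t ∧ ∃ q, p.IsOptimalProfile (τ - t) (-x) v q then
    p.initialAccel (τ - t) v h.2.choose
  else p.uMax

open Classical in
/-- The unsaturated controller `g_us`; `v₁, u₁` are the speed and the acceleration of the preceding
vehicle. -/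
def gus (v₁ v₂ σ u₁ : ℝ) : ℝ :=
  if v₂ = 0 then u₁
  else (v₁ / v₂ * (1 + σ * (u₁ / -p.uMin)) - 1) * (-p.uMin / σ)

/-- The safe-following controller `g_sf`. -/
def gsf (τ t x v₂ v₁ σ u₁ : ℝ) : ℝ := min (p.guc τ t x v₂) (p.gus v₁ v₂ σ u₁)

/-- The coupling set `𝒞_s`, a set of triples `(v₁, v₂, σ)`. -/
def couplingSet : Set (ℝ × ℝ × ℝ) := {z | z.1 ≤ z.2.1 ∧ z.2.2 ∈ Icc 1 p.σ₀}

/-- `g` saturated from below by `lo` and from above by `hi`. -/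
def sat (lo hi g : ℝ) : ℝ := max lo (min hi g)

open Classical in
/-- The local switching controller; `coupled` tells which of the two controllers is selected. -/
def localControl (coupled : Prop) (τ t x v₂ v₁ σ u₁ : ℝ) : ℝ :=
  if v₂ < p.vMax then
    (if coupled then p.gsf τ t x v₂ v₁ σ u₁ else p.guc τ t x v₂)
  else
    sat p.uMin 0 (if coupled then p.gsf τ t x v₂ v₁ σ u₁ else p.guc τ t x v₂)

end Params

/-! ### The static scheduling problem and its solution algorithm -/

/-- `ℛ(i, q) = 1` among the elements of `A`: `q` is the immediate follower of `i`. -/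
def ImmediatelyPrecedes {ι : Type} (A : Set ι) (branch : ι → Fin 4) (pos : ι → ℝ) (i q : ι) :
    Prop :=
  branch i = branch q ∧ pos q < pos i ∧
    ¬∃ j ∈ A, branch j = branch i ∧ pos q < pos j ∧ pos j < pos i

/-- An instance of the scheduling problem. -/
structure SchedProblem (ι : Type) where
  /-- the bubbles to schedule -/
  bubbles : List ι
  /-- the present time `t_s` -/
  now : ℝ
  branch : ι → Fin 4
  /-- position of the lead vehicle at time `now` -/
  pos : ι → ℝ
  /-- number of vehicles -/
  size : ι → ℕ
  /-- bound on the occupancy time -/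
  occ : ι → ℝ
  /-- lower bound on the average velocity -/
  vLo : ι → ℝ
  /-- upper bound on the average velocity -/
  vHi : ι → ℝ
  /-- earliest approach time allowed by the bubbles that are not rescheduled -/
  tauMin : ℝ
  /-- fuel cost functions -/
  F : ι → ℝ → ℝ
  /-- weight of the travel time -/
  WT : ℝ

namespace SchedProblem

variable {ι : Type} [DecidableEq ι] (S : SchedProblem ι)

/-- Distance to the intersection. -/
def d (i : ι) : ℝ := -S.pos i

/-- Approach time that corresponds to the average velocity `v` of bubble `i`. -/
def timeOf (i : ι) (v : ℝ) : ℝ := S.now + S.d i / v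

def phi (i : ι) (v : ℝ) : ℝ := S.size i * (S.WT * (S.d i / v) + S.F i v)

/-- The simplified cost function `𝒞_ℒ`. -/
def cost (vbar : ι → ℝ) : ℝ := (S.bubbles.map fun i => S.phi i (vbar i)).sum

/-- `ℛ(i, q) = 1`. -/
def R (i q : ι) : Prop := ImmediatelyPrecedes {j | j ∈ S.bubbles} S.branch S.pos i q

/-- All constraints of the scheduling problem, for average velocities `vbar`. -/
structure Feasible (vbar : ι → ℝ) : Prop where
  pos_vel : ∀ i ∈ S.bubbles, 0 < vbar i
  bounds : ∀ i ∈ S.bubbles, vbar i ∈ Icc (S.vLo i) (S.vHi i)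
  after_min : ∀ i ∈ S.bubbles, S.tauMin ≤ S.timeOf i (vbar i)
  same_branch : ∀ i ∈ S.bubbles, ∀ q ∈ S.bubbles, S.R i q →
    S.timeOf i (vbar i) + S.occ i ≤ S.timeOf q (vbar q)
  diff_branch : ∀ i ∈ S.bubbles, ∀ q ∈ S.bubbles, S.branch i ≠ S.branch q →
    S.timeOf q (vbar q) + S.occ q ≤ S.timeOf i (vbar i) ∨
      S.timeOf i (vbar i) + S.occ i ≤ S.timeOf q (vbar q)

open Classical in
/-- The upper velocity bound combined with the requirement to approach no earlier than `tauMin`. -/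
def vCap (i : ι) : ℝ :=
  if S.tauMin ≤ S.now then S.vHi i else min (S.vHi i) (S.d i / (S.tauMin - S.now))

def c (q i : ι) : ℝ := S.d q / S.d i

def b (q i : ι) : ℝ := S.occ q / S.d i

/-- The velocity optimization for a fixed order of passage. The bubbles of the list pass one after
the other, the first of them after the given bubble with its given velocity, if there is one. -/
def velAux : Option (ι × ℝ) → List ι → List (ι × ℝ)
  | _, [] => []
  | none, i :: P => (i, S.vCap i) :: velAux (some (i, S.vCap i)) P
  | some (q, v), i :: P =>
      (i, min (S.vCap i) (v / (S.c q i + S.b q i * v))) ::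
        velAux (some (i, min (S.vCap i) (v / (S.c q i + S.b q i * v)))) P

/-- Optimal average velocities for the order `P`, as a list of pairs in the order `P`. -/
def velList (P : List ι) : List (ι × ℝ) := S.velAux none P

/-- Optimal average velocity of bubble `i` for the order `P`. -/
def velOpt (P : List ι) (i : ι) : ℝ := ((S.velList P).lookup i).getD 0

def listCost (l : List (ι × ℝ)) : ℝ := (l.map fun y => S.phi y.1 y.2).sum

/-- The cost of an order `P`. -/
def orderCost (P : List ι) : ℝ := S.listCost (S.velList P)

open Classical in
/-- The queue of branch `k`: its bubbles in the order of their arrival. -/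
def queue (k : Fin 4) : List ι :=
  (S.bubbles.filter fun i => S.branch i = k).insertionSort fun i j => S.pos j ≤ S.pos i

/-- What remains of the queue of branch `k` when the bubbles of `P` have passed. -/
def remaining (P : List ι) (k : Fin 4) : List ι := (S.queue k).filter fun i => i ∉ P

/-- Lower bound on the cost of all orders that start with `P`: the bubbles of `P` have their optimal
velocities, and those that remain have the upper bounds on their velocities that are computed
branch by branch. -/
def lowerBound (P : List ι) : ℝ :=
  S.orderCost P + ∑ k, S.listCost (S.velAux (S.velList P).getLast? (S.remaining P k))

/-- The children of the node `P`: the next bubble is the first in the queue of some branch. -/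
def children (P : List ι) : Multiset (List ι) :=
  ∑ k, (((S.remaining P k).head?.map fun i => P ++ [i]).toList : Multiset (List ι))

/-- A complete order of passage that respects the order on each branch. -/
structure IsOrder (P : List ι) : Prop where
  perm : P.Perm S.bubbles
  respects : ∀ i ∈ P, ∀ q ∈ P, S.R i q → P.idxOf i < P.idxOf q

/-- A step of the branch-and-bound search. The state consists of the best order found so far and of
the nodes of the tree that are still to be explored; any of these can be explored next. -/
inductive Step : List ι × Multiset (List ι) → List ι × Multiset (List ι) → Prop
  | improve (best P : List ι) (rest : Multiset (List ι)) (hP : P.Perm S.bubbles)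
      (h : S.orderCost P < S.orderCost best) : Step (best, P ::ₘ rest) (P, rest)
  | reject (best P : List ι) (rest : Multiset (List ι)) (hP : P.Perm S.bubbles)
      (h : S.orderCost best ≤ S.orderCost P) : Step (best, P ::ₘ rest) (best, rest)
  | prune (best P : List ι) (rest : Multiset (List ι)) (hP : ¬P.Perm S.bubbles) (hne : P ≠ [])
      (h : S.orderCost best < S.lowerBound P) : Step (best, P ::ₘ rest) (best, rest)
  | expand (best P : List ι) (rest : Multiset (List ι)) (hP : ¬P.Perm S.bubbles)
      (h : P = [] ∨ S.lowerBound P ≤ S.orderCost best) :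
      Step (best, P ::ₘ rest) (best, S.children P + rest)

/-- `P` is an output of the schedule optimization: it is the best order when the search, which
starts from an arbitrary candidate order and the root of the tree, has no node left. -/
def IsOutput (P : List ι) : Prop :=
  ∃ P₀, S.IsOrder P₀ ∧ Relation.ReflTransGen S.Step (P₀, {[]}) (P, 0)

/-- Every execution of the search from a candidate order ends after finitely many steps. -/
def SearchTerminates : Prop :=
  ∀ P₀, S.IsOrder P₀ → ¬∃ a : ℕ → List ι × Multiset (List ι),
    a 0 = (P₀, {[]}) ∧ ∀ n, S.Step (a n) (a (n + 1))

end SchedProblem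

/-! ### Bubbles and the evolution of the traffic -/

/-- A bubble: its branch and its vehicles. The vehicles of a branch are numbered `0, 1, 2, …` in the
order of their arrival; vehicle `n + 1` immediately follows vehicle `n`. -/
@[ext]
structure Bubble where
  branch : Fin 4
  members : Finset ℕ

instance : DecidableEq Bubble := Classical.decEq _

namespace Bubble

/-- The lead vehicle. -/
def lead (b : Bubble) : ℕ := sInf (b.members : Set ℕ)

/-- Number of vehicles of the bubble in front of vehicle `n`, that is `j - 1` for the `j`-th
vehicle. -/
def rank (b : Bubble) (n : ℕ) : ℕ := (b.members.filter fun l => l < n).card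

end Bubble

/-- Sum of the squared distances to the center of the cluster. -/
def sumOfSquares (pos : ℕ → ℝ) (C : Finset (Finset ℕ)) : ℝ :=
  ∑ B ∈ C, ∑ n ∈ B, (pos n - (∑ l ∈ B, pos l) / (B.card : ℝ)) ^ 2

/-- Everything that happens over time: the traffic, and the decisions of the intersection
manager. The first arguments are always the branch and the number of the vehicle. -/
structure Evolution where
  /-- number of vehicles that ever appear on a branch (possibly infinite) -/
  count : Fin 4 → ℕ∞
  /-- time at which a vehicle appears -/
  spawn : Fin 4 → ℕ → ℝ
  /-- position of the front, relative to the beginning of the intersection -/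
  x : Fin 4 → ℕ → ℝ → ℝ
  /-- velocity -/
  v : Fin 4 → ℕ → ℝ → ℝ
  /-- acceleration -/
  u : Fin 4 → ℕ → ℝ → ℝ
  /-- the clusters formed at the `s`-th instance on a branch -/
  clusters : ℕ → Fin 4 → Finset (Finset ℕ)
  /-- the order of passage decided at the `s`-th instance -/
  order : ℕ → List Bubble

namespace Evolution

variable (e : Evolution) (p : Params)

/-- Vehicle `n` of branch `k` belongs to a bubble formed before the `s`-th instance. -/
def ClusteredBefore (s : ℕ) (k : Fin 4) (n : ℕ) : Prop :=
  ∃ r < s, ∃ B ∈ e.clusters r k, n ∈ B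

/-- The vehicles in the staging zone of branch `k` that do not yet belong to a bubble at the `s`-th
instance. -/
def newVehicles (s : ℕ) (k : Fin 4) : Set ℕ :=
  {n | (n : ℕ∞) < e.count k ∧ e.spawn k n ≤ p.instant s ∧
    e.x k n (p.instant s) ∈ p.stagingZone ∧ ¬e.ClusteredBefore s k n}

/-- The new bubbles of the `s`-th instance. -/
def newBubbles (s : ℕ) : Finset Bubble :=
  Finset.univ.biUnion fun k => (e.clusters s k).image (Bubble.mk k)

/-- Position of the lead vehicle. -/
def bubblePos (b : Bubble) (t : ℝ) : ℝ := e.x b.branch b.lead t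

/-- The safety ratio `σ` of vehicle `n` with respect to vehicle `n - 1`, for `n ≥ 1`. -/
def safetyRatio (k : Fin 4) (n : ℕ) (t : ℝ) : ℝ :=
  (e.x k (n - 1) t - e.x k n t) / p.safeDist (e.v k (n - 1) t) (e.v k n t)

/-- The vehicle is in the coupling set; the first vehicle of a branch never is. -/
def Coupled (k : Fin 4) (n : ℕ) (t : ℝ) : Prop :=
  1 ≤ n ∧ (e.v k (n - 1) t, e.v k n t, e.safetyRatio p k n t) ∈ p.couplingSet

open Classical in
/-- The previously scheduled bubbles that are scheduled again at the `s`-th instance. -/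
def retained : ℕ → List Bubble
  | 0 => []
  | s + 1 =>
    let l := (e.order s).filter fun b =>
      e.bubblePos b (p.instant (s + 1)) ∈ p.stagingZone ∪ p.midZone
    l.drop ((e.newBubbles (s + 1)).card + l.length - p.Nbar)

/-- The scheduling problem of the `s`-th instance, given the earliest approach time. -/
def problemWith (T : ℝ) (F : ℕ → Bubble → ℝ → ℝ) (s : ℕ) (tauMin : ℝ) : SchedProblem Bubble where
  bubbles := e.retained p s ++ (e.newBubbles s).toList
  now := p.instant s
  branch := Bubble.branch
  pos b := e.bubblePos b (p.instant s)
  size b := b.members.card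
  occ b := p.occBound T b.members.card
  vLo b := (((-e.bubblePos b (p.instant s) : ℝ) : EReal) /
    ⨅ n : {n // n ∈ b.members},
      (p.latestDuration (-e.x b.branch n (p.instant s)) (e.v b.branch n (p.instant s)) -
        ((b.rank n * p.Tnom : ℝ) : EReal))).toReal
  vHi b := -e.bubblePos b (p.instant s) /
    ⨆ n : {n // n ∈ b.members},
      (p.earliestDuration (-e.x b.branch n (p.instant s)) (e.v b.branch n (p.instant s)) -
        b.rank n * p.Tnom)
  tauMin := tauMin
  F := F s
  WT := p.WT

/-- The approach times in force after the `s`-th scheduling (those of the latest scheduling of each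
bubble), and the earliest approach time used in it. -/
def scheduleState (T : ℝ) (F : ℕ → Bubble → ℝ → ℝ) : ℕ → (Bubble → ℝ) × ℝ
  | 0 =>
    let S := e.problemWith p T F 0 0
    (fun b => S.timeOf b (S.velOpt (e.order 0) b), 0)
  | s + 1 =>
    let prev := scheduleState T F s
    let tauMin := ((e.order s).filter fun b => b ∉ e.retained p (s + 1)).foldr
      (fun b a => max (prev.1 b + p.occBound T b.members.card) a) prev.2
    let S := e.problemWith p T F (s + 1) tauMin
    (fun b => if b ∈ e.order (s + 1) then S.timeOf b (S.velOpt (e.order (s + 1)) b) else prev.1 b,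
      tauMin)

/-- The approach time `τ_b` in force after the `s`-th scheduling. -/
def tau (T : ℝ) (F : ℕ → Bubble → ℝ → ℝ) (s : ℕ) (b : Bubble) : ℝ := (e.scheduleState p T F s).1 b

/-- The scheduling problem of the `s`-th instance. -/
def problem (T : ℝ) (F : ℕ → Bubble → ℝ → ℝ) (s : ℕ) : SchedProblem Bubble :=
  e.problemWith p T F s (e.scheduleState p T F s).2

/-- The approach time `τ_{i,j}` of the vehicle that is in force at time `t`. -/
def vehicleTau (T : ℝ) (F : ℕ → Bubble → ℝ → ℝ) (b : Bubble) (n : ℕ) (t : ℝ) : ℝ :=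
  e.tau p T F ⌊t / p.Tcs⌋₊ b + b.rank n * p.Tnom

/-- The times at which the bubble uses the intersection: some vehicle of it has its front beyond the
beginning and its rear not beyond the end of the intersection. -/
def occupancy (b : Bubble) : Set ℝ :=
  {t | ∃ n ∈ b.members, e.spawn b.branch n ≤ t ∧ e.x b.branch n t ∈ Icc 0 (p.Δ + p.L)}

/-- The traffic evolves under the clustering, the scheduling and the local controllers. -/
structure IsClosedLoop (T : ℝ) (F : ℕ → Bubble → ℝ → ℝ) : Prop where
  /-- the vehicles are numbered in the order of their arrival -/
  spawn_mono : ∀ k, Monotone (e.spawn k)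
  spawn_finite : ∀ k t, {n : ℕ | (n : ℕ∞) < e.count k ∧ e.spawn k n ≤ t}.Finite
  /-- initially the vehicles are in the staging zone, and later vehicles appear at the beginning of
  the branch -/
  spawn_pos : ∀ k (n : ℕ), (n : ℕ∞) < e.count k →
    (e.spawn k n = 0 ∧ e.x k n 0 ∈ p.stagingZone) ∨
      (0 < e.spawn k n ∧ e.x k n (e.spawn k n) = p.start)
  spawn_vel : ∀ k (n : ℕ), (n : ℕ∞) < e.count k → e.v k n (e.spawn k n) ∈ Icc 0 p.vMax
  /-- `ẋ = v` and `v̇ = u`, in the sense of Carathéodory -/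
  dynamics : ∀ k (n : ℕ), (n : ℕ∞) < e.count k → ∀ t ≥ e.spawn k n,
    IntervalIntegrable (e.u k n) volume (e.spawn k n) t ∧
    e.v k n t = e.v k n (e.spawn k n) + ∫ r in (e.spawn k n)..t, e.u k n r ∧
    e.x k n t = e.x k n (e.spawn k n) + ∫ r in (e.spawn k n)..t, e.v k n r
  /-- until a vehicle belongs to a bubble, its motion is only subject to the general limits -/
  unclustered : ∀ k (n : ℕ), (n : ℕ∞) < e.count k → ∀ t ≥ e.spawn k n,
    (∀ s, p.instant s ≤ t → ¬∃ B ∈ e.clusters s k, n ∈ B) →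
    e.v k n t ∈ Icc 0 p.vMax ∧ e.u k n t ∈ Icc p.uMin p.uMax
  /-- at every instance the new vehicles on each branch are clustered by position with the
  `M`-means criterion -/
  clustering : ∀ s k, ∃ (A : Finset ℕ) (C : Finpartition A),
    (A : Set ℕ) = e.newVehicles p s k ∧ C.parts = e.clusters s k ∧
    C.parts.card = min A.card (p.NbarBranch k) ∧
    ∀ C' : Finpartition A, C'.parts.card = C.parts.card →
      sumOfSquares (fun n => e.x k n (p.instant s)) C.parts ≤
        sumOfSquares (fun n => e.x k n (p.instant s)) C'.parts
  /-- at every instance the order of passage is computed by the schedule optimization -/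
  scheduling : ∀ s, (e.problem p T F s).IsOutput (e.order s)
  /-- the vehicles of the bubbles use the local switching controller: at every time the line of the
  controller that is selected by the switching rule is the one applied for some time -/
  control : ∀ s, ∀ b ∈ e.newBubbles s, ∀ n ∈ b.members, ∀ t ≥ p.instant s, ∃ ε > 0,
    ∀ r ∈ Ico t (t + ε), e.u b.branch n r =
      p.localControl (e.Coupled p b.branch n t) (e.vehicleTau p T F b n r) r
        (e.x b.branch n r) (e.v b.branch n r) (e.v b.branch (n - 1) r)
        (e.safetyRatio p b.branch n r) (e.u b.branch (n - 1) r)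

end Evolution

end Intersection

end

/-!
The proof combines three arguments: on the motion of a single vehicle and of its follower, on the
scheduling problem at one instance, and on the sequence of the schedules.

*Safety.* While the follower is faster and below the safe distance, the safe-following control makes
the safe distance shrink at least as fast as the actual distance and does not let the relative speed
grow; while the follower is not faster, the distance grows and the safe distance is constant. So the
distance never falls below the safe one (`safeDist_le_of_law`).

*Arrival.* The uncoupled controller acts as a feedback law. It compares the distance to go with the
distance `Params.holdDist` covered if the present speed is held as long as possible before a final ramp up
to the nominal speed: it brakes if there is less to go (`Params.initialAccel_of_lt_holdDist`) and accelerates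
if there is more (`Params.initialAccel_of_holdDist_lt`). With room to stop and to speed up again, which the
exit zones provide, no vehicle is early (`neg_of_lt_tau`). The only delicate state is a vehicle at
rest at the distance of the final ramp, which could not brake; it is not reached
(`vel_pos_of_holdDist_eq`). A vehicle that is not in time has accelerated fully since the last moment
at which it was coupled to its predecessor (`arrival_dichotomy`). At that moment it was at most `σ₀`
safe distances behind, and the definition of `Tiat` is such that this distance is made up within
`Tiat` after the arrival of the predecessor (`Params.follower_maxDist`, by concavity of the covered distance
in the speed, and `arrival_of_coupled`). By induction along the branch, the vehicles of a bubble arrive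
at intervals of at most `T`, the first one exactly at the approach time of the bubble
(`Evolution.Admissible.arrives`).

*Scheduling.* For a fixed order of passage, the recursion gives every bubble the earliest approach
time that the bubbles before it permit. As the costs are nonincreasing functions of the velocity, it
is optimal for this order (`SchedProblem.Regular.listCost_le_of_pairwise`), and every feasible choice
of velocities defines an order (`SchedProblem.Regular.exists_isOrder_le`). Leaving out bubbles makes
the others pass earlier, which validates the lower bounds of the branch and bound
(`SchedProblem.lowerBound_le`). Hence the search keeps the invariant that every order either does not
improve on the best one or extends an open node (`SchedProblem.SearchInv`), and it is finite because
a weighted count of the open nodes decreases (`SchedProblem.SearchInv.weight_lt`).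

*Sequence of schedules.* An optimal cluster is an interval (`mem_of_between_of_optimal`), since
otherwise the exchange of two points would lower the sum of squares; so a bubble consists of
consecutive vehicles. On each branch, the bubbles that are not rescheduled are those in front
(`Evolution.Admissible.removed_of_front`), and their windows are over by the time `tauMin`
(`Evolution.Admissible.tau_ge_of_removed`), after which the rescheduled ones pass. This makes all
windows disjoint (`Evolution.Admissible.windows`).

*A last schedule.* The bubbles in front of the intersection contain a bounded number of vehicles,
which keeps the approach times within a constant horizon (`Evolution.Admissible.exists_tau_le`). A
slow lead vehicle of a bubble that is still rescheduled thus has more room than it needs and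
accelerates, so that its speed is bounded below and the bubble leaves the mid zone
(`Evolution.Admissible.exists_not_mem_order`).
-/

namespace Intersection

/-! ### Continuous functions on an interval: last exits, first hits, continuation -/

theorem exists_last_nonneg {f : ℝ → ℝ} {a b : ℝ} (hab : a ≤ b) (hf : ContinuousOn f (Icc a b))
    (ha : 0 ≤ f a) (hb : f b < 0) : ∃ c ∈ Ico a b, f c = 0 ∧ ∀ t ∈ Ioc c b, f t < 0 := by
  have hc : IsCompact (Icc a b ∩ f ⁻¹' Ici 0) :=
    isCompact_Icc.of_isClosed_subset (hf.preimage_isClosed_of_isClosed isClosed_Icc isClosed_Ici)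
      inter_subset_left
  obtain ⟨c, ⟨hcI, hc0⟩, hmax⟩ := hc.exists_isGreatest ⟨a, ⟨left_mem_Icc.2 hab, ha⟩⟩
  have hlt : ∀ t ∈ Ioc c b, f t < 0 := fun t ht => by
    by_contra! h
    exact absurd (hmax ⟨⟨hcI.1.trans ht.1.le, ht.2⟩, h⟩) (not_le.2 ht.1)
  have hcb : c < b := lt_of_le_of_ne hcI.2 (by rintro rfl; exact absurd hb (not_lt.2 hc0))
  refine ⟨c, ⟨hcI.1, hcb⟩, le_antisymm ?_ hc0, hlt⟩
  by_contra! hpos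
  obtain ⟨t, ht, ht0⟩ := intermediate_value_Icc' hcb.le
    (hf.mono (Icc_subset_Icc_left hcI.1)) (show f b / 2 ∈ Icc (f b) (f c) by constructor <;> linarith)
  have h1 : t ≠ b := by rintro rfl; linarith
  have h2 : c ≠ t := by rintro rfl; linarith
  obtain ⟨s, hs, hs0⟩ := intermediate_value_Icc' ht.1
    (hf.mono (Icc_subset_Icc hcI.1 ht.2)) (show (0 : ℝ) ∈ Icc (f t) (f c) by constructor <;> linarith)
  have h3 : c ≠ s := by rintro rfl; linarith
  have := hlt s ⟨lt_of_le_of_ne hs.1 h3, hs.2.trans ht.2⟩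
  linarith

theorem exists_first_nonpos {f : ℝ → ℝ} {a b : ℝ} (hab : a ≤ b) (hf : ContinuousOn f (Icc a b))
    (ha : 0 < f a) (hb : f b ≤ 0) : ∃ c ∈ Ioc a b, f c = 0 ∧ ∀ t ∈ Ico a c, 0 < f t := by
  have hc : IsCompact (Icc a b ∩ f ⁻¹' Iic 0) :=
    isCompact_Icc.of_isClosed_subset (hf.preimage_isClosed_of_isClosed isClosed_Icc isClosed_Iic)
      inter_subset_left
  obtain ⟨c, ⟨hcI, hc0⟩, hmin⟩ := hc.exists_isLeast ⟨b, ⟨right_mem_Icc.2 hab, hb⟩⟩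
  have hlt : ∀ t ∈ Ico a c, 0 < f t := fun t ht => by
    by_contra! h
    exact absurd (hmin ⟨⟨ht.1, ht.2.le.trans hcI.2⟩, h⟩) (not_le.2 ht.2)
  have hac : a < c := lt_of_le_of_ne hcI.1 (by rintro rfl; exact absurd ha (not_lt.2 hc0))
  refine ⟨c, ⟨hac, hcI.2⟩, le_antisymm hc0 ?_, hlt⟩
  by_contra! hneg
  obtain ⟨s, hs, hs0⟩ := intermediate_value_Icc' hac.le
    (hf.mono (Icc_subset_Icc_right hcI.2)) (show (0 : ℝ) ∈ Icc (f c) (f a) by constructor <;> linarith)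
  have h3 : s ≠ c := by rintro rfl; linarith
  have := hlt s ⟨hs.1, lt_of_le_of_ne hs.2 h3⟩
  linarith

/-- A continuous function stays nonnegative if it does so a little beyond every zero. -/
theorem nonneg_on_of_continuation {f : ℝ → ℝ} {a b : ℝ} (hf : ContinuousOn f (Icc a b))
    (ha : 0 ≤ f a)
    (hstep : ∀ c ∈ Ico a b, (∀ t ∈ Icc a c, 0 ≤ f t) → f c = 0 →
      ∃ δ > 0, ∀ t ∈ Icc c (min b (c + δ)), 0 ≤ f t) :
    ∀ t ∈ Icc a b, 0 ≤ f t := by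
  by_contra! hcon
  obtain ⟨t₁, ht₁, hneg⟩ := hcon
  set Z := {t | t ∈ Icc a b ∧ f t < 0} with hZ
  have hne : Z.Nonempty := ⟨t₁, ht₁, hneg⟩
  have hbd : BddBelow Z := ⟨a, fun t ht => ht.1.1⟩
  set c := sInf Z with hc
  have hac : a ≤ c := le_csInf hne fun t ht => ht.1.1
  have hct : c ≤ t₁ := csInf_le hbd ⟨ht₁, hneg⟩
  have hbefore : ∀ t ∈ Icc a b, t < c → 0 ≤ f t := fun t ht htc => by
    by_contra! h
    exact absurd (csInf_le hbd ⟨ht, h⟩) (not_le.2 htc)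
  have hcI : c ∈ Icc a b := ⟨hac, hct.trans ht₁.2⟩
  have hfc : 0 ≤ f c := by
    by_contra! h
    obtain ⟨d, hd, hd0, hlt⟩ := exists_last_nonneg hac (hf.mono (Icc_subset_Icc_right hcI.2)) ha h
    have hm : (d + c) / 2 ∈ Ioc d c := by constructor <;> linarith [hd.2]
    have h1 := hlt _ hm
    have h2 := hbefore ((d + c) / 2) ⟨by linarith [hd.1, hd.2], by linarith [hcI.2, hd.2]⟩
      (by linarith [hd.2])
    linarith
  have hall : ∀ t ∈ Icc a c, 0 ≤ f t := fun t ht => by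
    rcases ht.2.lt_or_eq with h | h
    · exact hbefore t ⟨ht.1, ht.2.trans hcI.2⟩ h
    · rw [h]; exact hfc
  have hct' : c < t₁ := lt_of_le_of_ne hct (by rintro h; rw [← h] at hneg; linarith)
  have hcb : c ∈ Ico a b := ⟨hac, hct'.trans_le ht₁.2⟩
  have key : ∃ δ > 0, ∀ t ∈ Icc c (min b (c + δ)), 0 ≤ f t := by
    rcases hfc.eq_or_lt with h | h
    · exact hstep c hcb hall h.symm
    · have := (hf c hcI).eventually (lt_mem_nhds h)
      rw [Filter.eventually_iff, Metric.mem_nhdsWithin_iff] at this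
      obtain ⟨ε, hε, hsub⟩ := this
      refine ⟨ε / 2, by positivity, fun t ht => le_of_lt (hsub ⟨?_, ?_, ?_⟩)⟩
      · rw [Metric.mem_ball, Real.dist_eq, abs_lt]
        have := ht.2.trans (min_le_right _ _)
        constructor <;> linarith [ht.1]
      · exact hac.trans ht.1
      · exact ht.2.trans (min_le_left _ _)
  obtain ⟨δ, hδ, hpos⟩ := key
  obtain ⟨t, ht, htlt⟩ := exists_lt_of_csInf_lt hne (show c < c + δ by linarith)
  have h1 : c ≤ t := csInf_le hbd ht
  have := hpos t ⟨h1, le_min ht.1.2 htlt.le⟩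
  exact absurd ht.2 (not_lt.2 this)

/-! ### Carathéodory trajectories -/

/-- `x` and `v` are the position and the velocity that result from the integrable control `u`,
from time `t₀` on. -/
structure Traj (x v u : ℝ → ℝ) (t₀ : ℝ) : Prop where
  int : ∀ t ≥ t₀, IntervalIntegrable u volume t₀ t
  vel : ∀ t ≥ t₀, v t = v t₀ + ∫ r in t₀..t, u r
  pos : ∀ t ≥ t₀, x t = x t₀ + ∫ r in t₀..t, v r

namespace Traj

variable {x v u : ℝ → ℝ} {t₀ : ℝ} (h : Traj x v u t₀)
include h

theorem int' {a b : ℝ} (ha : t₀ ≤ a) (hab : a ≤ b) : IntervalIntegrable u volume a b :=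
  (h.int a ha).symm.trans (h.int b (ha.trans hab))

theorem vel_sub {a b : ℝ} (ha : t₀ ≤ a) (hab : a ≤ b) : v b - v a = ∫ r in a..b, u r := by
  rw [h.vel a ha, h.vel b (ha.trans hab),
    ← intervalIntegral.integral_add_adjacent_intervals (h.int a ha) (h.int' ha hab)]
  ring

theorem ac_v {a b : ℝ} (ha : t₀ ≤ a) (hab : a ≤ b) : AbsolutelyContinuousOnInterval v a b := by
  have h1 := (h.int' ha hab).absolutelyContinuousOnInterval_intervalIntegral
    (c := a) (left_mem_uIcc)
  have h2 : AbsolutelyContinuousOnInterval (fun _ : ℝ => v a) a b :=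
    (LipschitzWith.const (v a)).lipschitzOnWith.absolutelyContinuousOnInterval
  rw [absolutelyContinuousOnInterval_iff]
  intro ε hε
  obtain ⟨δ, hδ, hd⟩ := (absolutelyContinuousOnInterval_iff _ _ _).1 (h2.add h1) ε hε
  refine ⟨δ, hδ, fun E hE hl => ?_⟩
  refine lt_of_eq_of_lt (Finset.sum_congr rfl fun i hi => ?_) (hd E hE hl)
  have hv : ∀ t ∈ uIcc a b, v a + ∫ r in a..t, u r = v t := fun t ht => by
    rw [uIcc_of_le hab] at ht
    have := h.vel_sub ha ht.1
    linarith
  have hm := hE.1 i hi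
  simp only [Pi.add_apply]
  rw [hv _ hm.1, hv _ hm.2]

theorem continuousOn_v : ContinuousOn v (Ici t₀) := by
  intro t ht
  have h1 := (h.ac_v le_rfl (show t₀ ≤ t + 1 by linarith [mem_Ici.1 ht])).continuousOn
  rw [uIcc_of_le (by linarith [mem_Ici.1 ht])] at h1
  refine (h1 t ⟨ht, by linarith⟩).mono_of_mem_nhdsWithin ?_
  rw [mem_nhdsWithin]
  exact ⟨Iio (t + 1), isOpen_Iio, by simp, fun r hr => ⟨hr.2, hr.1.le⟩⟩

theorem cont_v {a b : ℝ} (ha : t₀ ≤ a) : ContinuousOn v (Icc a b) :=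
  h.continuousOn_v.mono fun _ ht => ha.trans ht.1

theorem int_v {a b : ℝ} (ha : t₀ ≤ a) (hab : a ≤ b) : IntervalIntegrable v volume a b :=
  (h.cont_v ha).intervalIntegrable_of_Icc hab

theorem pos_sub {a b : ℝ} (ha : t₀ ≤ a) (hab : a ≤ b) : x b - x a = ∫ r in a..b, v r := by
  rw [h.pos a ha, h.pos b (ha.trans hab),
    ← intervalIntegral.integral_add_adjacent_intervals (h.int_v le_rfl ha) (h.int_v ha hab)]
  ring

theorem continuousOn_x : ContinuousOn x (Ici t₀) := by
  intro t ht
  have h0 : t₀ ≤ t + 1 := by linarith [mem_Ici.1 ht]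
  have h1 : ContinuousOn (fun t => ∫ r in t₀..t, v r) (uIcc t₀ (t + 1)) :=
    intervalIntegral.continuousOn_primitive_interval
      ((h.cont_v le_rfl).integrableOn_Icc.mono_set (by rw [uIcc_of_le h0]))
  have h2 : ContinuousOn x (Icc t₀ (t + 1)) := by
    rw [uIcc_of_le h0] at h1
    exact (continuousOn_const.add h1).congr fun r hr => h.pos r hr.1
  refine (h2 t ⟨ht, by linarith⟩).mono_of_mem_nhdsWithin ?_
  rw [mem_nhdsWithin]
  exact ⟨Iio (t + 1), isOpen_Iio, by simp, fun r hr => ⟨hr.2, hr.1.le⟩⟩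

theorem cont_x {a b : ℝ} (ha : t₀ ≤ a) : ContinuousOn x (Icc a b) :=
  h.continuousOn_x.mono fun _ ht => ha.trans ht.1

theorem mono {t₁ : ℝ} (ht : t₀ ≤ t₁) : Traj x v u t₁ where
  int t h1 := h.int' ht h1
  vel t h1 := by have := h.vel_sub ht h1; linarith
  pos t h1 := by have := h.pos_sub ht h1; linarith

theorem vel_sub_le {a b c : ℝ} (ha : t₀ ≤ a) (hab : a ≤ b) (hu : ∀ r ∈ Ioo a b, u r ≤ c) :
    v b - v a ≤ c * (b - a) := by
  rw [h.vel_sub ha hab]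
  have := intervalIntegral.integral_mono_on_of_le_Ioo hab (h.int' ha hab)
    (intervalIntegrable_const (c := c)) hu
  simpa [mul_comm] using this

theorem le_vel_sub {a b c : ℝ} (ha : t₀ ≤ a) (hab : a ≤ b) (hu : ∀ r ∈ Ioo a b, c ≤ u r) :
    c * (b - a) ≤ v b - v a := by
  rw [h.vel_sub ha hab]
  have := intervalIntegral.integral_mono_on_of_le_Ioo hab
    (intervalIntegrable_const (c := c)) (h.int' ha hab) hu
  simpa [mul_comm] using this

theorem pos_sub_le {a b : ℝ} {f : ℝ → ℝ} (ha : t₀ ≤ a) (hab : a ≤ b)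
    (hf : IntervalIntegrable f volume a b) (hv : ∀ r ∈ Icc a b, v r ≤ f r) :
    x b - x a ≤ ∫ r in a..b, f r := by
  rw [h.pos_sub ha hab]
  exact intervalIntegral.integral_mono_on hab (h.int_v ha hab) hf hv

theorem le_pos_sub {a b : ℝ} {f : ℝ → ℝ} (ha : t₀ ≤ a) (hab : a ≤ b)
    (hf : IntervalIntegrable f volume a b) (hv : ∀ r ∈ Icc a b, f r ≤ v r) :
    ∫ r in a..b, f r ≤ x b - x a := by
  rw [h.pos_sub ha hab]
  exact intervalIntegral.integral_mono_on hab hf (h.int_v ha hab) hv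

theorem pos_sub_le_const {a b c : ℝ} (ha : t₀ ≤ a) (hab : a ≤ b) (hv : ∀ r ∈ Icc a b, v r ≤ c) :
    x b - x a ≤ c * (b - a) := by
  simpa [mul_comm] using h.pos_sub_le ha hab (intervalIntegrable_const (c := c)) hv

theorem const_le_pos_sub {a b c : ℝ} (ha : t₀ ≤ a) (hab : a ≤ b) (hv : ∀ r ∈ Icc a b, c ≤ v r) :
    c * (b - a) ≤ x b - x a := by
  simpa [mul_comm] using h.le_pos_sub ha hab (intervalIntegrable_const (c := c)) hv

theorem pos_mono {a b : ℝ} (ha : t₀ ≤ a) (hab : a ≤ b) (hv : ∀ r ∈ Icc a b, 0 ≤ v r) :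
    x a ≤ x b := by
  have := h.const_le_pos_sub ha hab hv
  linarith

theorem vel_of_const {a b c : ℝ} (ha : t₀ ≤ a) (hu : ∀ r ∈ Ioo a b, u r = c) :
    ∀ t ∈ Icc a b, v t = v a + c * (t - a) := fun t ht => by
  have h1 := h.vel_sub_le ha ht.1 fun r hr => (hu r ⟨hr.1, hr.2.trans_le ht.2⟩).le
  have h2 := h.le_vel_sub ha ht.1 fun r hr => (hu r ⟨hr.1, hr.2.trans_le ht.2⟩).ge
  linarith

theorem pos_of_const {a b c : ℝ} (ha : t₀ ≤ a) (hu : ∀ r ∈ Ioo a b, u r = c) :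
    ∀ t ∈ Icc a b, x t = x a + v a * (t - a) + c * (t - a) ^ 2 / 2 := fun t ht => by
  have h1 := h.pos_sub ha ht.1
  have h2 : ∫ r in a..t, v r = ∫ r in a..t, (v a + c * (r - a)) := by
    refine intervalIntegral.integral_congr fun r hr => ?_
    rw [uIcc_of_le ht.1] at hr
    exact h.vel_of_const ha hu r ⟨hr.1, hr.2.trans ht.2⟩
  have h3 : ∫ r in a..t, (v a + c * (r - a)) = v a * (t - a) + c * (t - a) ^ 2 / 2 := by
    have hd : ∀ r ∈ uIcc a t, HasDerivAt (fun r => v a * r + c * (r - a) ^ 2 / 2)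
        (v a + c * (r - a)) r := fun r _ => by
      have := ((hasDerivAt_id r).const_mul (v a)).add
        (((((hasDerivAt_id r).sub_const a).pow 2).const_mul c).div_const 2)
      exact this.congr_deriv (by simp; ring)
    rw [intervalIntegral.integral_eq_sub_of_hasDerivAt hd
      (by apply Continuous.intervalIntegrable; fun_prop)]
    ring
  linarith

/-- If `u ≥ m` whenever the speed is below `c`, then the speed is at least that of an acceleration
with `m` that stops at `c`. -/
theorem min_le_vel {a b c m : ℝ} (ha : t₀ ≤ a)
    (hu : ∀ r ∈ Ioc a b, v r < c → m ≤ u r) (hm : 0 ≤ m) :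
    ∀ t ∈ Icc a b, min c (v a + m * (t - a)) ≤ v t := fun t ht => by
  by_contra! hlt
  have hc : v t < c := hlt.trans_le (min_le_left _ _)
  have hlow : v t < v a + m * (t - a) := hlt.trans_le (min_le_right _ _)
  by_cases hall : ∀ r ∈ Icc a t, v r < c
  · have := h.le_vel_sub ha ht.1 fun r hr => hu r ⟨hr.1, hr.2.le.trans ht.2⟩
      (hall r ⟨hr.1.le, hr.2.le⟩)
    linarith
  · push Not at hall
    obtain ⟨r, hr, hrc⟩ := hall
    obtain ⟨d, hd, hd0, hd1⟩ := exists_last_nonneg (f := fun s => v s - c) hr.2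
      ((h.cont_v (ha.trans hr.1)).sub continuousOn_const) (by linarith) (by linarith)
    have := h.le_vel_sub (ha.trans (hr.1.trans hd.1)) hd.2.le fun s hs =>
      hu s ⟨(hr.1.trans hd.1).trans_lt hs.1, hs.2.le.trans ht.2⟩
        (by linarith [hd1 s ⟨hs.1, hs.2.le⟩])
    nlinarith [hd.2]

theorem integral_vel_mul {a b : ℝ} (ha : t₀ ≤ a) (hab : a ≤ b) :
    ∫ r in a..b, v r * u r = (v b ^ 2 - v a ^ 2) / 2 := by
  have hac := h.ac_v ha hab
  have h1 := hac.integral_deriv_mul_eq_sub hac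
  have h2 : ∫ r in a..b, (deriv v r * v r + v r * deriv v r) = ∫ r in a..b, 2 * (v r * u r) := by
    refine intervalIntegral.integral_congr_ae ?_
    have hne : ∀ᵐ r : ℝ, r ≠ b := by simp [ae_iff, measure_singleton]
    filter_upwards [(h.int' ha hab).ae_hasDerivAt_integral, hne] with r hr hrb hmem
    rw [uIoc_of_le hab] at hmem
    have hd := hr (by rw [uIcc_of_le hab]; exact ⟨hmem.1.le, hmem.2⟩) a left_mem_uIcc
    have hdv : HasDerivAt v (u r) r := by
      refine (hd.const_add (v a)).congr_of_eventuallyEq ?_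
      filter_upwards [Ioo_mem_nhds hmem.1 (lt_of_le_of_ne hmem.2 hrb)] with s hs
      have := h.vel_sub ha hs.1.le
      linarith
    rw [hdv.deriv]; ring
  rw [h2, intervalIntegral.integral_const_mul] at h1
  linarith

end Traj
end Intersection
namespace Intersection
namespace Params

variable (p : Params)

/-! ### The uncoupled controller -/

theorem vMax_pos : 0 < p.vMax := p.νnom_pos.trans_le p.νnom_le

theorem neg_uMin_pos : 0 < -p.uMin := neg_pos.2 p.uMin_neg

/-- Distance covered in time `T` from speed `v` under maximum acceleration up to `vMax`. -/
noncomputable def maxDist (T v : ℝ) : ℝ :=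
  p.vMax * T - ((p.vMax - v) ^ 2 - max (p.vMax - v - p.uMax * T) 0 ^ 2) / (2 * p.uMax)

/-- The time for which the speed `v` can be held, if a ramp up to `νnom` has to end at time `T`. -/
noncomputable def slack (T v : ℝ) : ℝ := T - max (p.νnom - v) 0 / p.uMax

/-- Distance covered in time `T` if the speed `v` is held as long as possible before a final ramp up
to `νnom`. The sign of its difference to the distance to go is that of the uncoupled control. -/
noncomputable def holdDist (T v : ℝ) : ℝ := v * T + max (p.νnom - v) 0 ^ 2 / (2 * p.uMax)

/-- Distance covered by the profile that brakes from `v` to `ν`, cruises, and ramps up to `νnom` at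
the end of the time `T` if `ν` is below. -/
noncomputable def brakeDist (T v ν : ℝ) : ℝ :=
  ν * T + (v - ν) ^ 2 / (2 * -p.uMin) + max (p.νnom - ν) 0 ^ 2 / (2 * p.uMax)

/-- Duration of the cruise phase of the profile of `brakeDist`. -/
noncomputable def brakeSlack (T v ν : ℝ) : ℝ := T - (v - ν) / -p.uMin - max (p.νnom - ν) 0 / p.uMax

theorem rampTime_of_le {a b : ℝ} (h : a ≤ b) : p.rampTime a b = (b - a) / p.uMax := by
  refine max_eq_left ((div_nonpos_of_nonneg_of_nonpos (by linarith) p.uMin_neg.le).trans ?_)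
  exact div_nonneg (by linarith) p.uMax_pos.le

theorem rampTime_of_ge {a b : ℝ} (h : b ≤ a) : p.rampTime a b = (a - b) / -p.uMin := by
  have h1 : (b - a) / p.uMin = (a - b) / -p.uMin := by
    rw [div_neg, ← neg_div]; ring
  rw [rampTime, h1]
  refine max_eq_right ((div_nonpos_of_nonpos_of_nonneg (by linarith) p.uMax_pos.le).trans ?_)
  exact div_nonneg (by linarith) p.neg_uMin_pos.le

theorem rampTime_nonneg (a b : ℝ) : 0 ≤ p.rampTime a b := by
  have hu := p.uMax_pos
  have hK := p.neg_uMin_pos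
  rcases le_total a b with h | h
  · rw [p.rampTime_of_le h]; exact div_nonneg (by linarith) hu.le
  · rw [p.rampTime_of_ge h]; exact div_nonneg (by linarith) hK.le

theorem sub_le_mul_rampTime (a b : ℝ) : b - a ≤ p.uMax * p.rampTime a b := by
  have h := le_max_left ((b - a) / p.uMax) ((b - a) / p.uMin)
  rw [div_le_iff₀ p.uMax_pos] at h
  rw [rampTime]; linarith

theorem maxDist_zero {v : ℝ} (hv : v ≤ p.vMax) : p.maxDist 0 v = 0 := by
  rw [maxDist, max_eq_left (by linarith)]; simp

/-- Moving for a time `h` from speed `a` to speed `b`, with mean speed `(a + b) / 2`, does not bring a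
vehicle further than maximum acceleration. -/
theorem add_maxDist_le {h T a b : ℝ} (hh : 0 ≤ h) (hT : 0 ≤ T) (ha : a ≤ p.vMax)
    (hb : b ≤ p.vMax) (hab : b - a ≤ p.uMax * h) :
    (a + b) / 2 * h + p.maxDist T b ≤ p.maxDist (h + T) a := by
  have hu := p.uMax_pos
  simp only [maxDist]
  obtain ⟨P, rfl⟩ : ∃ P, a = p.vMax - P := ⟨p.vMax - a, by ring⟩
  obtain ⟨Q, rfl⟩ : ∃ Q, b = p.vMax - Q := ⟨p.vMax - b, by ring⟩
  simp only [sub_sub_cancel]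
  set X := max (Q - p.uMax * T) 0 with hX
  set Y := max (P - p.uMax * (h + T)) 0 with hY
  have hz : 0 ≤ p.uMax * h := by positivity
  have hmain : X ^ 2 - Y ^ 2 ≤ (P + Q) * (p.uMax * h - P + Q) := by
    have hR : P - p.uMax * h ≤ Q := by linarith
    have hT' : 0 ≤ p.uMax * T := by positivity
    have h1 : X - Y ≤ Q - (P - p.uMax * h) := by
      rw [hX, hY]
      have e : P - p.uMax * (h + T) = P - p.uMax * h - p.uMax * T := by ring
      rw [e]
      rcases max_cases (Q - p.uMax * T) 0 with ⟨h1, h1'⟩ | ⟨h1, h1'⟩ <;>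
      rcases max_cases (P - p.uMax * h - p.uMax * T) 0 with ⟨h2, h2'⟩ | ⟨h2, h2'⟩ <;>
      rw [h1, h2] <;> linarith
    have h2 : X + Y ≤ P + Q := by
      have e1 : X ≤ Q := max_le (by linarith) (by linarith)
      have e2 : Y ≤ P := max_le (by linarith) (by linarith)
      linarith
    have h3 : 0 ≤ X := le_max_right _ _
    have h4 : 0 ≤ Y := le_max_right _ _
    nlinarith
  have : ((p.vMax - P + (p.vMax - Q)) / 2 * h + (p.vMax * T - (Q ^ 2 - X ^ 2) / (2 * p.uMax)))
      = p.vMax * (h + T) - (P ^ 2 - Y ^ 2) / (2 * p.uMax)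
        + (X ^ 2 - Y ^ 2 - (P + Q) * (p.uMax * h - P + Q)) / (2 * p.uMax) := by
    field_simp; ring
  rw [this]
  have : (X ^ 2 - Y ^ 2 - (P + Q) * (p.uMax * h - P + Q)) / (2 * p.uMax) ≤ 0 :=
    div_nonpos_of_nonpos_of_nonneg (by linarith) (by positivity)
  linarith

theorem profile_le_maxDist {T d v ν w : ℝ} (h : p.IsProfile T d v ν w) (hv : v ≤ p.vMax) :
    d ≤ p.maxDist T v := by
  have h1 := p.rampTime_nonneg v ν
  have h2 := h.hold_nonneg
  have h3 := p.rampTime_nonneg ν w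
  have e1 := p.add_maxDist_le h1 (add_nonneg h2 h3) hv h.cruise_mem.2 (p.sub_le_mul_rampTime v ν)
  have e2 := p.add_maxDist_le h2 h3 h.cruise_mem.2 h.cruise_mem.2
    (by rw [sub_self]; exact mul_nonneg p.uMax_pos.le h2)
  have e3 := p.add_maxDist_le h3 le_rfl h.cruise_mem.2 h.final_mem.2 (p.sub_le_mul_rampTime ν w)
  have e4 := h.dist_eq
  rw [add_zero, p.maxDist_zero h.final_mem.2] at e3
  have e5 : p.rampTime v ν + (p.holdTime T v ν w + p.rampTime ν w) = T := by
    rw [holdTime]; ring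
  rw [e5] at e1
  simp only [rampDist] at e4
  linarith

theorem profile_slack {T d v ν w : ℝ} (h : p.IsProfile T d v ν w) : 0 ≤ p.slack T v := by
  have h1 := p.sub_le_mul_rampTime v ν
  have h3 := p.sub_le_mul_rampTime ν w
  have hT : p.rampTime v ν + p.rampTime ν w ≤ T := by
    have := h.hold_nonneg
    rw [holdTime] at this; linarith
  have h0 : 0 ≤ T := by linarith [p.rampTime_nonneg v ν, p.rampTime_nonneg ν w]
  have hu := p.uMax_pos
  have : max (p.νnom - v) 0 ≤ p.uMax * T := by
    refine max_le ?_ (by positivity)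
    have := h.final_mem.1
    nlinarith
  rw [slack, sub_nonneg, div_le_iff₀ hu]; linarith

theorem exists_isOptimalProfile {T d v ν w : ℝ} (h : p.IsProfile T d v ν w) :
    ∃ q, p.IsOptimalProfile T d v q := by
  have hr : ∀ f g : ℝ × ℝ → ℝ, Continuous f → Continuous g →
      Continuous fun q => p.rampTime (f q) (g q) := fun f g hf hg => by
    unfold rampTime; fun_prop
  have hh : Continuous fun q : ℝ × ℝ => p.holdTime T v q.1 q.2 := by
    unfold holdTime
    have h1 := hr (fun _ => v) Prod.fst continuous_const continuous_fst
    have h2 := hr Prod.fst Prod.snd continuous_fst continuous_snd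
    fun_prop
  have hd : Continuous fun q : ℝ × ℝ =>
      p.rampDist v q.1 + q.1 * p.holdTime T v q.1 q.2 + p.rampDist q.1 q.2 := by
    unfold rampDist
    have h1 := hr (fun _ => v) Prod.fst continuous_const continuous_fst
    have h2 := hr Prod.fst Prod.snd continuous_fst continuous_snd
    fun_prop
  have hc : Continuous fun q : ℝ × ℝ => profileCost v q.1 q.2 := by
    unfold profileCost; fun_prop
  let Z : Set (ℝ × ℝ) := (Icc 0 p.vMax ×ˢ Icc p.νnom p.vMax) ∩
    {q | 0 ≤ p.holdTime T v q.1 q.2 ∧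
      p.rampDist v q.1 + q.1 * p.holdTime T v q.1 q.2 + p.rampDist q.1 q.2 = d}
  have hZ : IsCompact Z := (isCompact_Icc.prod isCompact_Icc).inter_right
    ((isClosed_le continuous_const hh).inter (isClosed_eq hd continuous_const))
  have hprof : ∀ ν w, (ν, w) ∈ Z ↔ p.IsProfile T d v ν w := fun ν w =>
    ⟨fun h => ⟨h.1.1, h.1.2, h.2.1, h.2.2⟩, fun h => ⟨⟨h.1, h.2⟩, h.3, h.4⟩⟩
  obtain ⟨q, hq, hmin⟩ := hZ.exists_isMinOn ⟨(ν, w), (hprof ν w).2 h⟩ hc.continuousOn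
  exact ⟨q, (hprof _ _).1 hq, fun ν' w' h' => hmin ((hprof _ _).2 h')⟩

/-- If the distance to go is shorter than `holdDist`, an optimal profile starts by braking: braking
at once to a cruising speed is cheaper than any other way to lose the time. -/
theorem initialAccel_of_lt_holdDist {T d v : ℝ} {q : ℝ × ℝ} (hv : v ≤ p.vMax)
    (hq : p.IsOptimalProfile T d v q) (hd : d < p.holdDist T v) :
    p.initialAccel T v q = p.uMin := by
  obtain ⟨ν, w⟩ := q
  obtain ⟨⟨hν, hw, hh, hdist⟩, hmin⟩ := hq
  have hu := p.uMax_pos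
  have hK := p.neg_uMin_pos
  have hν0 := p.νnom_pos
  simp only [rampDist] at hh hdist hν hw hmin
  unfold initialAccel
  simp only
  by_cases h1 : ν < v
  · rw [if_pos h1]
  push Not at h1
  rw [if_neg (not_lt.2 h1)]
  have e1 := p.rampTime_of_le h1
  have hT : T = (ν - v) / p.uMax + p.holdTime T v ν w + p.rampTime ν w := by
    rw [← e1, holdTime]; ring
  set h2 := p.holdTime T v ν w with hh2
  rw [e1] at hdist
  by_cases hwv : v ≤ w
  · -- all speeds are at least `v`, so that the distance is at least `holdDist`
    exfalso
    have hm : max (p.νnom - v) 0 ≤ w - v := max_le (by linarith [hw.1]) (by linarith)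
    have hm' : max (p.νnom - v) 0 ^ 2 / (2 * p.uMax) ≤ (w - v) ^ 2 / (2 * p.uMax) := by
      gcongr
    rw [holdDist] at hd
    have key : v * T + (w - v) ^ 2 / (2 * p.uMax) ≤ d := by
      rcases le_total ν w with h3 | h3
      · rw [p.rampTime_of_le h3] at hdist hT
        rw [← hdist, hT]
        have : (v + ν) / 2 * ((ν - v) / p.uMax) + ν * h2 + (ν + w) / 2 * ((w - ν) / p.uMax) -
          (v * ((ν - v) / p.uMax + h2 + (w - ν) / p.uMax) + (w - v) ^ 2 / (2 * p.uMax)) =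
          (ν - v) * h2 := by field_simp; ring
        have := mul_nonneg (sub_nonneg.2 h1) hh
        linarith
      · rw [p.rampTime_of_ge h3] at hdist hT
        rw [← hdist, hT]
        have e : (v + ν) / 2 * ((ν - v) / p.uMax) + ν * h2 + (ν + w) / 2 * ((ν - w) / -p.uMin) -
          (v * ((ν - v) / p.uMax + h2 + (ν - w) / -p.uMin) + (w - v) ^ 2 / (2 * p.uMax)) =
          (ν - v) * h2 + (ν - w) * (ν - v + (w - v)) / (2 * p.uMax)
          + (ν - v + (w - v)) * (ν - w) / (2 * -p.uMin) := by
          have := hK.ne'; have := p.uMin_neg.ne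
          field_simp; ring
        have a1 := mul_nonneg (sub_nonneg.2 h1) hh
        have a2 : 0 ≤ (ν - w) * (ν - v + (w - v)) / (2 * p.uMax) :=
          div_nonneg (mul_nonneg (by linarith) (by linarith)) (by positivity)
        have a3 : 0 ≤ (ν - v + (w - v)) * (ν - w) / (2 * -p.uMin) :=
          div_nonneg (mul_nonneg (by linarith) (by linarith)) (by positivity)
        linarith
    linarith
  push Not at hwv
  have h3 : w ≤ ν := by linarith
  by_cases h4 : ν = v ∧ h2 = 0
  · rw [if_neg (by linarith [h4.1]), if_neg (by linarith [h4.2]), if_pos (by linarith [h4.1])]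
  exfalso
  rw [p.rampTime_of_ge h3] at hdist hT
  have hD0 : p.holdDist T v = v * T := by
    rw [holdDist, max_eq_right (by linarith [hw.1])]; simp
  rw [hD0] at hd
  -- braking at once to `m ∈ (w, v)`
  set g : ℝ → ℝ := fun m => m * T + (v - m) ^ 2 / (2 * -p.uMin) with hg
  have hgw : g w < d := by
    have e : (v + ν) / 2 * ((ν - v) / p.uMax) + ν * h2 + (ν + w) / 2 * ((ν - w) / -p.uMin) -
        w * ((ν - v) / p.uMax + h2 + (ν - w) / -p.uMin) =
        (ν - v) * (v + ν - 2 * w) / (2 * p.uMax) + (ν - w) * h2 + (ν - w) ^ 2 / (2 * -p.uMin) := by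
      have := hK.ne'; have := p.uMin_neg.ne
      field_simp; ring
    have hsq : (v - w) ^ 2 / (2 * -p.uMin) ≤ (ν - w) ^ 2 / (2 * -p.uMin) := by
      gcongr
    have a1 : 0 ≤ (ν - v) * (v + ν - 2 * w) / (2 * p.uMax) :=
      div_nonneg (mul_nonneg (by linarith) (by linarith)) (by positivity)
    have a2 : 0 ≤ (ν - w) * h2 := mul_nonneg (by linarith) hh
    have hlt : 0 < (ν - v) * (v + ν - 2 * w) / (2 * p.uMax) + (ν - w) * h2 := by
      rcases h1.lt_or_eq with h5 | h5
      · have : 0 < (ν - v) * (v + ν - 2 * w) / (2 * p.uMax) :=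
          div_pos (mul_pos (by linarith) (by linarith)) (by positivity)
        linarith
      · have : 0 < (ν - w) * h2 := mul_pos (by linarith)
          (lt_of_le_of_ne hh fun h => h4 ⟨h5.symm, h.symm⟩)
        linarith
    have : g w = w * T + (v - w) ^ 2 / (2 * -p.uMin) := rfl
    rw [this, ← hdist]
    nth_rw 1 [hT]
    linarith
  have hgv : d ≤ g v := by simp only [hg, sub_self]; simp; linarith
  obtain ⟨m, hm, hgm⟩ := intermediate_value_Icc hwv.le (f := g) (by fun_prop) ⟨hgw.le, hgv⟩
  have hmw : w < m := lt_of_le_of_ne hm.1 (by rintro rfl; linarith)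
  have hp : p.IsProfile T d v m m := by
    have r1 := p.rampTime_of_ge hm.2
    have r2 : p.rampTime m m = 0 := by rw [p.rampTime_of_le le_rfl]; simp
    refine ⟨⟨by linarith [hw.1], by linarith [hm.2]⟩, ⟨by linarith [hw.1], by linarith [hm.2]⟩, ?_, ?_⟩
    · rw [holdTime, r1, r2, hT]
      have a1 : 0 ≤ (ν - v) / p.uMax := div_nonneg (by linarith) hu.le
      have a2 : (v - m) / -p.uMin ≤ (ν - w) / -p.uMin := by gcongr
      linarith
    · rw [rampDist, rampDist, holdTime, r1, r2, ← hgm]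
      simp only [hg]
      have := hK.ne'; have := p.uMin_neg.ne
      field_simp; ring
  have := hmin m m hp
  simp only [profileCost] at this
  rw [abs_of_nonpos (by linarith [hm.2] : m - v ≤ 0), abs_of_nonneg (by linarith : 0 ≤ ν - v),
    abs_of_nonpos (by linarith : w - ν ≤ 0)] at this
  simp at this
  linarith

/-- If the distance to go is longer than `holdDist`, an optimal profile starts by accelerating. -/
theorem initialAccel_of_holdDist_lt {T d v : ℝ} {q : ℝ × ℝ} (hv : v ∈ Icc 0 p.vMax)
    (hq : p.IsOptimalProfile T d v q) (hd : p.holdDist T v < d) :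
    p.initialAccel T v q = p.uMax := by
  obtain ⟨ν, w⟩ := q
  obtain ⟨⟨hν, hw, hh, hdist⟩, hmin⟩ := hq
  have hu := p.uMax_pos
  have hK := p.neg_uMin_pos
  have hν0 := p.νnom_pos
  simp only [rampDist] at hh hdist hν hw hmin
  unfold initialAccel
  simp only
  by_cases h1 : v < ν
  · rw [if_neg (not_lt.2 h1.le), if_pos h1]
  push Not at h1
  have e1 := p.rampTime_of_ge h1
  have hT : T = (v - ν) / -p.uMin + p.holdTime T v ν w + p.rampTime ν w := by
    rw [← e1, holdTime]; ring
  set h2 := p.holdTime T v ν w with hh2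
  rw [e1] at hdist
  have b1 : 0 ≤ (v - ν) / -p.uMin := div_nonneg (by linarith) hK.le
  by_cases hwv : w ≤ v
  · -- all speeds are at most `v`
    exfalso
    rw [holdDist, max_eq_right (by linarith [hw.1])] at hd
    have b3 := p.rampTime_nonneg ν w
    have c1 : (v + ν) / 2 * ((v - ν) / -p.uMin) ≤ v * ((v - ν) / -p.uMin) := by
      gcongr; linarith
    have c2 : ν * h2 ≤ v * h2 := by gcongr
    have c3 : (ν + w) / 2 * p.rampTime ν w ≤ v * p.rampTime ν w := by
      gcongr; linarith
    rw [hT] at hd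
    have : (0 : ℝ) ^ 2 / (2 * p.uMax) = 0 := by simp
    linarith
  push Not at hwv
  have h3 : ν ≤ w := by linarith
  rw [p.rampTime_of_le h3] at hdist hT
  have hdw : d ≤ v * T + (w - v) ^ 2 / (2 * p.uMax) := by
    rw [← hdist, hT]
    have e : (v + ν) / 2 * ((v - ν) / -p.uMin) + ν * h2 + (ν + w) / 2 * ((w - ν) / p.uMax) -
        (v * ((v - ν) / -p.uMin + h2 + (w - ν) / p.uMax) + (w - v) ^ 2 / (2 * p.uMax)) =
        -((v - ν) ^ 2 / (2 * -p.uMin) + (v - ν) * h2 + (v - ν) ^ 2 / (2 * p.uMax)) := by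
      have := hK.ne'; have := p.uMin_neg.ne
      field_simp; ring
    have a1 : 0 ≤ (v - ν) ^ 2 / (2 * -p.uMin) := by positivity
    have a2 : 0 ≤ (v - ν) ^ 2 / (2 * p.uMax) := by positivity
    have a3 : 0 ≤ (v - ν) * h2 := mul_nonneg (by linarith) hh
    linarith
  have hwν : p.νnom < w := by
    rcases hw.1.lt_or_eq with h | h
    · exact h
    · exfalso
      rw [holdDist, max_eq_left (by linarith), h] at hd
      linarith
  by_cases h4 : ν = v ∧ h2 = 0
  · rw [if_neg (by linarith [h4.1]), if_neg (by linarith [h4.1]), if_neg (by linarith [h4.2]),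
      if_neg (by linarith), if_pos (by linarith [h4.1])]
  exfalso
  -- accelerating at once to `m ∈ (v, w)`
  set W : ℝ → ℝ := fun m => max m p.νnom with hW
  set g : ℝ → ℝ := fun m => (v + m) / 2 * ((m - v) / p.uMax) + m * (T - (W m - v) / p.uMax)
    + (m + W m) / 2 * ((W m - m) / p.uMax) with hg
  have hgw : d < g w := by
    have hWw : W w = w := max_eq_left hwν.le
    have e : g w = w * T - (w - v) ^ 2 / (2 * p.uMax) := by
      simp only [hg, hWw]; field_simp; ring
    have e2 : w * ((v - ν) / -p.uMin + h2 + (w - ν) / p.uMax) -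
        ((v + ν) / 2 * ((v - ν) / -p.uMin) + ν * h2 + (ν + w) / 2 * ((w - ν) / p.uMax)) =
        (v - ν) * (2 * w - v - ν) / (2 * -p.uMin) + (w - ν) * h2 + (w - ν) ^ 2 / (2 * p.uMax) := by
      have := hK.ne'; have := p.uMin_neg.ne
      field_simp; ring
    have hsq : (w - v) ^ 2 / (2 * p.uMax) ≤ (w - ν) ^ 2 / (2 * p.uMax) := by
      gcongr
    have a1 : 0 ≤ (v - ν) * (2 * w - v - ν) / (2 * -p.uMin) :=
      div_nonneg (mul_nonneg (by linarith) (by linarith)) (by positivity)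
    have a2 : 0 ≤ (w - ν) * h2 := mul_nonneg (by linarith) hh
    have hlt : 0 < (v - ν) * (2 * w - v - ν) / (2 * -p.uMin) + (w - ν) * h2 := by
      rcases h1.lt_or_eq with h5 | h5
      · have : 0 < (v - ν) * (2 * w - v - ν) / (2 * -p.uMin) :=
          div_pos (mul_pos (by linarith) (by linarith)) (by positivity)
        linarith
      · have : 0 < (w - ν) * h2 := mul_pos (by linarith)
          (lt_of_le_of_ne hh fun h => h4 ⟨h5, h.symm⟩)
        linarith
    rw [e, ← hdist]
    nth_rw 1 [hT]
    linarith
  have hgv : g v ≤ d := by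
    refine le_of_eq_of_le ?_ hd.le
    have hWv : W v - v = max (p.νnom - v) 0 := by
      simp only [hW]
      rw [max_comm v, ← max_sub_sub_right]; simp
    have hWv' : W v = v + max (p.νnom - v) 0 := by linarith
    simp only [hg, hWv', holdDist]
    field_simp; ring
  obtain ⟨m, hm, hgm⟩ := intermediate_value_Icc hwv.le (f := g) (by fun_prop) ⟨hgv, hgw.le⟩
  have hmw : m < w := lt_of_le_of_ne hm.2 (by rintro rfl; linarith)
  have hWm1 : m ≤ W m := le_max_left _ _
  have hWm2 : W m < w := max_lt hmw hwν
  have hp : p.IsProfile T d v m (W m) := by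
    have r1 := p.rampTime_of_le hm.1
    have r2 := p.rampTime_of_le hWm1
    refine ⟨⟨by linarith [hm.1, hv.1], by linarith [hw.2]⟩, ⟨le_max_right _ _, by linarith [hw.2]⟩,
      ?_, ?_⟩
    · have a2 : (W m - v) / p.uMax ≤ (w - ν) / p.uMax := by gcongr
      have a3 : (W m - v) / p.uMax = (m - v) / p.uMax + (W m - m) / p.uMax := by ring
      rw [holdTime, r1, r2]
      linarith
    · rw [rampDist, rampDist, holdTime, r1, r2, ← hgm]
      simp only [hg]
      ring
  have := hmin m (W m) hp
  simp only [profileCost] at this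
  rw [abs_of_nonneg (by linarith [hm.1] : 0 ≤ m - v), abs_of_nonneg (by linarith : 0 ≤ W m - m),
    abs_of_nonpos (by linarith : ν - v ≤ 0), abs_of_nonneg (by linarith : 0 ≤ w - ν)] at this
  linarith

theorem brakeSlack_mono {T v ν₁ ν₂ : ℝ} (h : ν₁ ≤ ν₂) :
    p.brakeSlack T v ν₁ ≤ p.brakeSlack T v ν₂ := by
  have hu := p.uMax_pos
  have hK := p.neg_uMin_pos
  unfold brakeSlack
  have h1 : (v - ν₂) / -p.uMin ≤ (v - ν₁) / -p.uMin := by gcongr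
  have h2 : max (p.νnom - ν₂) 0 / p.uMax ≤ max (p.νnom - ν₁) 0 / p.uMax := by gcongr
  linarith

/-- There is a profile if the distance to go is at most `holdDist` and at least that of some
admissible braking profile. -/
theorem exists_isProfile_of_brakeDist_le {T d v ν₀ : ℝ} (hv : v ≤ p.vMax) (hν0 : 0 ≤ ν₀)
    (hνv : ν₀ ≤ v) (hs : 0 ≤ p.brakeSlack T v ν₀) (hlo : p.brakeDist T v ν₀ ≤ d)
    (hhi : d ≤ p.holdDist T v) : ∃ ν w, p.IsProfile T d v ν w := by
  have hu := p.uMax_pos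
  have hK := p.neg_uMin_pos
  have hcont : Continuous fun ν => p.brakeDist T v ν := by unfold brakeDist; fun_prop
  have hvd : p.brakeDist T v v = p.holdDist T v := by simp [brakeDist, holdDist]
  obtain ⟨m, hm, hgm⟩ := intermediate_value_Icc hνv (f := fun ν => p.brakeDist T v ν)
    hcont.continuousOn ⟨hlo, by simpa only [hvd] using hhi⟩
  have hs' := hs.trans (p.brakeSlack_mono hm.1)
  have hN : max (p.νnom - m) 0 = max m p.νnom - m := by
    rw [max_comm m, ← max_sub_sub_right]; simp
  have hWm : m ≤ max m p.νnom := le_max_left _ _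
  have r1 := p.rampTime_of_ge hm.2
  have r2 := p.rampTime_of_le hWm
  refine ⟨m, max m p.νnom, ⟨hν0.trans hm.1, hm.2.trans hv⟩,
    ⟨le_max_right _ _, max_le (hm.2.trans hv) p.νnom_le⟩, ?_, ?_⟩
  · rw [brakeSlack, hN] at hs'
    rw [holdTime, r1, r2]; linarith
  · rw [← hgm]
    simp only [brakeDist, hN]
    rw [rampDist, rampDist, holdTime, r1, r2]
    have := hK.ne'; have := p.uMin_neg.ne
    field_simp; ring

/-- Distance to go beyond what is needed to stop and to speed up again to `νnom`. -/
noncomputable def stopMargin (d v : ℝ) : ℝ := d - v ^ 2 / (2 * -p.uMin) - p.νnom ^ 2 / (2 * p.uMax)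

/-- If a vehicle has room to stop and to speed up again, but is closer than `holdDist`, a profile
exists: lower the cruising speed until either the distance fits or no time is left for cruising. -/
theorem exists_isProfile_of_stopMargin_pos {T d v : ℝ} (hv : v ∈ Icc 0 p.vMax)
    (hM : 0 < p.stopMargin d v) (hs : 0 ≤ p.slack T v) (hhi : d ≤ p.holdDist T v) :
    ∃ ν w, p.IsProfile T d v ν w := by
  have hu := p.uMax_pos
  have hK := p.neg_uMin_pos
  have hn := p.νnom_pos
  unfold stopMargin at hM
  by_cases h0 : 0 ≤ p.brakeSlack T v 0
  · refine p.exists_isProfile_of_brakeDist_le hv.2 le_rfl hv.1 h0 ?_ hhi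
    rw [brakeDist, sub_zero, sub_zero, max_eq_left hn.le]; linarith
  · have hcont : Continuous fun ν => p.brakeSlack T v ν := by unfold brakeSlack; fun_prop
    have hvs : p.brakeSlack T v v = p.slack T v := by simp [brakeSlack, slack]
    push Not at h0
    obtain ⟨m, hm, hgm⟩ := intermediate_value_Icc hv.1 (f := fun ν => p.brakeSlack T v ν)
      hcont.continuousOn (show (0 : ℝ) ∈ Icc _ _ from ⟨h0.le, by simpa only [hvs] using hs⟩)
    simp only at hgm
    refine p.exists_isProfile_of_brakeDist_le hv.2 hm.1 hm.2 hgm.ge ?_ hhi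
    refine le_trans ?_ (show v ^ 2 / (2 * -p.uMin) + p.νnom ^ 2 / (2 * p.uMax) ≤ d by linarith)
    rw [brakeSlack] at hgm
    have hT : T = (v - m) / -p.uMin + max (p.νnom - m) 0 / p.uMax := by linarith
    have e : p.brakeDist T v m = v ^ 2 / (2 * -p.uMin) - m ^ 2 / (2 * -p.uMin) +
        (max (p.νnom - m) 0 ^ 2 + 2 * m * max (p.νnom - m) 0) / (2 * p.uMax) := by
      rw [brakeDist]; nth_rw 1 [hT]
      have := hK.ne'; have := p.uMin_neg.ne
      field_simp; ring
    rw [e]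
    have a1 : 0 ≤ m ^ 2 / (2 * -p.uMin) := by positivity
    have a2 : (max (p.νnom - m) 0 ^ 2 + 2 * m * max (p.νnom - m) 0) / (2 * p.uMax) ≤
        p.νnom ^ 2 / (2 * p.uMax) := by
      gcongr
      rcases max_cases (p.νnom - m) 0 with ⟨h, h'⟩ | ⟨h, h'⟩ <;> rw [h] <;> nlinarith [hm.1]
    linarith

/-- With room to stop and to speed up again, a ramp up to `νnom` alone is too short for the distance. -/
theorem holdDist_lt_of_slack_zero {T d v : ℝ}
    (hM : 0 < p.stopMargin d v) (hs : p.slack T v = 0) : p.holdDist T v < d := by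
  have hu := p.uMax_pos
  have hK := p.neg_uMin_pos
  have hn := p.νnom_pos
  unfold stopMargin at hM
  rw [slack] at hs
  have hT : T = max (p.νnom - v) 0 / p.uMax := by linarith
  have a1 : 0 ≤ v ^ 2 / (2 * -p.uMin) := by positivity
  have e : p.holdDist T v = (max (p.νnom - v) 0 ^ 2 + 2 * v * max (p.νnom - v) 0) / (2 * p.uMax) := by
    rw [holdDist]; nth_rw 1 [hT]; field_simp; ring
  have a2 : (max (p.νnom - v) 0 ^ 2 + 2 * v * max (p.νnom - v) 0) / (2 * p.uMax) ≤
      p.νnom ^ 2 / (2 * p.uMax) := by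
    gcongr
    rcases max_cases (p.νnom - v) 0 with ⟨h, h'⟩ | ⟨h, h'⟩ <;> rw [h] <;> nlinarith
  linarith

/-- Braking slightly is possible, and shortens the distance, as long as the speed and the slack are
positive. -/
theorem exists_brakeDist_lt {T v : ℝ} (hv : 0 < v) (hs : 0 < p.slack T v) :
    ∃ ν₀, 0 ≤ ν₀ ∧ ν₀ < v ∧ 0 < p.brakeSlack T v ν₀ ∧ p.brakeDist T v ν₀ < p.holdDist T v := by
  have hu := p.uMax_pos
  have hK := p.neg_uMin_pos
  set c := 1 / -p.uMin + 1 / p.uMax with hc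
  have hcpos : 0 < c := by positivity
  set ε := min v (p.slack T v / c) / 2 with hε
  have hmin : 0 < min v (p.slack T v / c) := lt_min hv (by positivity)
  have hεpos : 0 < ε := by positivity
  have hεv : ε < v := by
    have := min_le_left v (p.slack T v / c); linarith
  have hεs : ε * c < p.slack T v := by
    rw [← lt_div_iff₀ hcpos]
    have := min_le_right v (p.slack T v / c); linarith
  have hsub : max (p.νnom - (v - ε)) 0 ≤ max (p.νnom - v) 0 + ε :=
    max_le (by linarith [le_max_left (p.νnom - v) 0]) (by linarith [le_max_right (p.νnom - v) 0])
  have hnn : 0 ≤ max (p.νnom - (v - ε)) 0 := le_max_right _ _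
  refine ⟨v - ε, by linarith, by linarith, ?_, ?_⟩
  · rw [brakeSlack]
    rw [slack] at hεs
    have a : max (p.νnom - (v - ε)) 0 / p.uMax ≤ (max (p.νnom - v) 0 + ε) / p.uMax := by gcongr
    have b : (v - (v - ε)) / -p.uMin + (max (p.νnom - v) 0 + ε) / p.uMax =
      max (p.νnom - v) 0 / p.uMax + ε * c := by rw [hc]; field_simp; ring
    linarith
  · rw [brakeDist, holdDist]
    set N := max (p.νnom - v) 0 with hN
    have a : max (p.νnom - (v - ε)) 0 ^ 2 / (2 * p.uMax) ≤ (N + ε) ^ 2 / (2 * p.uMax) := by gcongr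
    have hT : T = p.slack T v + N / p.uMax := by rw [slack]; ring
    have b : v * T + N ^ 2 / (2 * p.uMax) - ((v - ε) * T + (v - (v - ε)) ^ 2 / (2 * -p.uMin) +
        (N + ε) ^ 2 / (2 * p.uMax)) = ε * (p.slack T v - ε * c) + ε ^ 2 * c / 2 := by
      set S := p.slack T v
      rw [hT, hc]
      have := hK.ne'; have := p.uMin_neg.ne
      field_simp; ring
    have : 0 < ε * (p.slack T v - ε * c) := mul_pos hεpos (by linarith)
    have : 0 ≤ ε ^ 2 * c / 2 := by positivity
    linarith

/-! ### The feedback law -/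

theorem initialAccel_mem (T v : ℝ) (q : ℝ × ℝ) : p.initialAccel T v q ∈ Icc p.uMin p.uMax := by
  have := p.uMin_neg; have := p.uMax_pos
  unfold initialAccel
  split_ifs <;> constructor <;> linarith

theorem guc_mem (τ t x v : ℝ) : p.guc τ t x v ∈ Icc p.uMin p.uMax := by
  have := p.uMin_neg; have := p.uMax_pos
  unfold guc
  split_ifs
  · exact p.initialAccel_mem _ _ _
  · constructor <;> linarith

theorem guc_nonneg_of_nonpos {τ t x v : ℝ} (hv : v ≤ 0) : 0 ≤ p.guc τ t x v := by
  have h1 := p.uMax_pos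
  unfold guc
  split_ifs with h
  · have hq := h.2.choose_spec.1
    have a := hq.cruise_mem.1
    have b := hq.final_mem.1
    have c := p.νnom_pos
    unfold initialAccel
    split_ifs <;> linarith
  · exact h1.le

theorem guc_of_le {τ t x v : ℝ} (h : τ ≤ t) : p.guc τ t x v = p.uMax := by
  unfold guc
  rw [dif_neg]
  rintro ⟨h1, -⟩
  linarith

/-- No velocity profile leads to the intersection in time `T`, because it is too short. -/
def Late (T d v : ℝ) : Prop := p.maxDist T v < d ∨ p.slack T v < 0

theorem guc_of_late {τ t x v : ℝ} (hv : v ≤ p.vMax) (h : p.Late (τ - t) (-x) v) :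
    p.guc τ t x v = p.uMax := by
  unfold guc
  rw [dif_neg]
  rintro ⟨h1, q, hq⟩
  rcases h with h | h
  · exact absurd (p.profile_le_maxDist hq.1 hv) (not_le.2 h)
  · exact absurd (p.profile_slack hq.1) (not_le.2 h)

theorem guc_of_holdDist_lt {τ t x v : ℝ} (hv : v ∈ Icc 0 p.vMax)
    (h : p.holdDist (τ - t) v < -x) : p.guc τ t x v = p.uMax := by
  unfold guc
  split_ifs with h1
  · exact p.initialAccel_of_holdDist_lt hv h1.2.choose_spec h
  · rfl

theorem guc_of_lt_holdDist {τ t x v ν w : ℝ} (hv : v ≤ p.vMax) (ht : t < τ)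
    (hp : p.IsProfile (τ - t) (-x) v ν w) (h : -x < p.holdDist (τ - t) v) :
    p.guc τ t x v = p.uMin := by
  have h1 : 0 < τ - t ∧ ∃ q, p.IsOptimalProfile (τ - t) (-x) v q :=
    ⟨by linarith, p.exists_isOptimalProfile hp⟩
  unfold guc
  rw [dif_pos h1]
  exact p.initialAccel_of_lt_holdDist hv h1.2.choose_spec h

end Params
end Intersection
namespace Intersection

/-! ### Distances covered under bounded acceleration -/

theorem hasDerivAt_max_zero_sq (y : ℝ) :
    HasDerivAt (fun y : ℝ => max y 0 ^ 2) (2 * max y 0) y := by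
  have hne : ∀ y : ℝ, y ≠ 0 → HasDerivAt (fun y : ℝ => max y 0 ^ 2) (2 * max y 0) y := fun y hy => by
    rcases hy.lt_or_gt with h | h
    · refine HasDerivAt.congr_of_eventuallyEq (f := fun _ => 0) ?_ ?_
      · rw [max_eq_right h.le, mul_zero]; exact hasDerivAt_const _ _
      · filter_upwards [Iio_mem_nhds h] with z hz
        rw [max_eq_right (le_of_lt hz)]; simp
    · refine HasDerivAt.congr_of_eventuallyEq (f := fun z => z ^ 2) ?_ ?_
      · rw [max_eq_left h.le]; simpa using hasDerivAt_pow 2 y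
      · filter_upwards [Ioi_mem_nhds h] with z hz
        rw [max_eq_left (le_of_lt hz)]
  by_cases hy : y = 0
  · subst hy
    exact hasDerivAt_of_hasDerivAt_of_ne (g := fun y => 2 * max y 0) (fun y hy => hne y hy)
      (by fun_prop) (by fun_prop)
  · exact hne y hy

namespace Params
variable (p : Params)

theorem integral_min_eq_maxDist {a b w : ℝ} (hw : w ≤ p.vMax) :
    ∫ r in a..b, min p.vMax (w + p.uMax * (r - a)) = p.maxDist (b - a) w := by
  have hu := p.uMax_pos
  have hd : ∀ r ∈ uIcc a b, HasDerivAt (fun r => p.maxDist (r - a) w)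
      (min p.vMax (w + p.uMax * (r - a))) r := fun r _ => by
    have h1 : HasDerivAt (fun r => p.vMax - w - p.uMax * (r - a)) (-p.uMax) r := by
      have := (((hasDerivAt_id r).sub_const a).const_mul p.uMax).const_sub (p.vMax - w)
      exact this.congr_deriv (by simp)
    have h2 := (hasDerivAt_max_zero_sq (p.vMax - w - p.uMax * (r - a))).comp r h1
    have h3 : HasDerivAt (fun r => p.vMax * (r - a)) p.vMax r := by
      have := ((hasDerivAt_id r).sub_const a).const_mul p.vMax
      exact this.congr_deriv (by simp)
    have h4 := h3.sub ((h2.const_sub ((p.vMax - w) ^ 2)).div_const (2 * p.uMax))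
    refine h4.congr_deriv ?_
    rcases le_total (p.vMax - w - p.uMax * (r - a)) 0 with h | h
    · rw [max_eq_right h, min_eq_left (by linarith)]; simp
    · rw [max_eq_left h, min_eq_right (by linarith)]; field_simp; ring
  rw [intervalIntegral.integral_eq_sub_of_hasDerivAt hd
    (by apply Continuous.intervalIntegrable; fun_prop)]
  simp [p.maxDist_zero hw]

end Params

namespace Traj

variable {x v u : ℝ → ℝ} {t₀ : ℝ} (h : Traj x v u t₀)
include h

theorem pos_sub_le_of_acc_le {a b c : ℝ} (ha : t₀ ≤ a) (hab : a ≤ b) (hu : ∀ r ∈ Ioo a b, u r ≤ c) :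
    x b - x a ≤ v a * (b - a) + c * (b - a) ^ 2 / 2 := by
  have h1 := h.pos_sub_le (f := fun r => v a + c * (r - a)) ha hab
    (by apply Continuous.intervalIntegrable; fun_prop) fun r hr => by
      have := h.vel_sub_le ha hr.1 fun s hs => hu s ⟨hs.1, hs.2.trans_le hr.2⟩
      linarith
  have h3 : ∫ r in a..b, (v a + c * (r - a)) = v a * (b - a) + c * (b - a) ^ 2 / 2 := by
    have hd : ∀ r ∈ uIcc a b, HasDerivAt (fun r => v a * r + c * (r - a) ^ 2 / 2)
        (v a + c * (r - a)) r := fun r _ => by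
      have := ((hasDerivAt_id r).const_mul (v a)).add
        (((((hasDerivAt_id r).sub_const a).pow 2).const_mul c).div_const 2)
      exact this.congr_deriv (by simp; ring)
    rw [intervalIntegral.integral_eq_sub_of_hasDerivAt hd
      (by apply Continuous.intervalIntegrable; fun_prop)]
    ring
  linarith

theorem pos_sub_le_maxDist (p : Params) {a b : ℝ} (ha : t₀ ≤ a) (hab : a ≤ b)
    (hu : ∀ r ∈ Icc a b, u r ≤ p.uMax) (hv : ∀ r ∈ Icc a b, v r ≤ p.vMax) :
    x b - x a ≤ p.maxDist (b - a) (v a) := by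
  rw [← p.integral_min_eq_maxDist (hv a (left_mem_Icc.2 hab))]
  refine h.pos_sub_le ha hab (by apply Continuous.intervalIntegrable; fun_prop) fun r hr => ?_
  have := h.vel_sub_le ha hr.1 fun s hs => hu s ⟨hs.1.le, hs.2.le.trans hr.2⟩
  exact le_min (hv r hr) (by linarith)

theorem maxDist_le_pos_sub (p : Params) {a b w : ℝ} (ha : t₀ ≤ a) (hab : a ≤ b) (hw : w ≤ p.vMax)
    (hv : ∀ r ∈ Icc a b, min p.vMax (w + p.uMax * (r - a)) ≤ v r) :
    p.maxDist (b - a) w ≤ x b - x a := by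
  rw [← p.integral_min_eq_maxDist hw]
  exact h.le_pos_sub ha hab (by apply Continuous.intervalIntegrable; fun_prop) hv

end Traj

/-! ### A vehicle never arrives before its approach time -/

section NotEarly

variable {p : Params} {x v u : ℝ → ℝ} {t₀ τ : ℝ}

theorem slack_antitone (h : Traj x v u t₀) (hu : ∀ t ≥ t₀, u t ≤ p.uMax) {a b : ℝ} (ha : t₀ ≤ a)
    (hab : a ≤ b) : p.slack (τ - b) (v b) ≤ p.slack (τ - a) (v a) := by
  have h1 := h.vel_sub_le ha hab fun r hr => hu r (ha.trans hr.1.le)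
  have hup := p.uMax_pos
  have h2 : max (p.νnom - v a) 0 ≤ max (p.νnom - v b) 0 + p.uMax * (b - a) := by
    refine max_le ?_ ?_
    · linarith [le_max_left (p.νnom - v b) 0]
    · have := mul_nonneg hup.le (sub_nonneg.2 hab)
      linarith [le_max_right (p.νnom - v b) 0]
  have h3 : max (p.νnom - v a) 0 / p.uMax ≤ max (p.νnom - v b) 0 / p.uMax + (b - a) := by
    rw [div_le_iff₀ hup, add_mul, div_mul_cancel₀ _ hup.ne']; linarith
  unfold Params.slack
  linarith

/-- While a vehicle brakes with a nonnegative slack, the difference between its distance to go and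
`holdDist` does not decrease. -/
theorem holdDist_add_le_of_brake (h : Traj x v u t₀) {a b : ℝ} (ha : t₀ ≤ a) (hab : a ≤ b)
    (hu : ∀ r ∈ Ioo a b, u r = p.uMin) (hsa : 0 ≤ p.slack (τ - a) (v a))
    (hsb : 0 ≤ p.slack (τ - b) (v b)) :
    -x a - p.holdDist (τ - a) (v a) ≤ -x b - p.holdDist (τ - b) (v b) := by
  have hup := p.uMax_pos
  have hK := p.neg_uMin_pos
  have e1 := h.vel_of_const ha hu b (right_mem_Icc.2 hab)
  have e2 := h.pos_of_const ha hu b (right_mem_Icc.2 hab)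
  unfold Params.slack at hsa hsb
  unfold Params.holdDist
  set A := max (p.νnom - v a) 0 with hA
  set B := max (p.νnom - v b) 0 with hB
  have hA0 : 0 ≤ A := le_max_right _ _
  have hB0 : 0 ≤ B := le_max_right _ _
  have hs : 0 ≤ -p.uMin * (b - a) := mul_nonneg hK.le (by linarith)
  have hBA : B ≤ A + -p.uMin * (b - a) := by
    refine max_le ?_ (by linarith)
    linarith [le_max_left (p.νnom - v a) 0]
  have h1 : A ≤ p.uMax * (τ - a) := by
    have : A / p.uMax ≤ τ - a := by linarith
    rw [div_le_iff₀ hup] at this; linarith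
  have h2 : B ≤ p.uMax * (τ - b) := by
    have : B / p.uMax ≤ τ - b := by linarith
    rw [div_le_iff₀ hup] at this; linarith
  have h3 : B ^ 2 - A ^ 2 ≤ -p.uMin * (b - a) * (p.uMax * (τ - a) + p.uMax * (τ - b)) := by
    have : B ^ 2 - A ^ 2 ≤ -p.uMin * (b - a) * (A + B) := by nlinarith
    refine this.trans ?_
    gcongr
  have h4 : (B ^ 2 - A ^ 2) / (2 * p.uMax) ≤ -p.uMin * (b - a) * ((τ - a) + (τ - b)) / 2 := by
    rw [div_le_iff₀ (by positivity)]; linarith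
  have h5 : (B ^ 2 - A ^ 2) / (2 * p.uMax) = B ^ 2 / (2 * p.uMax) - A ^ 2 / (2 * p.uMax) := by ring
  rw [e1, e2]
  rw [h5] at h4
  linear_combination h4

theorem stopMargin_eq_of_brake (h : Traj x v u t₀) {a b : ℝ} (ha : t₀ ≤ a) (hab : a ≤ b)
    (hu : ∀ r ∈ Ioo a b, u r = p.uMin) :
    p.stopMargin (-x b) (v b) = p.stopMargin (-x a) (v a) := by
  have hK := p.neg_uMin_pos.ne'
  have hK' := p.uMin_neg.ne
  have e1 := h.vel_of_const ha hu b (right_mem_Icc.2 hab)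
  have e2 := h.pos_of_const ha hu b (right_mem_Icc.2 hab)
  unfold Params.stopMargin
  rw [e1, e2]
  field_simp
  ring

/-- A vehicle at rest at the distance `νnom² / (2 uMax)` with time to spare could start too early. It
does not get there: near such a state, the stopping margin bounds the speed, hence also its own
decrease, so that it would have had to vanish before. -/
theorem vel_pos_of_holdDist_eq (h : Traj x v u t₀)
    (hu : ∀ t ≥ t₀, u t ≤ p.uMax) (hv : ∀ t ≥ t₀, 0 ≤ v t) {t₁ c : ℝ} (ht₁ : t₀ ≤ t₁)
    (htc : t₁ ≤ c) (hM : 0 < p.stopMargin (-x t₁) (v t₁))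
    (hH : ∀ t ∈ Icc t₁ c, 0 ≤ -x t - p.holdDist (τ - t) (v t))
    (hHc : -x c - p.holdDist (τ - c) (v c) = 0) (hs : 0 < p.slack (τ - c) (v c)) : 0 < v c := by
  have hup := p.uMax_pos
  have hK := p.neg_uMin_pos
  have hn := p.νnom_pos
  by_contra! hvc
  have hvc0 : v c = 0 := le_antisymm hvc (hv c (ht₁.trans htc))
  have hMc : p.stopMargin (-x c) (v c) = 0 := by
    rw [Params.holdDist, hvc0, sub_zero, max_eq_left hn.le] at hHc
    rw [Params.stopMargin, hvc0]
    simp only [ne_eq, OfNat.ofNat_ne_zero, not_false_eq_true, zero_pow, zero_div]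
    linarith
  have hcv := h.cont_v (a := t₁) (b := c) ht₁
  have hcx := h.cont_x (a := t₁) (b := c) ht₁
  have hcM : ContinuousOn (fun t => p.stopMargin (-x t) (v t)) (Icc t₁ c) := by
    unfold Params.stopMargin; fun_prop
  have hZ : IsCompact (Icc t₁ c ∩ {t | v t = 0} ∩ {t | p.stopMargin (-x t) (v t) = 0}) := by
    refine isCompact_Icc.of_isClosed_subset ?_ (inter_subset_left.trans inter_subset_left)
    have h1 := hcv.preimage_isClosed_of_isClosed isClosed_Icc (isClosed_singleton (x := (0 : ℝ)))
    have h2 := hcM.preimage_isClosed_of_isClosed isClosed_Icc (isClosed_singleton (x := (0 : ℝ)))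
    have := h1.inter h2
    convert this using 1
    ext t; simp; tauto
  obtain ⟨c₀, ⟨⟨hc₀I, hvc₀⟩, hMc₀⟩, hleast⟩ :=
    hZ.exists_isLeast ⟨c, ⟨right_mem_Icc.2 htc, hvc0⟩, hMc⟩
  simp only [mem_ofPred_eq] at hvc₀ hMc₀
  have htc₀ : t₁ < c₀ := lt_of_le_of_ne hc₀I.1 (by rintro rfl; linarith)
  set S := p.slack (τ - c) (v c) with hS
  set η := min p.νnom (S / 2 / (1 / (2 * p.uMax) + 1 / (2 * -p.uMin))) with hη
  have hηpos : 0 < η := lt_min hn (by positivity)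
  -- close to `c₀` the speed is small
  have hev := (hcv c₀ hc₀I).eventually (gt_mem_nhds (show v c₀ < η by rw [hvc₀]; exact hηpos))
  rw [Filter.eventually_iff, Metric.mem_nhdsWithin_iff] at hev
  obtain ⟨ε, hε, hsub⟩ := hev
  set a := max t₁ (c₀ - min (ε / 2) (S / 4)) with ha
  have hmpos : 0 < min (ε / 2) (S / 4) := lt_min (by positivity) (by positivity)
  have hat : t₁ ≤ a := le_max_left _ _
  have hac : a < c₀ := max_lt htc₀ (by linarith)
  have haε : c₀ - ε / 2 ≤ a :=
    le_trans (by linarith [min_le_left (ε / 2) (S / 4)]) (le_max_right _ _)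
  have haS : c₀ - S / 4 ≤ a :=
    le_trans (by linarith [min_le_right (ε / 2) (S / 4)]) (le_max_right _ _)
  have hlow : ∀ t ∈ Icc a c₀, v t * (S / 2) ≤ p.stopMargin (-x t) (v t) := fun t ht => by
    have htI : t ∈ Icc t₁ c := ⟨hat.trans ht.1, ht.2.trans hc₀I.2⟩
    have hvη : v t < η := hsub ⟨by
      rw [Metric.mem_ball, Real.dist_eq, abs_lt]; constructor <;> linarith [ht.1, ht.2], htI⟩
    have hv0 := hv t (ht₁.trans htI.1)
    have hvn : v t < p.νnom := hvη.trans_le (min_le_left _ _)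
    have h1 := hH t htI
    have h2 : S ≤ p.slack (τ - t) (v t) := slack_antitone h hu (ht₁.trans htI.1) htI.2
    have h3 : v t * (1 / (2 * p.uMax) + 1 / (2 * -p.uMin)) ≤ S / 2 := by
      rw [← le_div_iff₀ (by positivity)]
      exact hvη.le.trans (min_le_right _ _)
    rw [Params.slack, max_eq_left (by linarith)] at h2
    rw [Params.holdDist, max_eq_left (by linarith)] at h1
    rw [Params.stopMargin]
    have h4 : 0 ≤ v t * (τ - t - (p.νnom - v t) / p.uMax - S) := mul_nonneg hv0 (by linarith)
    have h5 : 0 ≤ v t * (S / 2 - v t * (1 / (2 * p.uMax) + 1 / (2 * -p.uMin))) :=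
      mul_nonneg hv0 (by linarith)
    have e : -x t - v t ^ 2 / (2 * -p.uMin) - p.νnom ^ 2 / (2 * p.uMax) - v t * (S / 2) =
        (-x t - (v t * (τ - t) + (p.νnom - v t) ^ 2 / (2 * p.uMax))) +
        v t * (τ - t - (p.νnom - v t) / p.uMax - S) +
        v t * (S / 2 - v t * (1 / (2 * p.uMax) + 1 / (2 * -p.uMin))) := by
      have := hK.ne'; have := p.uMin_neg.ne
      field_simp; ring
    linarith
  have hup' : ∀ t ∈ Icc a c₀, p.stopMargin (-x t) (v t) ≤ x c₀ - x t := fun t ht => by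
    rw [Params.stopMargin, hvc₀] at hMc₀
    rw [Params.stopMargin]
    have : 0 ≤ v t ^ 2 / (2 * -p.uMin) := by positivity
    simp only [ne_eq, OfNat.ofNat_ne_zero, not_false_eq_true, zero_pow, zero_div] at hMc₀
    linarith
  obtain ⟨t, ht, hmax⟩ := isCompact_Icc.exists_isMaxOn (nonempty_Icc.2 hac.le)
    (hcM.mono (Icc_subset_Icc hat hc₀I.2))
  set m := p.stopMargin (-x t) (v t) with hm
  have hvm : ∀ r ∈ Icc t c₀, v r ≤ 2 * m / S := fun r hr => by
    have h1 := hlow r ⟨ht.1.trans hr.1, hr.2⟩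
    have h2 : p.stopMargin (-x r) (v r) ≤ m := hmax ⟨ht.1.trans hr.1, hr.2⟩
    rw [le_div_iff₀ hs]; linarith
  have h1 := h.pos_sub_le_const (ht₁.trans (hat.trans ht.1)) ht.2 hvm
  have h2 := hup' t ht
  have hm0 : 0 ≤ m := (mul_nonneg (hv t (ht₁.trans (hat.trans ht.1))) (by positivity)).trans (hlow t ht)
  have h3 : 2 * m / S * (c₀ - t) ≤ 2 * m / S * (S / 4) := by
    gcongr; linarith [ht.1]
  have h4 : 2 * m / S * (S / 4) = m / 2 := by field_simp; ring
  have hmz : m ≤ 0 := by linarith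
  have haI : a ∈ Icc a c₀ := left_mem_Icc.2 hac.le
  have h5 : p.stopMargin (-x a) (v a) ≤ m := hmax haI
  have h6 := hlow a haI
  have h7 := hv a (ht₁.trans hat)
  have hva : v a = 0 := by
    by_contra hne
    have : 0 < v a * (S / 2) := mul_pos (lt_of_le_of_ne h7 (Ne.symm hne)) (by positivity)
    linarith
  have : c₀ ≤ a := hleast ⟨⟨⟨hat, hac.le.trans hc₀I.2⟩, hva⟩, by
    rw [hva] at h6
    show p.stopMargin (-x a) (v a) = 0
    rw [hva] at h5 ⊢
    linarith⟩
  linarith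

/-- A vehicle that brakes whenever the uncoupled controller does, and that has room to stop and to
speed up again, does not arrive before its approach time. -/
theorem neg_of_lt_tau (h : Traj x v u t₀)
    (hu : ∀ t ≥ t₀, u t ≤ p.uMax) (hv : ∀ t ≥ t₀, v t ∈ Icc 0 p.vMax)
    (hc : ∀ t ≥ t₀, p.guc τ t (x t) (v t) = p.uMin → u t = p.uMin)
    (hM : 0 < p.stopMargin (-x t₀) (v t₀)) (hs : 0 ≤ p.slack (τ - t₀) (v t₀)) :
    ∀ t ∈ Ico t₀ τ, x t < 0 := by
  intro t ht
  have hup := p.uMax_pos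
  have hK := p.neg_uMin_pos
  have hn := p.νnom_pos
  have h0τ : t₀ ≤ τ := ht.1.trans ht.2.le
  have hcv := h.cont_v (a := t₀) (b := τ) le_rfl
  have hcx := h.cont_x (a := t₀) (b := τ) le_rfl
  have hcM : ContinuousOn (fun t => p.stopMargin (-x t) (v t)) (Icc t₀ τ) := by
    unfold Params.stopMargin; fun_prop
  have hcS : ContinuousOn (fun t => p.slack (τ - t) (v t)) (Icc t₀ τ) := by
    unfold Params.slack; fun_prop
  have hcH : ContinuousOn (fun t => -x t - p.holdDist (τ - t) (v t)) (Icc t₀ τ) := by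
    unfold Params.holdDist; fun_prop
  -- `th` is the time at which the slack is used up
  obtain ⟨th, hth, hSth, hSpos⟩ : ∃ th ∈ Icc t₀ τ, p.slack (τ - th) (v th) = 0 ∧
      ∀ t ∈ Ico t₀ th, 0 < p.slack (τ - t) (v t) := by
    rcases hs.eq_or_lt with h1 | h1
    · exact ⟨t₀, left_mem_Icc.2 h0τ, h1.symm, fun t ht => absurd ht.1 (not_le.2 ht.2)⟩
    · obtain ⟨c, hc1, hc2, hc3⟩ := exists_first_nonpos h0τ hcS h1 (by
        have : 0 ≤ max (p.νnom - v τ) 0 / p.uMax := div_nonneg (le_max_right _ _) hup.le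
        simp only [Params.slack]; linarith)
      exact ⟨c, ⟨hc1.1.le, hc1.2⟩, hc2, hc3⟩
  have hSnn : ∀ t ∈ Icc t₀ th, 0 ≤ p.slack (τ - t) (v t) := fun t ht => by
    rcases ht.2.lt_or_eq with h1 | h1
    · exact (hSpos t ⟨ht.1, h1⟩).le
    · rw [h1, hSth]
  have hlt : ∀ t ∈ Icc t₀ th, -x t - p.holdDist (τ - t) (v t) < 0 →
      (∃ ν w, p.IsProfile (τ - t) (-x t) (v t) ν w) → t < τ → u t = p.uMin := by
    rintro t ht hH ⟨ν, w, hp⟩ htτ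
    exact hc t ht.1 (p.guc_of_lt_holdDist (hv t ht.1).2 htτ hp (by linarith))
  -- while the distance to go is shorter than `holdDist`, the vehicle brakes, which preserves the
  -- stopping margin; this ends before the slack is used up
  have phase1 : ∀ c ∈ Icc t₀ th, (∀ t ∈ Ico t₀ c, -x t - p.holdDist (τ - t) (v t) < 0) →
      ∀ t ∈ Icc t₀ c, 0 < p.stopMargin (-x t) (v t) := by
    intro c hc1 hneg t ht
    by_contra! hcon
    obtain ⟨d, hd, hd0, hd1⟩ := exists_first_nonpos ht.1
      (hcM.mono (Icc_subset_Icc_right (ht.2.trans (hc1.2.trans hth.2)))) hM hcon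
    have := stopMargin_eq_of_brake (p := p) h le_rfl hd.1.le fun r hr => by
      have hrc : r < c := hr.2.trans_le (hd.2.trans ht.2)
      have hrI : r ∈ Icc t₀ th := ⟨hr.1.le, hrc.le.trans hc1.2⟩
      have hH := hneg r ⟨hr.1.le, hrc⟩
      exact hlt r hrI hH (p.exists_isProfile_of_stopMargin_pos (hv r hr.1.le) (hd1 r ⟨hr.1.le, hr.2⟩)
        (hSnn r hrI) (by linarith)) (hrc.trans_le (hc1.2.trans hth.2))
    linarith
  obtain ⟨t₁, ht₁, hH₁, hM₁⟩ : ∃ t₁ ∈ Icc t₀ th, 0 ≤ -x t₁ - p.holdDist (τ - t₁) (v t₁) ∧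
      ∀ t ∈ Icc t₀ t₁, 0 < p.stopMargin (-x t) (v t) := by
    rcases le_or_gt 0 (-x t₀ - p.holdDist (τ - t₀) (v t₀)) with h1 | h1
    · refine ⟨t₀, left_mem_Icc.2 hth.1, h1, fun t ht => ?_⟩
      rw [le_antisymm ht.2 ht.1]; exact hM
    · have hex : 0 ≤ -x th - p.holdDist (τ - th) (v th) ∨
          ∃ t ∈ Icc t₀ th, 0 ≤ -x t - p.holdDist (τ - t) (v t) := by
        by_contra! hcon
        have := phase1 th (right_mem_Icc.2 hth.1) (fun t ht => hcon.2 t ⟨ht.1, ht.2.le⟩) th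
          (right_mem_Icc.2 hth.1)
        have := p.holdDist_lt_of_slack_zero this hSth
        linarith [hcon.1]
      obtain ⟨s, hs, hs0⟩ : ∃ t ∈ Icc t₀ th, 0 ≤ -x t - p.holdDist (τ - t) (v t) := by
        rcases hex with h2 | h2
        · exact ⟨th, right_mem_Icc.2 hth.1, h2⟩
        · exact h2
      obtain ⟨c, hc1, hc2, hc3⟩ := exists_first_nonpos hs.1
        ((hcH.mono (Icc_subset_Icc_right (hs.2.trans hth.2))).neg) (by simp only [Pi.neg_apply]; linarith) (by simp only [Pi.neg_apply]; linarith)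
      simp only [Pi.neg_apply] at hc2 hc3
      have hcI : c ∈ Icc t₀ th := ⟨hc1.1.le, hc1.2.trans hs.2⟩
      exact ⟨c, hcI, by linarith, phase1 c hcI fun t ht => by linarith [hc3 t ht]⟩
  -- afterwards the distance to go is at least `holdDist`, since at equality there is a profile that
  -- brakes a little, so that the controller brakes as soon as the distance becomes shorter
  have phase2 : ∀ t ∈ Icc t₁ th, 0 ≤ -x t - p.holdDist (τ - t) (v t) := by
    refine nonneg_on_of_continuation (hcH.mono (Icc_subset_Icc ht₁.1 hth.2)) hH₁ ?_
    intro c hc1 hHc hc0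
    have hSc := hSpos c ⟨ht₁.1.trans hc1.1, hc1.2⟩
    have hvc := vel_pos_of_holdDist_eq h hu (fun t ht => (hv t ht).1) ht₁.1 hc1.1
      (hM₁ t₁ (right_mem_Icc.2 ht₁.1)) hHc hc0 hSc
    obtain ⟨ν₀, hν0, hν1, hν2, hν3⟩ := p.exists_brakeDist_lt hvc hSc
    have hcτ : c ∈ Icc t₀ τ := ⟨ht₁.1.trans hc1.1, hc1.2.le.trans hth.2⟩
    have hcb1 : ContinuousOn (fun t => p.brakeSlack (τ - t) (v t) ν₀) (Icc t₀ τ) := by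
      unfold Params.brakeSlack; fun_prop
    have hcb2 : ContinuousOn (fun t => -x t - p.brakeDist (τ - t) (v t) ν₀) (Icc t₀ τ) := by
      unfold Params.brakeDist; fun_prop
    have hev := ((hcv c hcτ).eventually (lt_mem_nhds hν1)).and
      (((hcb1 c hcτ).eventually (lt_mem_nhds hν2)).and ((hcb2 c hcτ).eventually
        (lt_mem_nhds (show 0 < -x c - p.brakeDist (τ - c) (v c) ν₀ by linarith))))
    rw [Filter.eventually_iff, Metric.mem_nhdsWithin_iff] at hev
    obtain ⟨ε, hε, hsub⟩ := hev
    refine ⟨ε / 2, by positivity, fun t ht => ?_⟩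
    have htth : t ≤ th := ht.2.trans (min_le_left _ _)
    have htε : t ≤ c + ε / 2 := ht.2.trans (min_le_right _ _)
    by_contra! hneg
    obtain ⟨d, hd, hd0, hd1⟩ := exists_last_nonneg ht.1
      (hcH.mono (Icc_subset_Icc hcτ.1 (htth.trans hth.2))) hc0.ge hneg
    have h0d : t₀ ≤ d := hcτ.1.trans hd.1
    have := holdDist_add_le_of_brake (p := p) (τ := τ) h h0d hd.2.le (fun r hr => by
      have hrI : r ∈ Icc t₀ th := ⟨h0d.trans hr.1.le, hr.2.le.trans htth⟩
      have hb := hsub (show r ∈ Metric.ball c ε ∩ Icc t₀ τ from ⟨by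
        rw [Metric.mem_ball, Real.dist_eq, abs_lt]
        constructor <;> linarith [hd.1, hr.1, hr.2], hrI.1, hrI.2.trans hth.2⟩)
      have hH := hd1 r ⟨hr.1, hr.2.le⟩
      refine hlt r hrI hH (p.exists_isProfile_of_brakeDist_le (hv r hrI.1).2 hν0 hb.1.le hb.2.1.le
        (by linarith [hb.2.2]) (by linarith)) (hr.2.trans_le (htth.trans hth.2)))
      (hSnn d ⟨h0d, hd.2.le.trans htth⟩) (hSnn t ⟨h0d.trans hd.2.le, htth⟩)
    linarith
  rcases le_total t t₁ with h1 | h1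
  · have := hM₁ t ⟨ht.1, h1⟩
    rw [Params.stopMargin] at this
    have a1 : 0 ≤ v t ^ 2 / (2 * -p.uMin) := by positivity
    have a2 : 0 ≤ p.νnom ^ 2 / (2 * p.uMax) := by positivity
    linarith
  rcases le_total t th with h2 | h2
  · have h3 := phase2 t ⟨h1, h2⟩
    rw [Params.holdDist] at h3
    have hv0 := (hv t ht.1).1
    have h4 : 0 ≤ v t * (τ - t) := mul_nonneg hv0 (by linarith [ht.2])
    have h5 : 0 ≤ max (p.νnom - v t) 0 ^ 2 / (2 * p.uMax) := by positivity
    rcases hv0.eq_or_lt with h6 | h6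
    · have h7 : 0 < max (p.νnom - v t) 0 ^ 2 / (2 * p.uMax) := by
        rw [← h6, sub_zero, max_eq_left hn.le]; positivity
      linarith
    · have : 0 < v t * (τ - t) := mul_pos h6 (by linarith [ht.2])
      linarith
  · have h3 := phase2 th ⟨ht₁.2, le_rfl⟩
    have h4 := h.pos_sub_le_of_acc_le hth.1 h2 fun r hr => hu r (hth.1.trans hr.1.le)
    rw [Params.slack] at hSth
    rw [Params.holdDist] at h3
    have h5 : max (p.νnom - v th) 0 = p.uMax * (τ - th) := by
      have : max (p.νnom - v th) 0 / p.uMax = τ - th := by linarith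
      rw [div_eq_iff hup.ne'] at this; linarith
    rw [h5] at h3
    have h6 : (p.uMax * (τ - th)) ^ 2 / (2 * p.uMax) = p.uMax * (τ - th) ^ 2 / 2 := by
      field_simp
    rw [h6] at h3
    have h7 : v th * (t - th) ≤ v th * (τ - th) := by
      gcongr
      · exact (hv th hth.1).1
      · exact ht.2.le
    have h8 : p.uMax * (t - th) ^ 2 / 2 < p.uMax * (τ - th) ^ 2 / 2 := by
      have : (t - th) ^ 2 < (τ - th) ^ 2 := by
        apply pow_lt_pow_left₀ <;> linarith [ht.2]
      nlinarith
    linarith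

end NotEarly
end Intersection
namespace Intersection
namespace Params
variable (p : Params)

/-! ### Earliest arrival -/

theorem mul_le_maxDist {T v : ℝ} (hT : 0 ≤ T) (hv : v ≤ p.vMax) : v * T ≤ p.maxDist T v := by
  have := p.add_maxDist_le hT le_rfl hv hv
    (by rw [sub_self]; exact mul_nonneg p.uMax_pos.le hT)
  rw [add_zero, p.maxDist_zero hv] at this
  linarith

/-- From the earliest arrival on, the distance `d` can be covered by maximum acceleration, and if `d`
is not too short, there is also time to reach `νnom`. -/
theorem earliestDuration_spec {d v : ℝ} (hd : 0 ≤ d) (hv : v ∈ Icc 0 p.vMax) :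
    (∀ T, p.earliestDuration d v ≤ T → d ≤ p.maxDist T v ∧
      (p.νnom ^ 2 / (2 * p.uMax) ≤ d → 0 ≤ p.slack T v)) ∧
    d / p.vMax ≤ p.earliestDuration d v ∧
    p.earliestDuration d v ≤ p.vMax / p.uMax + d / p.vMax := by
  have hu := p.uMax_pos
  have hV := p.vMax_pos
  have hn := p.νnom_pos
  have hslack : ∀ T, 0 ≤ T → p.νnom - v ≤ p.uMax * T → 0 ≤ p.slack T v := fun T h0 hT => by
    have : max (p.νnom - v) 0 / p.uMax ≤ T := by
      rw [div_le_iff₀ hu]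
      exact max_le (by linarith) (by positivity)
    rw [slack]; linarith
  unfold earliestDuration
  split_ifs with h
  · rw [le_div_iff₀ (by positivity)] at h
    set s := √(v ^ 2 + 2 * p.uMax * d) with hs
    have hnn : 0 ≤ v ^ 2 + 2 * p.uMax * d := by positivity
    have hs2 : s ^ 2 = v ^ 2 + 2 * p.uMax * d := Real.sq_sqrt hnn
    have hs0 : 0 ≤ s := Real.sqrt_nonneg _
    have hvs : v ≤ s := Real.le_sqrt_of_sq_le (by nlinarith)
    have hsV : s ≤ p.vMax := Real.sqrt_le_iff.2 ⟨hV.le, by linarith⟩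
    have hh : 0 ≤ (s - v) / p.uMax := div_nonneg (by linarith) hu.le
    have hdd : d = (v + s) / 2 * ((s - v) / p.uMax) := by
      field_simp; linarith
    have hus : p.uMax * ((s - v) / p.uMax) = s - v := by field_simp
    refine ⟨fun T hT => ⟨?_, fun hnd => hslack T (hh.trans hT) ?_⟩, ?_, ?_⟩
    · have h1 := p.add_maxDist_le (T := T - (s - v) / p.uMax) hh (by linarith) hv.2 hsV hus.ge
      have h2 := p.mul_le_maxDist (T := T - (s - v) / p.uMax) (by linarith) hsV
      have h3 : 0 ≤ s * (T - (s - v) / p.uMax) := mul_nonneg hs0 (by linarith)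
      rw [add_sub_cancel] at h1
      linarith
    · have h1 : p.νnom ≤ s := by
        refine Real.le_sqrt_of_sq_le ?_
        rw [div_le_iff₀ (by positivity)] at hnd
        nlinarith [hv.1]
      have h2 : p.uMax * ((s - v) / p.uMax) ≤ p.uMax * T := by gcongr
      linarith
    · rw [div_le_iff₀ hV]
      nth_rw 1 [hdd]
      rw [mul_comm _ p.vMax]
      gcongr
      linarith [hv.2]
    · have : (s - v) / p.uMax ≤ p.vMax / p.uMax := by
        gcongr; linarith [hv.1]
      have : 0 ≤ d / p.vMax := by positivity
      linarith
  · push Not at h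
    set D := (p.vMax ^ 2 - v ^ 2) / (2 * p.uMax) with hD
    have hD0 : 0 ≤ D := div_nonneg (by nlinarith [hv.1, hv.2]) (by positivity)
    have hDe : D = (v + p.vMax) / 2 * ((p.vMax - v) / p.uMax) := by rw [hD]; field_simp; ring
    have hh : 0 ≤ (p.vMax - v) / p.uMax := div_nonneg (by linarith [hv.2]) hu.le
    have hus : p.uMax * ((p.vMax - v) / p.uMax) = p.vMax - v := by field_simp
    have hdD : 0 ≤ (d - D) / p.vMax := div_nonneg (by linarith) hV.le
    have hspl : (d - D) / p.vMax = d / p.vMax - D / p.vMax := by ring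
    refine ⟨fun T hT => ⟨?_, fun _ => hslack T (by linarith) ?_⟩, ?_, ?_⟩
    · have h1 := p.add_maxDist_le (T := T - (p.vMax - v) / p.uMax) hh (by linarith) hv.2 le_rfl
        hus.ge
      have h2 := p.mul_le_maxDist (T := T - (p.vMax - v) / p.uMax) (by linarith) le_rfl
      have h3 : d - D ≤ p.vMax * (T - (p.vMax - v) / p.uMax) := by
        have : (d - D) / p.vMax ≤ T - (p.vMax - v) / p.uMax := by linarith
        rw [div_le_iff₀ hV] at this; linarith
      rw [add_sub_cancel] at h1
      linarith
    · have h2 : p.uMax * ((p.vMax - v) / p.uMax) ≤ p.uMax * T := by gcongr; linarith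
      linarith [p.νnom_le]
    · have : D / p.vMax ≤ (p.vMax - v) / p.uMax := by
        rw [div_le_iff₀ hV, hDe, mul_comm _ p.vMax]
        gcongr
        linarith [hv.2]
      linarith
    · have : (p.vMax - v) / p.uMax ≤ p.vMax / p.uMax := by
        gcongr; linarith [hv.1]
      have : 0 ≤ D / p.vMax := by positivity
      linarith

/-! ### The bound on the inter-approach times -/

theorem safeDist_of_le {v₁ v₂ : ℝ} (h0 : 0 ≤ v₁) (h : v₁ ≤ v₂) :
    p.safeDist v₁ v₂ = p.L + (v₂ ^ 2 - v₁ ^ 2) / (2 * -p.uMin) := by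
  have hK := p.neg_uMin_pos
  rw [safeDist, max_eq_right]
  · congr 1
    have := hK.ne'; have := p.uMin_neg.ne
    field_simp
  · have : 0 ≤ v₂ ^ 2 - v₁ ^ 2 := by nlinarith
    have : 0 < -2 * p.uMin := by linarith
    positivity

theorem safeDist_of_ge {v₁ v₂ : ℝ} (h0 : 0 ≤ v₂) (h : v₂ ≤ v₁) : p.safeDist v₁ v₂ = p.L := by
  have hK := p.neg_uMin_pos
  rw [safeDist, max_eq_left, add_zero]
  have : 0 ≤ v₁ ^ 2 - v₂ ^ 2 := by nlinarith
  have h2 : 0 < -2 * p.uMin := by linarith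
  have : 0 ≤ 1 / (-2 * p.uMin) * (v₁ ^ 2 - v₂ ^ 2) := by positivity
  linarith

theorem L_le_safeDist (v₁ v₂ : ℝ) : p.L ≤ p.safeDist v₁ v₂ := by
  rw [safeDist]; linarith [le_max_left 0 (1 / (-2 * p.uMin) * (v₂ ^ 2 - v₁ ^ 2))]

theorem safeDist_pos (v₁ v₂ : ℝ) : 0 < p.safeDist v₁ v₂ := p.L_pos.trans_le (p.L_le_safeDist _ _)

theorem safeDist_le {v₁ v₂ w₁ w₂ : ℝ} (h1 : 0 ≤ w₁) (h2 : w₁ ≤ v₁) (h3 : 0 ≤ v₂) (h4 : v₂ ≤ w₂) :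
    p.safeDist v₁ v₂ ≤ p.safeDist w₁ w₂ := by
  have hK := p.neg_uMin_pos
  unfold safeDist
  have : 0 < -2 * p.uMin := by linarith
  gcongr

theorem νnom_mul_Tnom : p.νnom * p.Tnom = p.safeDist p.νnom p.vMax := by
  have := p.νnom_pos
  rw [Tnom]; field_simp

theorem Tnom_pos : 0 < p.Tnom := div_pos (p.safeDist_pos _ _) p.νnom_pos

theorem σ₀_mul_Tnom_le_Tiat : p.σ₀ * p.Tnom ≤ p.Tiat := by
  unfold Tiat; split_ifs
  · exact le_rfl
  · exact le_max_left _ _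

theorem Tnom_le_Tiat : p.Tnom ≤ p.Tiat := by
  have := p.σ₀_mul_Tnom_le_Tiat
  nlinarith [p.Tnom_pos, p.one_lt_σ₀]

theorem Tiat_pos : 0 < p.Tiat := p.Tnom_pos.trans_le p.Tnom_le_Tiat

/-- `Tfol` is a quadratic polynomial with its maximum at `vLow`. -/
theorem Tfol_le_Tiat {v : ℝ} (hv0 : 0 ≤ v) (hv : v ≤ p.νnom) : p.Tfol v ≤ p.Tiat := by
  have hu := p.uMax_pos
  have hK := p.neg_uMin_pos
  have hK' := p.uMin_neg.ne
  have hV := p.vMax_pos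
  have hσ : 0 < p.σ₀ := by linarith [p.one_lt_σ₀]
  have hden : 0 < -p.uMin + p.σ₀ * p.uMax := by positivity
  set k := (1 / p.uMax + p.σ₀ / -p.uMin) / (2 * p.vMax) with hk
  have hkpos : 0 < k := by positivity
  set c := p.νnom ^ 2 / (2 * p.uMax * p.vMax) + p.σ₀ * (p.L + p.vMax ^ 2 / (2 * -p.uMin)) / p.vMax
    - p.νnom / p.uMax + k * p.vLow ^ 2 with hc
  have hform : ∀ w, 0 ≤ w → w ≤ p.vMax → p.Tfol w = c - k * (p.vLow - w) ^ 2 := fun w h0 h1 => by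
    rw [Tfol, p.safeDist_of_le h0 h1]
    have hvl : k * (2 * p.vLow) = 1 / p.uMax := by
      rw [hk, vLow]; field_simp; ring
    have : k * (p.vLow - w) ^ 2 = k * p.vLow ^ 2 - 1 / p.uMax * w + k * w ^ 2 := by
      rw [← hvl]; ring
    rw [this, hc, hk]
    field_simp
    ring
  have hvV : v ≤ p.vMax := hv.trans p.νnom_le
  unfold Tiat
  split_ifs with h
  · have h1 : p.Tfol v ≤ p.Tfol p.νnom := by
      rw [hform v hv0 hvV, hform _ p.νnom_pos.le p.νnom_le]
      have : (p.vLow - p.νnom) ^ 2 ≤ (p.vLow - v) ^ 2 := by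
        apply pow_le_pow_left₀ <;> linarith
      nlinarith
    refine h1.trans ?_
    have h2 : p.Tfol p.νnom = p.σ₀ * p.safeDist p.νnom p.vMax / p.vMax := by rw [Tfol]; ring
    rw [h2, Tnom, mul_div_assoc]
    gcongr
    · exact (p.safeDist_pos _ _).le
    · exact p.νnom_pos
    · exact p.νnom_le
  · push Not at h
    refine le_trans ?_ (le_max_right _ _)
    have h0 : 0 ≤ p.vLow := by
      unfold vLow
      positivity
    rw [hform v hv0 hvV, hform _ h0 (h.le.trans p.νnom_le)]
    have : 0 ≤ k * (p.vLow - v) ^ 2 := by positivity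
    nlinarith

theorem maxDist_add_mul_le {θ T v w : ℝ} (hT : 0 ≤ T)
    (hwV : w ≤ p.vMax) (hw : w ≤ v + p.uMax * θ) :
    p.maxDist θ v + w * T ≤ p.maxDist (θ + T) v := by
  have hu := p.uMax_pos
  set P := max (p.vMax - v - p.uMax * θ) 0 with hP
  have h1 := p.mul_le_maxDist (v := p.vMax - P) hT (by linarith [le_max_right (p.vMax - v - p.uMax * θ) 0])
  have h2 : w ≤ p.vMax - P := by
    have : P ≤ p.vMax - w := max_le (by linarith) (by linarith)
    linarith
  have h3 : w * T ≤ (p.vMax - P) * T := by gcongr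
  have h4 : p.maxDist θ v + p.maxDist T (p.vMax - P) = p.maxDist (θ + T) v := by
    simp only [maxDist, sub_sub_cancel, ← hP]
    have : max (P - p.uMax * T) 0 = max (p.vMax - v - p.uMax * (θ + T)) 0 := by
      have hT' : 0 ≤ p.uMax * T := by positivity
      rw [hP, mul_add]
      rcases max_cases (p.vMax - v - p.uMax * θ) 0 with ⟨h, h'⟩ | ⟨h, h'⟩
      · rw [h]; ring_nf
      · rw [h, max_eq_right (by linarith), max_eq_right (by linarith)]
    rw [this]
    ring
  linarith

theorem maxDist_mono {T v w : ℝ} (hT : 0 ≤ T) (hw : w ≤ p.vMax) (hvw : v ≤ w) :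
    p.maxDist T v ≤ p.maxDist T w := by
  have := p.add_maxDist_le (h := 0) le_rfl hT hw (hvw.trans hw) (by linarith)
  simpa using this

/-- `maxDist` is a concave function of the speed. -/
theorem maxDist_concave {S P μ : ℝ} (hS : 0 ≤ S) (hP : 0 ≤ P) (h0 : 0 ≤ μ) (h1 : μ ≤ 1) :
    (1 - μ) * (p.vMax * S) + μ * p.maxDist S (p.vMax - P) ≤ p.maxDist S (p.vMax - μ * P) := by
  have hu := p.uMax_pos
  simp only [maxDist, sub_sub_cancel]
  set z := p.uMax * S with hz
  have hz0 : 0 ≤ z := by positivity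
  have key : (μ * P) ^ 2 - max (μ * P - z) 0 ^ 2 ≤ μ * (P ^ 2 - max (P - z) 0 ^ 2) := by
    rcases le_total P z with h | h
    · have : μ * P ≤ z := by nlinarith
      rw [max_eq_right (by linarith), max_eq_right (by linarith)]
      have := mul_nonneg (mul_nonneg h0 (sub_nonneg.2 h1)) (sq_nonneg P)
      nlinarith
    · rw [max_eq_left (by linarith : 0 ≤ P - z)]
      rcases le_total (μ * P) z with h2 | h2
      · rw [max_eq_right (by linarith)]
        have : 0 ≤ μ * ((z - μ * P) * P + z * (P - z)) :=
          mul_nonneg h0 (add_nonneg (mul_nonneg (by linarith) hP) (mul_nonneg hz0 (by linarith)))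
        nlinarith
      · rw [max_eq_left (by linarith)]
        have : 0 ≤ (1 - μ) * z ^ 2 := mul_nonneg (by linarith) (sq_nonneg _)
        nlinarith
  have key2 := div_le_div_of_nonneg_right key (show 0 ≤ 2 * p.uMax by positivity)
  have e : μ * (P ^ 2 - max (P - z) 0 ^ 2) / (2 * p.uMax) =
    μ * ((P ^ 2 - max (P - z) 0 ^ 2) / (2 * p.uMax)) := by ring
  rw [e] at key2
  linarith

/-- The distance that a follower has to make up, from the moment at which it is coupled for the last
time, is covered within `Tiat` after the arrival of its predecessor. -/
theorem follower_maxDist {T θ S dp v a : ℝ} (hT : p.Tiat ≤ T) (hθ : 0 ≤ θ)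
    (hS : θ + T ≤ S) (hv : 0 ≤ v) (hva : v ≤ a) (ha : a ≤ p.vMax) (hdp : dp ≤ p.maxDist θ v)
    (hreach : p.νnom ≤ v + p.uMax * θ) :
    dp + p.σ₀ * p.safeDist v a ≤ p.maxDist S a := by
  have hu := p.uMax_pos
  have hV := p.vMax_pos
  have hK := p.neg_uMin_pos
  have hn := p.νnom_pos
  have hσ : 0 < p.σ₀ := by linarith [p.one_lt_σ₀]
  have hT0 : 0 ≤ T := p.Tiat_pos.le.trans hT
  have hσT : p.σ₀ * p.safeDist p.νnom p.vMax ≤ p.νnom * T := by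
    rw [← p.νnom_mul_Tnom]
    have := p.σ₀_mul_Tnom_le_Tiat.trans hT
    nlinarith
  have hS0 : 0 ≤ S := by linarith
  have hvV : v ≤ p.vMax := hva.trans ha
  have hend : dp + p.σ₀ * p.safeDist p.νnom p.vMax ≤ p.maxDist S v := by
    have h1 := p.maxDist_add_mul_le (T := S - θ) (by linarith) p.νnom_le hreach
    rw [add_sub_cancel] at h1
    have : p.νnom * T ≤ p.νnom * (S - θ) := by gcongr; linarith
    linarith
  rcases le_total p.νnom v with h | h
  · have h1 := p.safeDist_le hn.le h (hv.trans hva) ha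
    have h2 := p.maxDist_mono hS0 ha hva
    have : p.σ₀ * p.safeDist v a ≤ p.σ₀ * p.safeDist p.νnom p.vMax := by gcongr
    linarith
  · -- the difference of the two sides is concave in `a`, so that it suffices to check the claim for
    -- `a = v` and for `a = vMax`
    have hend' : dp + p.σ₀ * p.L ≤ p.maxDist S v := by
      have : p.σ₀ * p.L ≤ p.σ₀ * p.safeDist p.νnom p.vMax := by
        gcongr; exact p.L_le_safeDist _ _
      linarith
    have htop : dp + p.σ₀ * p.safeDist v p.vMax ≤ p.vMax * S := by
      have h1 := (p.Tfol_le_Tiat hv h).trans hT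
      have h2 : p.vMax * p.Tfol v = (p.νnom ^ 2 - v ^ 2) / (2 * p.uMax) +
          p.σ₀ * p.safeDist v p.vMax - p.vMax * (p.νnom - v) / p.uMax := by
        rw [Tfol]; field_simp
      have h3 : p.vMax * p.Tfol v ≤ p.vMax * T := by gcongr
      have h4 : p.maxDist θ v ≤ p.vMax * θ - ((p.vMax - v) ^ 2 - (p.vMax - p.νnom) ^ 2) / (2 * p.uMax) := by
        unfold maxDist
        gcongr
        refine max_le (by linarith) (by linarith [p.νnom_le])
      have h5 : ((p.vMax - v) ^ 2 - (p.vMax - p.νnom) ^ 2) / (2 * p.uMax) =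
        p.vMax * (p.νnom - v) / p.uMax - (p.νnom ^ 2 - v ^ 2) / (2 * p.uMax) := by
        field_simp; ring
      have h6 : p.vMax * (θ + T) ≤ p.vMax * S := by gcongr
      linarith
    rcases hvV.eq_or_lt with h1 | h1
    · have : a = v := by linarith
      rw [this, p.safeDist_of_ge hv le_rfl]; exact hend'
    set P := p.vMax - v with hP
    have hPpos : 0 < P := by linarith
    set μ := (p.vMax - a) / P with hμ
    have hμ0 : 0 ≤ μ := div_nonneg (by linarith) hPpos.le
    have hμ1 : μ ≤ 1 := by rw [hμ, div_le_one hPpos]; linarith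
    have hμP : μ * P = p.vMax - a := by rw [hμ]; field_simp
    have hc := p.maxDist_concave hS0 hPpos.le hμ0 hμ1
    rw [hμP, sub_sub_cancel, sub_sub_cancel] at hc
    have hD : p.safeDist v a ≤ (1 - μ) * p.safeDist v p.vMax + μ * p.L := by
      rw [p.safeDist_of_le hv hva, p.safeDist_of_le hv hvV]
      have h2 : a ^ 2 - v ^ 2 ≤ (1 - μ) * (p.vMax ^ 2 - v ^ 2) := by
        have ha' : a = p.vMax - μ * P := by linarith
        have hv' : v = p.vMax - P := by linarith
        rw [ha', hv']
        have : 0 ≤ μ * (1 - μ) * P ^ 2 := by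
          have := sub_nonneg.2 hμ1; positivity
        nlinarith
      have h3 := div_le_div_of_nonneg_right h2 (show 0 ≤ 2 * -p.uMin by positivity)
      rw [mul_div_assoc] at h3
      linarith
    have h7 : p.σ₀ * p.safeDist v a ≤ p.σ₀ * ((1 - μ) * p.safeDist v p.vMax + μ * p.L) := by gcongr
    have h8 := mul_le_mul_of_nonneg_left htop (sub_nonneg.2 hμ1)
    have h9 := mul_le_mul_of_nonneg_left hend' hμ0
    linarith

end Params

/-! ### Arrival -/

section Arrival

variable {p : Params} {x v u : ℝ → ℝ} {t₀ τ : ℝ}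

/-- An uncoupled vehicle that is not late arrives in time, with at least the nominal speed. -/
theorem nonneg_at_tau_of_not_late (h : Traj x v u t₀) (hv : ∀ t ≥ t₀, v t ∈ Icc 0 p.vMax)
    (h0τ : t₀ ≤ τ) (hlaw : ∀ t ∈ Ioc t₀ τ, v t < p.vMax → u t = p.guc τ t (x t) (v t))
    (hnl : ¬p.Late (τ - t₀) (-x t₀) (v t₀)) : 0 ≤ x τ ∧ p.νnom ≤ v τ := by
  have hup := p.uMax_pos
  have hcv := h.cont_v (a := t₀) (b := τ) le_rfl
  have hcx := h.cont_x (a := t₀) (b := τ) le_rfl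
  have hc1 : ContinuousOn (fun t => p.maxDist (τ - t) (v t) - -x t) (Icc t₀ τ) := by
    unfold Params.maxDist; fun_prop
  have hc2 : ContinuousOn (fun t => p.slack (τ - t) (v t)) (Icc t₀ τ) := by
    unfold Params.slack; fun_prop
  have hset : ∀ t, ¬p.Late (τ - t) (-x t) (v t) ↔
      0 ≤ p.maxDist (τ - t) (v t) - -x t ∧ 0 ≤ p.slack (τ - t) (v t) := fun t => by
    rw [Params.Late, not_or, not_lt, not_lt, sub_nonneg]
  have hZ : IsCompact (Icc t₀ τ ∩ {t | ¬p.Late (τ - t) (-x t) (v t)}) := by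
    refine isCompact_Icc.of_isClosed_subset ?_ inter_subset_left
    have h1 := hc1.preimage_isClosed_of_isClosed isClosed_Icc (isClosed_Ici (a := (0 : ℝ)))
    have h2 := hc2.preimage_isClosed_of_isClosed isClosed_Icc (isClosed_Ici (a := (0 : ℝ)))
    convert h1.inter h2 using 1
    ext t
    simp only [mem_inter_iff, mem_ofPred_eq, hset, mem_preimage, mem_Ici]
    tauto
  obtain ⟨c, ⟨hcI, hcl⟩, hmax⟩ := hZ.exists_isGreatest ⟨t₀, left_mem_Icc.2 h0τ, hnl⟩
  have hlow := h.min_le_vel (a := c) (b := τ) (c := p.vMax) (m := p.uMax) hcI.1 (fun r hr hrv => by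
    have hl : p.Late (τ - r) (-x r) (v r) := by
      by_contra hl
      exact absurd (hmax ⟨⟨hcI.1.trans hr.1.le, hr.2⟩, hl⟩) (not_le.2 hr.1)
    rw [hlaw r ⟨hcI.1.trans_lt hr.1, hr.2⟩ hrv, p.guc_of_late hrv.le hl]) hup.le
  have hd := h.maxDist_le_pos_sub p hcI.1 hcI.2 (hv c hcI.1).2 hlow
  rw [mem_ofPred_eq, hset] at hcl
  refine ⟨by linarith [hcl.1], le_trans (le_min p.νnom_le ?_) (hlow τ (right_mem_Icc.2 hcI.2))⟩
  have := hcl.2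
  rw [Params.slack] at this
  have h2 : max (p.νnom - v c) 0 / p.uMax ≤ τ - c := by linarith
  rw [div_le_iff₀ hup] at h2
  linarith [le_max_left (p.νnom - v c) 0]

/-- Either a vehicle arrives in time, or it moves with maximum acceleration since the last moment at
which it was coupled. -/
theorem arrival_dichotomy (h : Traj x v u t₀) (hv : ∀ t ≥ t₀, v t ∈ Icc 0 p.vMax)
    {C : ℝ → Prop} {B : ℝ} (h0τ : t₀ ≤ τ) (hτB : τ ≤ B) (hC : IsCompact (Icc t₀ B ∩ {t | C t}))
    (hlaw : ∀ t ≥ t₀, ¬C t → v t < p.vMax → u t = p.guc τ t (x t) (v t))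
    (hnl : ¬p.Late (τ - t₀) (-x t₀) (v t₀)) :
    (0 ≤ x τ ∧ p.νnom ≤ v τ) ∨
      ∃ c ∈ Icc t₀ B, C c ∧ ∀ t ∈ Icc c B, min p.vMax (v c + p.uMax * (t - c)) ≤ v t := by
  rcases (Icc t₀ B ∩ {t | C t}).eq_empty_or_nonempty with hne | hne
  · left
    refine nonneg_at_tau_of_not_late h hv h0τ (fun t ht htv => hlaw t ht.1.le (fun hCt => ?_) htv) hnl
    have : t ∈ Icc t₀ B ∩ {t | C t} := ⟨⟨ht.1.le, ht.2.trans hτB⟩, hCt⟩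
    rw [hne] at this
    exact this
  obtain ⟨c, ⟨hcI, hcC⟩, hmax⟩ := hC.exists_isGreatest hne
  have hnC : ∀ t ∈ Ioc c B, ¬C t := fun t ht hCt =>
    absurd (hmax ⟨⟨hcI.1.trans ht.1.le, ht.2⟩, hCt⟩) (not_le.2 ht.1)
  by_cases hex : ∃ t ∈ Icc c τ, ¬p.Late (τ - t) (-x t) (v t)
  · left
    obtain ⟨t, ht, htl⟩ := hex
    exact nonneg_at_tau_of_not_late (h.mono (hcI.1.trans ht.1))
      (fun r hr => hv r ((hcI.1.trans ht.1).trans hr)) ht.2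
      (fun r hr hrv => hlaw r ((hcI.1.trans ht.1).trans hr.1.le)
        (hnC r ⟨ht.1.trans_lt hr.1, hr.2.trans hτB⟩) hrv) htl
  · right
    push Not at hex
    refine ⟨c, hcI, hcC, h.min_le_vel hcI.1 (fun r hr hrv => ?_) p.uMax_pos.le⟩
    rw [hlaw r (hcI.1.trans hr.1.le) (hnC r hr) hrv]
    rcases le_total τ r with h1 | h1
    · rw [p.guc_of_le h1]
    · rw [p.guc_of_late hrv.le (hex r ⟨hr.1.le, h1⟩)]

variable {xp vp up : ℝ → ℝ} {tp A : ℝ}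

/-- A vehicle that moves with maximum acceleration since a moment at which it was coupled has
arrived within `Tiat` after its predecessor, and has the nominal speed from the arrival of its
predecessor on. -/
theorem arrival_of_coupled (h : Traj x v u t₀) (hv : ∀ t ≥ t₀, v t ∈ Icc 0 p.vMax)
    (hp : Traj xp vp up tp) (hvp : ∀ t ≥ tp, vp t ∈ Icc 0 p.vMax) (hup : ∀ t ≥ tp, up t ≤ p.uMax)
    (htA : tp ≤ A) (hA : xp A = 0) (hAv : ∀ t ≥ A, p.νnom ≤ vp t) {c B : ℝ} (hc : t₀ ≤ c)
    (hcp : tp ≤ c) (hcB : c ≤ B) (hcv : vp c ≤ v c)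
    (hcx : xp c - x c ≤ p.σ₀ * p.safeDist (vp c) (v c))
    (hlow : ∀ t ∈ Icc c B, min p.vMax (v c + p.uMax * (t - c)) ≤ v t) :
    (A ≤ B → p.νnom ≤ v B) ∧ ∀ T, p.Tiat ≤ T → A + T ≤ B → 0 ≤ x B := by
  have hum := p.uMax_pos
  have hn := p.νnom_pos
  have hσ : 0 < p.σ₀ := by linarith [p.one_lt_σ₀]
  have hd := h.maxDist_le_pos_sub p hc hcB (hv c hc).2 hlow
  rcases le_or_gt A c with hAc | hAc
  · have h1 : p.νnom ≤ v c := (hAv c hAc).trans hcv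
    refine ⟨fun _ => le_trans (le_min p.νnom_le ?_) (hlow B (right_mem_Icc.2 hcB)), fun T hT hB => ?_⟩
    · have : 0 ≤ p.uMax * (B - c) := mul_nonneg hum.le (by linarith)
      linarith
    · have h2 := p.mul_le_maxDist (sub_nonneg.2 hcB) (hv c hc).2
      have h3 : p.νnom * (B - c) ≤ v c * (B - c) := by gcongr
      have h4 := hp.const_le_pos_sub htA hAc (c := p.νnom) fun r hr => hAv r hr.1
      have h5 := p.safeDist_le hn.le (hAv c hAc) (hv c hc).1 (hv c hc).2
      have h6 : p.σ₀ * p.safeDist (vp c) (v c) ≤ p.σ₀ * (p.νnom * p.Tnom) := by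
        rw [p.νnom_mul_Tnom]; gcongr
      have h7 : p.νnom * (p.σ₀ * p.Tnom) ≤ p.νnom * (B - A) := by
        gcongr
        linarith [p.σ₀_mul_Tnom_le_Tiat]
      linarith
  · have h1 := hp.vel_sub_le hcp hAc.le (c := p.uMax) fun r hr => hup r (hcp.trans hr.1.le)
    have h2 := hAv A le_rfl
    have h3 := hp.pos_sub_le_maxDist p hcp hAc.le (fun r hr => hup r (hcp.trans hr.1))
      fun r hr => (hvp r (hcp.trans hr.1)).2
    refine ⟨fun hAB => le_trans (le_min p.νnom_le ?_) (hlow B (right_mem_Icc.2 hcB)), fun T hT hB => ?_⟩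
    · have : p.uMax * (A - c) ≤ p.uMax * (B - c) := by gcongr
      linarith
    · have := p.follower_maxDist (dp := -xp c) (S := B - c) (v := vp c) hT (sub_nonneg.2 hAc.le) (by linarith)
        (hvp c hcp).1 hcv (hv c hc).2 (by linarith) (by linarith)
      linarith

end Arrival

/-! ### Safe following -/

section Safety

variable {p : Params}

/-- At or above the safe distance, the safe-following control does not fall below `uMin`, so that the
control of a coupled vehicle is admissible. -/
theorem uMin_le_gus {v₁ v₂ σ u₁ : ℝ} (h0 : 0 ≤ v₁) (h : v₁ ≤ v₂) (hσ : 1 ≤ σ) (hu : p.uMin ≤ u₁) :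
    p.uMin ≤ p.gus v₁ v₂ σ u₁ := by
  have hK := p.neg_uMin_pos
  unfold Params.gus
  split_ifs with h2
  · exact hu
  have hv2 : 0 < v₂ := lt_of_le_of_ne (h0.trans h) (Ne.symm h2)
  have h3 : 1 - σ ≤ 1 + σ * (u₁ / -p.uMin) := by
    have : -1 ≤ u₁ / -p.uMin := by rw [le_div_iff₀ hK]; linarith
    nlinarith
  have h4 : 1 - σ ≤ v₁ / v₂ * (1 + σ * (u₁ / -p.uMin)) := by
    have h5 : v₁ / v₂ ≤ 1 := (div_le_one hv2).2 h
    have h6 : 0 ≤ v₁ / v₂ := by positivity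
    calc 1 - σ ≤ v₁ / v₂ * (1 - σ) := by nlinarith
      _ ≤ _ := by gcongr
  have h7 : -σ * (-p.uMin / σ) ≤ (v₁ / v₂ * (1 + σ * (u₁ / -p.uMin)) - 1) * (-p.uMin / σ) := by
    gcongr; linarith
  have : -σ * (-p.uMin / σ) = p.uMin := by field_simp
  linarith

/-- Below the safe distance, the safe-following control does not let the relative speed grow, and it
makes the safe distance shrink at least as fast as the distance. -/
theorem gus_bound {v₁ v₂ σ u₁ u₂ : ℝ} (h0 : 0 ≤ v₁) (h : v₁ ≤ v₂) (hσ : 0 < σ) (hσ1 : σ ≤ 1)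
    (hu : p.uMin ≤ u₁) (hu₂ : u₂ ≤ max p.uMin (p.gus v₁ v₂ σ u₁)) :
    u₂ ≤ u₁ ∧ v₂ * (u₂ - p.uMin) ≤ v₁ * (u₁ - p.uMin) := by
  have hK := p.neg_uMin_pos
  rcases (h0.trans h).eq_or_lt with h2 | h2
  · have hv1 : v₁ = 0 := by linarith
    rw [← h2, hv1, Params.gus, if_pos rfl, max_eq_right hu] at hu₂
    rw [← h2, hv1]
    exact ⟨hu₂, by simp⟩
  have key : v₂ * (u₂ - p.uMin) ≤ v₁ * (u₁ - p.uMin) := by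
    rcases le_max_iff.1 hu₂ with h3 | h3
    · have a1 : v₂ * (u₂ - p.uMin) ≤ 0 := mul_nonpos_of_nonneg_of_nonpos h2.le (by linarith)
      have a2 : 0 ≤ v₁ * (u₁ - p.uMin) := mul_nonneg h0 (by linarith)
      linarith
    · rw [Params.gus, if_neg h2.ne'] at h3
      have h4 := mul_le_mul_of_nonneg_left h3 h2.le
      have e : v₂ * ((v₁ / v₂ * (1 + σ * (u₁ / -p.uMin)) - 1) * (-p.uMin / σ)) =
          (v₁ - v₂) * (-p.uMin / σ) + v₁ * u₁ := by
        have := hK.ne'; have := p.uMin_neg.ne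
        field_simp; ring
      rw [e] at h4
      have h5 : (v₁ - v₂) * (-p.uMin / σ) ≤ (v₁ - v₂) * -p.uMin := by
        refine mul_le_mul_of_nonpos_left ?_ (by linarith)
        rw [le_div_iff₀ hσ]; nlinarith
      linarith
  refine ⟨?_, key⟩
  have : v₁ * (u₁ - p.uMin) ≤ v₂ * (u₁ - p.uMin) :=
    mul_le_mul_of_nonneg_right h (by linarith)
  have := le_of_mul_le_mul_left (key.trans this) h2
  linarith

/-- The switching law keeps a vehicle at the safe distance from its predecessor. -/
theorem safeDist_le_of_law {x₁ v₁ u₁ x₂ v₂ u₂ : ℝ → ℝ} {t₀ : ℝ} (h1 : Traj x₁ v₁ u₁ t₀)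
    (h2 : Traj x₂ v₂ u₂ t₀) (hv1 : ∀ t ≥ t₀, 0 ≤ v₁ t) (hv2 : ∀ t ≥ t₀, 0 ≤ v₂ t)
    (hu1 : ∀ t ≥ t₀, p.uMin ≤ u₁ t)
    (hinit : p.safeDist (v₁ t₀) (v₂ t₀) ≤ x₁ t₀ - x₂ t₀)
    (hlaw : ∀ t ≥ t₀, v₁ t ≤ v₂ t → x₁ t - x₂ t = p.safeDist (v₁ t) (v₂ t) → ∃ ε > 0,
      ∀ r ∈ Ico t (t + ε), u₂ r ≤ max p.uMin (p.gus (v₁ r) (v₂ r)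
        ((x₁ r - x₂ r) / p.safeDist (v₁ r) (v₂ r)) (u₁ r))) :
    ∀ t ≥ t₀, p.safeDist (v₁ t) (v₂ t) ≤ x₁ t - x₂ t := by
  have hK := p.neg_uMin_pos
  intro t ht
  by_contra! hcon
  have hcv1 := h1.continuousOn_v
  have hcv2 := h2.continuousOn_v
  have hcx1 := h1.continuousOn_x
  have hcx2 := h2.continuousOn_x
  have hcf : ContinuousOn (fun t => x₁ t - x₂ t - p.safeDist (v₁ t) (v₂ t)) (Ici t₀) := by
    unfold Params.safeDist; fun_prop
  obtain ⟨c, hc, hc0, hc1⟩ := exists_last_nonneg ht (hcf.mono Icc_subset_Ici_self)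
    (by linarith) (by linarith)
  have hct : t₀ ≤ c := hc.1
  -- where the follower is not faster, the distance grows
  have hslow : ∀ a b, c ≤ a → a ≤ b → (∀ r ∈ Icc a b, v₂ r ≤ v₁ r) →
      x₁ a - x₂ a - p.safeDist (v₁ a) (v₂ a) ≤ x₁ b - x₂ b - p.safeDist (v₁ b) (v₂ b) := by
    intro a b ha hab hle
    rw [p.safeDist_of_ge (hv2 a (hct.trans ha)) (hle a (left_mem_Icc.2 hab)),
      p.safeDist_of_ge (hv2 b (hct.trans (ha.trans hab))) (hle b (right_mem_Icc.2 hab))]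
    have e1 := h1.pos_sub (hct.trans ha) hab
    have e2 := h2.pos_sub_le (hct.trans ha) hab (h1.int_v (hct.trans ha) hab) hle
    linarith
  rcases lt_or_ge (v₂ c) (v₁ c) with hlt | hge
  · have hev := ((hcv1.sub hcv2) c hct).eventually (lt_mem_nhds (show 0 < v₁ c - v₂ c by linarith))
    rw [Filter.eventually_iff, Metric.mem_nhdsWithin_iff] at hev
    obtain ⟨ε, hε, hsub⟩ := hev
    have hm : 0 < min (ε / 2) (t - c) := lt_min (by positivity) (by linarith [hc.2])
    have := hslow c (c + min (ε / 2) (t - c)) le_rfl (by linarith) fun r hr => by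
      have := hsub (show r ∈ _ from ⟨by
        rw [Metric.mem_ball, Real.dist_eq, abs_lt]
        constructor <;> linarith [hr.1, hr.2, min_le_left (ε / 2) (t - c)], hct.trans hr.1⟩)
      rw [mem_ofPred_eq, Pi.sub_apply] at this
      linarith
    have := hc1 (c + min (ε / 2) (t - c)) ⟨by linarith, by linarith [min_le_right (ε / 2) (t - c)]⟩
    linarith
  · obtain ⟨ε₁, hε₁, hl⟩ := hlaw c hct hge (by linarith)
    have hDc := p.safeDist_pos (v₁ c) (v₂ c)
    have hev := ((hcx1.sub hcx2) c hct).eventually (lt_mem_nhds (show 0 < x₁ c - x₂ c by linarith))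
    rw [Filter.eventually_iff, Metric.mem_nhdsWithin_iff] at hev
    obtain ⟨ε₂, hε₂, hsub⟩ := hev
    set m := min (min ε₁ ε₂ / 2) (t - c) with hmdef
    have hm : 0 < m := lt_min (by positivity) (by linarith [hc.2])
    set b := c + m with hb
    have hmε : m ≤ min ε₁ ε₂ / 2 := min_le_left _ _
    have hmt : m ≤ t - c := min_le_right _ _
    have hε12 : 0 < min ε₁ ε₂ := lt_min hε₁ hε₂
    have hm1 : m < ε₁ := by linarith [min_le_left ε₁ ε₂]
    have hm2 : m < ε₂ := by linarith [min_le_right ε₁ ε₂]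
    have hcb : c ≤ b := by linarith
    have hpt : ∀ r ∈ Ioo c b, v₁ r ≤ v₂ r →
        u₂ r ≤ u₁ r ∧ v₂ r * (u₂ r - p.uMin) ≤ v₁ r * (u₁ r - p.uMin) := fun r hr hle => by
      have htr : t₀ ≤ r := hct.trans hr.1.le
      have hx : 0 < x₁ r - x₂ r := hsub (show r ∈ _ from ⟨by
        rw [Metric.mem_ball, Real.dist_eq, abs_lt]
        constructor <;> linarith [hr.1, hr.2], htr⟩)
      have hD := p.safeDist_pos (v₁ r) (v₂ r)
      have hneg := hc1 r ⟨hr.1, by linarith [hr.2]⟩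
      exact gus_bound (hv1 r htr) hle (div_pos hx hD) ((div_le_one hD).2 (by linarith)) (hu1 r htr)
        (hl r ⟨hr.1.le, by linarith [hr.2]⟩)
    -- once the follower is not faster, this remains so
    have hstay : ∀ s ∈ Icc c b, ∀ r ∈ Icc s b, v₂ s ≤ v₁ s → v₂ r ≤ v₁ r := by
      intro s hs r hr hle
      by_contra! hgt
      obtain ⟨d, hd, hd0, hd1⟩ := exists_last_nonneg (f := fun q => v₁ q - v₂ q) hr.1
        ((hcv1.sub hcv2).mono fun q hq => hct.trans (hs.1.trans hq.1)) (by linarith) (by linarith)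
      have h0d : t₀ ≤ d := hct.trans (hs.1.trans hd.1)
      have e1 := h1.vel_sub h0d hd.2.le
      have e2 := h2.vel_sub h0d hd.2.le
      have e3 := intervalIntegral.integral_mono_on_of_le_Ioo hd.2.le (h2.int' h0d hd.2.le)
        (h1.int' h0d hd.2.le) fun q hq => (hpt q ⟨(hs.1.trans hd.1).trans_lt hq.1,
          hq.2.trans_le hr.2⟩ (by linarith [hd1 q ⟨hq.1, hq.2.le⟩])).1
      linarith
    obtain ⟨a, ha, hfast, hslow'⟩ : ∃ a ∈ Icc c b, (∀ r ∈ Icc c a, v₁ r ≤ v₂ r) ∧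
        ∀ r ∈ Icc a b, v₂ r ≤ v₁ r ∨ a = b := by
      by_cases hz : ∃ s ∈ Icc c b, v₂ s ≤ v₁ s
      · obtain ⟨s, hs, hsl⟩ := hz
        rcases hge.eq_or_lt with h3 | h3
        · refine ⟨c, left_mem_Icc.2 hcb, fun r hr => ?_, fun r hr => Or.inl
            (hstay c (left_mem_Icc.2 hcb) r hr h3.ge)⟩
          rw [le_antisymm hr.2 hr.1]; exact h3.le
        · obtain ⟨a, ha, ha0, ha1⟩ := exists_first_nonpos (f := fun q => v₂ q - v₁ q) hs.1
            ((hcv2.sub hcv1).mono fun q hq => hct.trans hq.1) (by linarith) (by linarith)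
          have haI : a ∈ Icc c b := ⟨ha.1.le, ha.2.trans hs.2⟩
          refine ⟨a, haI, fun r hr => ?_, fun r hr => Or.inl (hstay a haI r hr (by linarith))⟩
          rcases hr.2.lt_or_eq with h4 | h4
          · linarith [ha1 r ⟨hr.1, h4⟩]
          · rw [h4]; linarith
      · push Not at hz
        exact ⟨b, right_mem_Icc.2 hcb, fun r hr => (hz r hr).le, fun r _ => Or.inr rfl⟩
    have h0a : t₀ ≤ a := hct.trans ha.1
    have hfa : 0 ≤ x₁ a - x₂ a - p.safeDist (v₁ a) (v₂ a) := by
      have hca : c ∈ Icc c a := left_mem_Icc.2 ha.1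
      have haa : a ∈ Icc c a := right_mem_Icc.2 ha.1
      rw [p.safeDist_of_le (hv1 c hct) (hfast c hca)] at hc0
      rw [p.safeDist_of_le (hv1 a h0a) (hfast a haa)]
      have e1 := h1.pos_sub hct ha.1
      have e2 := h2.pos_sub hct ha.1
      have e3 := h1.integral_vel_mul hct ha.1
      have e4 := h2.integral_vel_mul hct ha.1
      have i1 := h1.int_v hct ha.1
      have i2 := h2.int_v hct ha.1
      have i3 : IntervalIntegrable (fun r => v₁ r * u₁ r) volume c a :=
        (h1.int' hct ha.1).continuousOn_mul (by rw [uIcc_of_le ha.1]; exact h1.cont_v hct)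
      have i4 : IntervalIntegrable (fun r => v₂ r * u₂ r) volume c a :=
        (h2.int' hct ha.1).continuousOn_mul (by rw [uIcc_of_le ha.1]; exact h2.cont_v hct)
      have key := intervalIntegral.integral_mono_on_of_le_Ioo ha.1 (i4.sub i3)
        ((i1.sub i2).const_mul (-p.uMin)) fun r hr => by
          have := (hpt r ⟨hr.1, hr.2.trans_le ha.2⟩ (hfast r ⟨hr.1.le, hr.2.le⟩)).2
          linarith
      rw [intervalIntegral.integral_sub i4 i3, intervalIntegral.integral_const_mul,
        intervalIntegral.integral_sub i1 i2, e3, e4, ← e1, ← e2] at key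
      have k1 : (v₂ a ^ 2 - v₁ a ^ 2) / (2 * -p.uMin) - (v₂ c ^ 2 - v₁ c ^ 2) / (2 * -p.uMin) ≤
          (x₁ a - x₁ c) - (x₂ a - x₂ c) := by
        rw [← sub_div, div_le_iff₀ (by positivity)]
        linarith
      linarith
    have hfb : 0 ≤ x₁ b - x₂ b - p.safeDist (v₁ b) (v₂ b) := by
      rcases hslow' a (left_mem_Icc.2 ha.2) with h3 | h3
      · refine hfa.trans (hslow a b ha.1 ha.2 fun r hr => ?_)
        rcases hslow' r hr with h4 | h4
        · exact h4
        · rw [← h4] at hr; rw [le_antisymm hr.2 hr.1]; exact h3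
      · rw [← h3]; exact hfa
    have := hc1 b ⟨by linarith, by linarith⟩
    linarith

end Safety
end Intersection
namespace Intersection
namespace SchedProblem

/-! ### Velocities for a fixed order of passage -/

variable {ι : Type} (S : SchedProblem ι)

/-- The properties of the scheduling problems that arise. The lower bounds on the velocities vanish,
since all vehicles can stop before the intersection. -/
structure Regular (vM : ℝ) : Prop where
  nodup : S.bubbles.Nodup
  d_pos : ∀ i ∈ S.bubbles, 0 < S.d i
  vLo_eq : ∀ i ∈ S.bubbles, S.vLo i = 0
  vHi_pos : ∀ i ∈ S.bubbles, 0 < S.vHi i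
  vHi_le : ∀ i ∈ S.bubbles, S.vHi i ≤ vM
  occ_pos : ∀ i ∈ S.bubbles, 0 < S.occ i
  pos_inj : ∀ i ∈ S.bubbles, ∀ q ∈ S.bubbles, S.branch i = S.branch q → S.pos i = S.pos q → i = q
  WT_nonneg : 0 ≤ S.WT
  F_anti : ∀ i, AntitoneOn (S.F i) (Icc 0 vM)

variable {S} {vM : ℝ} (hS : S.Regular vM)

theorem timeOf_le_timeOf_iff {i : ι} (hd : 0 < S.d i) {v w : ℝ} (hv : 0 < v) (hw : 0 < w) :
    S.timeOf i v ≤ S.timeOf i w ↔ w ≤ v := by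
  rw [timeOf, timeOf, add_le_add_iff_left, div_le_div_iff_of_pos_left hd hv hw]

include hS

theorem Regular.vCap_pos {i : ι} (hi : i ∈ S.bubbles) : 0 < S.vCap i := by
  unfold vCap
  split_ifs with h
  · exact hS.vHi_pos i hi
  · push Not at h
    exact lt_min (hS.vHi_pos i hi) (div_pos (hS.d_pos i hi) (by linarith))

theorem Regular.le_vCap_iff {i : ι} (hi : i ∈ S.bubbles) {w : ℝ} (hw : 0 < w) :
    w ≤ S.vCap i ↔ w ≤ S.vHi i ∧ S.tauMin ≤ S.timeOf i w := by
  have hd := hS.d_pos i hi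
  unfold vCap
  split_ifs with h
  · have : 0 < S.d i / w := div_pos hd hw
    rw [timeOf]
    exact ⟨fun h1 => ⟨h1, by linarith⟩, fun h1 => h1.1⟩
  · push Not at h
    rw [le_min_iff, timeOf, le_div_iff₀ (by linarith), ← sub_le_iff_le_add', le_div_iff₀ hw,
      mul_comm w]

theorem Regular.timeOf_vCap_le {i : ι} (hi : i ∈ S.bubbles) :
    S.timeOf i (S.vCap i) ≤ max (S.timeOf i (S.vHi i)) S.tauMin := by
  have hd := hS.d_pos i hi
  have hv := hS.vHi_pos i hi
  unfold vCap
  split_ifs with h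
  · exact le_max_left _ _
  · push Not at h
    rcases min_cases (S.vHi i) (S.d i / (S.tauMin - S.now)) with ⟨h1, -⟩ | ⟨h1, -⟩
    · rw [h1]; exact le_max_left _ _
    · rw [h1]
      refine le_of_eq_of_le ?_ (le_max_right _ _)
      rw [timeOf, div_div_cancel₀ hd.ne']; ring

omit hS in
variable (S) in
/-- Velocity given to a bubble that passes after the bubble `o`. -/
noncomputable def headVel : Option (ι × ℝ) → ι → ℝ
  | none, i => S.vCap i
  | some (q, v), i => min (S.vCap i) (v / (S.c q i + S.b q i * v))

variable (S) in
/-- The time from which the intersection is free after the bubble `o`. -/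
noncomputable def release : Option (ι × ℝ) → ℝ
  | none => S.now
  | some (q, v) => S.timeOf q v + S.occ q

variable (S) in
/-- The bubble `o` belongs to the problem and has a positive velocity. -/
def Ok : Option (ι × ℝ) → Prop
  | none => True
  | some (q, v) => q ∈ S.bubbles ∧ 0 < v

omit hS in
theorem velAux_cons (o : Option (ι × ℝ)) (i : ι) (P : List ι) :
    S.velAux o (i :: P) = (i, S.headVel o i) :: S.velAux (some (i, S.headVel o i)) P := by
  cases o <;> rfl

omit hS in
theorem velAux_map_fst (o : Option (ι × ℝ)) (P : List ι) : (S.velAux o P).map Prod.fst = P := by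
  induction P generalizing o with
  | nil => cases o <;> rfl
  | cons i P ih => rw [velAux_cons, List.map_cons, ih]

omit hS in
theorem velAux_append (o : Option (ι × ℝ)) (P Q : List ι) :
    S.velAux o (P ++ Q) = S.velAux o P ++ S.velAux ((S.velAux o P).getLast?.or o) Q := by
  induction P generalizing o with
  | nil => cases o <;> simp [velAux]
  | cons i P ih =>
    rw [List.cons_append, velAux_cons, velAux_cons, ih, List.cons_append, List.getLast?_cons]
    congr 3
    cases (S.velAux (some (i, S.headVel o i)) P).getLast? <;> rfl

theorem Regular.headVel_spec {o : Option (ι × ℝ)} (ho : S.Ok o) {i : ι} (hi : i ∈ S.bubbles) :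
    0 < S.headVel o i ∧ S.timeOf i (S.headVel o i) = max (S.timeOf i (S.vCap i)) (S.release o) := by
  have hd := hS.d_pos i hi
  have hc := hS.vCap_pos hi
  rcases o with _ | ⟨q, v⟩
  · refine ⟨hc, (max_eq_left ?_).symm⟩
    have := div_pos hd hc
    simp only [release, timeOf, headVel]; linarith
  · obtain ⟨hq, hv⟩ := ho
    have hdq := hS.d_pos q hq
    have hoq := hS.occ_pos q hq
    have hw : 0 < v / (S.c q i + S.b q i * v) := by
      unfold c b; positivity
    have ht : S.timeOf i (v / (S.c q i + S.b q i * v)) = S.release (some (q, v)) := by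
      simp only [release, timeOf, c, b]
      field_simp
      ring
    refine ⟨lt_min hc hw, ?_⟩
    rw [← ht]
    simp only [headVel]
    rcases le_total (S.vCap i) (v / (S.c q i + S.b q i * v)) with h | h
    · rw [min_eq_left h, max_eq_left ((timeOf_le_timeOf_iff hd hw hc).2 h)]
    · rw [min_eq_right h, max_eq_right ((timeOf_le_timeOf_iff hd hc hw).2 h)]

theorem Regular.headVel_le {o : Option (ι × ℝ)} (ho : S.Ok o) {i : ι} (hi : i ∈ S.bubbles) :
    S.headVel o i ≤ S.vCap i := by
  rw [← timeOf_le_timeOf_iff (hS.d_pos i hi) (hS.vCap_pos hi) (hS.headVel_spec ho hi).1,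
    (hS.headVel_spec ho hi).2]
  exact le_max_left _ _

theorem Regular.ok_headVel {o : Option (ι × ℝ)} (ho : S.Ok o) {i : ι} (hi : i ∈ S.bubbles) :
    S.Ok (some (i, S.headVel o i)) := ⟨hi, (hS.headVel_spec ho hi).1⟩

theorem Regular.release_le {o : Option (ι × ℝ)} (ho : S.Ok o) {i : ι} (hi : i ∈ S.bubbles) :
    S.release o ≤ S.release (some (i, S.headVel o i)) := by
  have h1 := hS.occ_pos i hi
  have h2 : S.release (some (i, S.headVel o i)) = S.timeOf i (S.headVel o i) + S.occ i := rfl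
  rw [h2, (hS.headVel_spec ho hi).2]
  linarith [le_max_right (S.timeOf i (S.vCap i)) (S.release o)]

theorem Regular.velAux_mem {o : Option (ι × ℝ)} (ho : S.Ok o) {P : List ι}
    (hP : ∀ i ∈ P, i ∈ S.bubbles) :
    ∀ y ∈ S.velAux o P, 0 < y.2 ∧ y.2 ≤ S.vCap y.1 ∧ S.release o ≤ S.timeOf y.1 y.2 := by
  induction P generalizing o with
  | nil => cases o <;> simp [velAux]
  | cons i P ih =>
    have hi := hP i List.mem_cons_self
    intro y hy
    rw [velAux_cons, List.mem_cons] at hy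
    rcases hy with rfl | hy
    · refine ⟨(hS.headVel_spec ho hi).1, hS.headVel_le ho hi, ?_⟩
      rw [(hS.headVel_spec ho hi).2]; exact le_max_right _ _
    · have := ih (hS.ok_headVel ho hi) (fun j hj => hP j (List.mem_cons_of_mem _ hj)) y hy
      exact ⟨this.1, this.2.1, (hS.release_le ho hi).trans this.2.2⟩

theorem Regular.velAux_pairwise {o : Option (ι × ℝ)} (ho : S.Ok o) {P : List ι}
    (hP : ∀ i ∈ P, i ∈ S.bubbles) :
    (S.velAux o P).Pairwise fun y z => S.timeOf y.1 y.2 + S.occ y.1 ≤ S.timeOf z.1 z.2 := by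
  induction P generalizing o with
  | nil => cases o <;> simp [velAux]
  | cons i P ih =>
    have hi := hP i List.mem_cons_self
    have hP' : ∀ j ∈ P, j ∈ S.bubbles := fun j hj => hP j (List.mem_cons_of_mem _ hj)
    rw [velAux_cons, List.pairwise_cons]
    exact ⟨fun z hz => (hS.velAux_mem (hS.ok_headVel ho hi) hP' z hz).2.2,
      ih (hS.ok_headVel ho hi) hP'⟩

/-- No bubble is released later than all caps and the total occupancy time require. -/
theorem Regular.velAux_time_le {o : Option (ι × ℝ)} (ho : S.Ok o) {P : List ι}
    (hP : ∀ i ∈ P, i ∈ S.bubbles) {M : ℝ} (hM : ∀ i ∈ P, S.timeOf i (S.vCap i) ≤ M)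
    (hoM : S.release o ≤ M) :
    ∀ y ∈ S.velAux o P, S.timeOf y.1 y.2 + S.occ y.1 ≤ M + (P.map S.occ).sum := by
  induction P generalizing o M with
  | nil => cases o <;> simp [velAux]
  | cons i P ih =>
    have hi := hP i List.mem_cons_self
    have hP' : ∀ j ∈ P, j ∈ S.bubbles := fun j hj => hP j (List.mem_cons_of_mem _ hj)
    have hnn : 0 ≤ (P.map S.occ).sum := List.sum_nonneg fun x hx => by
      obtain ⟨j, hj, rfl⟩ := List.mem_map.1 hx
      exact (hS.occ_pos j (hP' j hj)).le
    have ht : S.timeOf i (S.headVel o i) ≤ M := by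
      rw [(hS.headVel_spec ho hi).2]; exact max_le (hM i List.mem_cons_self) hoM
    intro y hy
    rw [velAux_cons, List.mem_cons] at hy
    rw [List.map_cons, List.sum_cons]
    rcases hy with rfl | hy
    · simp only; linarith
    · have := ih (hS.ok_headVel ho hi) hP' (M := M + S.occ i)
        (fun j hj => (hM j (List.mem_cons_of_mem _ hj)).trans (by linarith [hS.occ_pos i hi]))
        (by simp only [release]; linarith) y hy
      linarith

theorem Regular.phi_anti {i : ι} (hi : i ∈ S.bubbles) {v w : ℝ} (hv : 0 < v) (hvw : v ≤ w)
    (hw : w ≤ S.vCap i) : S.phi i w ≤ S.phi i v := by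
  have hd := hS.d_pos i hi
  have h0 := hS.WT_nonneg
  have hwM : w ≤ vM :=
    (((hS.le_vCap_iff hi (hv.trans_le hvw)).1 hw).1).trans (hS.vHi_le i hi)
  have h1 := hS.F_anti i ⟨hv.le, hvw.trans hwM⟩ ⟨(hv.trans_le hvw).le, hwM⟩ hvw
  unfold phi
  gcongr

omit hS in
theorem listCost_cons (y : ι × ℝ) (l : List (ι × ℝ)) :
    S.listCost (y :: l) = S.phi y.1 y.2 + S.listCost l := by simp [listCost]

omit hS in
theorem listCost_append (l l' : List (ι × ℝ)) :
    S.listCost (l ++ l') = S.listCost l + S.listCost l' := by simp [listCost]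

/-- Passing later, or after additional bubbles, does not decrease the cost. -/
theorem Regular.listCost_filter_le {o o' : Option (ι × ℝ)} (ho : S.Ok o) (ho' : S.Ok o')
    (hoo : S.release o' ≤ S.release o) {Q : List ι} (hQ : ∀ i ∈ Q, i ∈ S.bubbles) (f : ι → Bool) :
    S.listCost (S.velAux o' (Q.filter f)) ≤ S.listCost ((S.velAux o Q).filter fun y => f y.1) := by
  induction Q generalizing o o' with
  | nil => cases o <;> cases o' <;> simp [velAux, listCost]
  | cons i Q ih =>
    have hi := hQ i List.mem_cons_self
    have hQ' : ∀ j ∈ Q, j ∈ S.bubbles := fun j hj => hQ j (List.mem_cons_of_mem _ hj)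
    have hd := hS.d_pos i hi
    rw [velAux_cons, List.filter_cons, List.filter_cons]
    have s1 := hS.headVel_spec ho hi
    have s2 := hS.headVel_spec ho' hi
    have ht : S.timeOf i (S.headVel o' i) ≤ S.timeOf i (S.headVel o i) := by
      rw [s1.2, s2.2]; exact max_le_max le_rfl hoo
    split_ifs with hf
    · rw [velAux_cons, listCost_cons, listCost_cons]
      refine add_le_add ?_ (ih (hS.ok_headVel ho hi) (hS.ok_headVel ho' hi) ?_ hQ')
      · exact hS.phi_anti hi s1.1 ((timeOf_le_timeOf_iff hd s2.1 s1.1).1 ht) (hS.headVel_le ho' hi)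
      · simp only [release]; linarith
    · exact ih (hS.ok_headVel ho hi) ho' (hoo.trans (hS.release_le ho hi)) hQ'

/-- The velocities of the recursion are optimal for the order `P`. -/
theorem Regular.listCost_le_of_pairwise {o : Option (ι × ℝ)} (ho : S.Ok o) {P : List ι}
    (hP : ∀ i ∈ P, i ∈ S.bubbles) {w : ι → ℝ} (hw : ∀ i ∈ P, 0 < w i)
    (hcap : ∀ i ∈ P, w i ≤ S.vCap i) (hrel : ∀ i ∈ P, S.release o ≤ S.timeOf i (w i))
    (hpw : P.Pairwise fun i q => S.timeOf i (w i) + S.occ i ≤ S.timeOf q (w q)) :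
    S.listCost (S.velAux o P) ≤ (P.map fun i => S.phi i (w i)).sum := by
  induction P generalizing o with
  | nil => cases o <;> simp [velAux, listCost]
  | cons i P ih =>
    have hi := hP i List.mem_cons_self
    have hwi := hw i List.mem_cons_self
    rw [List.pairwise_cons] at hpw
    have hmem : ∀ j ∈ P, j ∈ i :: P := fun j hj => List.mem_cons_of_mem _ hj
    have s := hS.headVel_spec ho hi
    have hd := hS.d_pos i hi
    have ht : S.timeOf i (S.headVel o i) ≤ S.timeOf i (w i) := by
      rw [s.2]
      exact max_le ((timeOf_le_timeOf_iff hd (hS.vCap_pos hi) hwi).2 (hcap i List.mem_cons_self))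
        (hrel i List.mem_cons_self)
    rw [velAux_cons, listCost_cons, List.map_cons, List.sum_cons]
    refine add_le_add ?_ (ih (hS.ok_headVel ho hi) (fun j hj => hP j (hmem j hj))
      (fun j hj => hw j (hmem j hj)) (fun j hj => hcap j (hmem j hj)) (fun j hj => ?_) hpw.2)
    · exact hS.phi_anti hi hwi ((timeOf_le_timeOf_iff hd s.1 hwi).1 ht) (hS.headVel_le ho hi)
    · have := hpw.1 j hj
      simp only [release]; linarith

variable [DecidableEq ι]

omit hS in
theorem lookup_eq_of_mem {l : List (ι × ℝ)} (hl : (l.map Prod.fst).Nodup) {i : ι} {v : ℝ}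
    (h : (i, v) ∈ l) : l.lookup i = some v := by
  induction l with
  | nil => simp at h
  | cons y l ih =>
    obtain ⟨j, w⟩ := y
    rw [List.map_cons, List.nodup_cons] at hl
    rw [List.lookup_cons]
    rcases List.mem_cons.1 h with h' | h'
    · rw [Prod.mk.injEq] at h'
      obtain ⟨rfl, rfl⟩ := h'
      simp
    · have hne : i ≠ j := by
        rintro rfl
        exact hl.1 (List.mem_map.2 ⟨(i, v), h', rfl⟩)
      have : (i == j) = false := by simpa using hne
      rw [this]
      exact ih hl.2 h'

omit hS in
theorem velList_eq_map {P : List ι} (hP : P.Nodup) :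
    S.velList P = P.map fun i => (i, S.velOpt P i) := by
  have h1 : (S.velList P).map Prod.fst = P := velAux_map_fst none P
  have h2 : ∀ y ∈ S.velList P, y = (y.1, S.velOpt P y.1) := fun y hy => by
    have := lookup_eq_of_mem (i := y.1) (v := y.2) (by rw [h1]; exact hP) hy
    rw [velOpt, this]; rfl
  calc S.velList P = (S.velList P).map ((fun i => (i, S.velOpt P i)) ∘ Prod.fst) := by
        conv_lhs => rw [← List.map_id (S.velList P)]
        exact List.map_congr_left fun y hy => h2 y hy
    _ = P.map fun i => (i, S.velOpt P i) := by rw [← List.map_map, h1]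

omit hS in
theorem cost_velOpt {P : List ι} (hP : P.Perm S.bubbles) (hnd : P.Nodup) :
    S.cost (S.velOpt P) = S.orderCost P := by
  rw [orderCost, velList_eq_map hnd, listCost, List.map_map, cost]
  exact ((hP.map _).sum_eq).symm

theorem Regular.velOpt_spec {P : List ι} (hP : ∀ i ∈ P, i ∈ S.bubbles) (hnd : P.Nodup) :
    ∀ i ∈ P, 0 < S.velOpt P i ∧ S.velOpt P i ≤ S.vCap i := fun i hi => by
  have h := hS.velAux_mem (o := none) trivial hP (i, S.velOpt P i) (by
    have : (i, S.velOpt P i) ∈ S.velList P := by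
      rw [velList_eq_map hnd]; exact List.mem_map.2 ⟨i, hi, rfl⟩
    exact this)
  exact ⟨h.1, h.2.1⟩

theorem Regular.velOpt_pairwise {P : List ι} (hP : ∀ i ∈ P, i ∈ S.bubbles) (hnd : P.Nodup) :
    P.Pairwise fun i q =>
      S.timeOf i (S.velOpt P i) + S.occ i ≤ S.timeOf q (S.velOpt P q) := by
  have h : (S.velList P).Pairwise _ := hS.velAux_pairwise (o := none) trivial hP
  rw [velList_eq_map hnd, List.pairwise_map] at h
  exact h

theorem Regular.velOpt_time_le {P : List ι} (hP : ∀ i ∈ P, i ∈ S.bubbles) (hnd : P.Nodup) {M : ℝ}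
    (hM : ∀ i ∈ P, S.timeOf i (S.vCap i) ≤ M) (hnow : S.now ≤ M) :
    ∀ i ∈ P, S.timeOf i (S.velOpt P i) + S.occ i ≤ M + (P.map S.occ).sum := fun i hi =>
  hS.velAux_time_le (o := none) trivial hP hM hnow (i, S.velOpt P i) (by
    have : (i, S.velOpt P i) ∈ S.velList P := by
      rw [velList_eq_map hnd]; exact List.mem_map.2 ⟨i, hi, rfl⟩
    exact this)

/-! ### Orders of passage -/

omit hS in
theorem idxOf_lt_of_pairwise {r : ι → ι → Prop} {P : List ι} (h : P.Pairwise r) {i q : ι}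
    (hi : i ∈ P) (hq : q ∈ P) (hlt : P.idxOf i < P.idxOf q) : r i q := by
  rw [List.pairwise_iff_getElem] at h
  have := h _ _ (List.idxOf_lt_length_iff.2 hi) (List.idxOf_lt_length_iff.2 hq) hlt
  rwa [List.getElem_idxOf, List.getElem_idxOf] at this

omit hS [DecidableEq ι] in
/-- A transitive relation that holds between immediate followers holds along a branch. -/
theorem of_pos_lt {r : ι → ι → Prop}
    (htrans : ∀ i ∈ S.bubbles, ∀ j ∈ S.bubbles, ∀ q ∈ S.bubbles, r i j → r j q → r i q)
    (hR : ∀ i ∈ S.bubbles, ∀ q ∈ S.bubbles, S.R i q → r i q) {i q : ι} (hi : i ∈ S.bubbles)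
    (hq : q ∈ S.bubbles) (hb : S.branch i = S.branch q) (hpos : S.pos q < S.pos i) : r i q := by
  classical
  obtain ⟨n, hn⟩ : ∃ n, (S.bubbles.toFinset.filter fun j => S.branch j = S.branch i ∧
    S.pos q < S.pos j ∧ S.pos j < S.pos i).card = n := ⟨_, rfl⟩
  induction n using Nat.strong_induction_on generalizing i q with
  | _ n ih =>
    by_cases h : ∃ j ∈ S.bubbles, S.branch j = S.branch i ∧ S.pos q < S.pos j ∧ S.pos j < S.pos i
    · obtain ⟨j, hj, hbj, h1, h2⟩ := h
      have hj' : j ∈ S.bubbles.toFinset.filter fun j => S.branch j = S.branch i ∧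
          S.pos q < S.pos j ∧ S.pos j < S.pos i := by simp [hj, hbj, h1, h2]
      refine htrans i hi j hj q hq (ih _ ?_ hi hj hbj.symm h2 rfl)
        (ih _ ?_ hj hq (hbj.trans hb) h1 rfl)
      · rw [← hn]
        refine Finset.card_lt_card ⟨fun a ha => ?_, fun hsub => ?_⟩
        · simp only [Finset.mem_filter] at ha ⊢
          exact ⟨ha.1, ha.2.1, h1.trans ha.2.2.1, ha.2.2.2⟩
        · have := hsub hj'
          simp at this
      · rw [← hn]
        refine Finset.card_lt_card ⟨fun a ha => ?_, fun hsub => ?_⟩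
        · simp only [Finset.mem_filter] at ha ⊢
          exact ⟨ha.1, ha.2.1.trans hbj, ha.2.2.1, ha.2.2.2.trans h2⟩
        · have := hsub hj'
          simp at this
    · exact hR i hi q hq ⟨hb, hpos, h⟩

omit hS in
theorem IsOrder.idxOf_lt {P : List ι} (hP : S.IsOrder P) {i q : ι} (hi : i ∈ S.bubbles)
    (hq : q ∈ S.bubbles) (hb : S.branch i = S.branch q) (hpos : S.pos q < S.pos i) :
    P.idxOf i < P.idxOf q :=
  of_pos_lt (r := fun i q => P.idxOf i < P.idxOf q) (fun _ _ _ _ _ _ => lt_trans)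
    (fun i hi q hq => hP.respects i (hP.perm.mem_iff.2 hi) q (hP.perm.mem_iff.2 hq)) hi hq hb hpos

theorem Regular.feasible_of_isOrder {P : List ι} (hP : S.IsOrder P) :
    S.Feasible (S.velOpt P) := by
  have hmem : ∀ i ∈ P, i ∈ S.bubbles := fun i hi => hP.perm.mem_iff.1 hi
  have hmem' : ∀ i ∈ S.bubbles, i ∈ P := fun i hi => hP.perm.mem_iff.2 hi
  have hnd : P.Nodup := hP.perm.nodup_iff.2 hS.nodup
  have hspec := hS.velOpt_spec hmem hnd
  have hpw := hS.velOpt_pairwise hmem hnd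
  have hcap : ∀ i ∈ S.bubbles, _ := fun i hi =>
    (hS.le_vCap_iff hi (hspec i (hmem' i hi)).1).1 (hspec i (hmem' i hi)).2
  refine ⟨fun i hi => (hspec i (hmem' i hi)).1, fun i hi => ⟨?_, (hcap i hi).1⟩,
    fun i hi => (hcap i hi).2, fun i hi q hq hR => ?_, fun i hi q hq hb => ?_⟩
  · rw [hS.vLo_eq i hi]; exact (hspec i (hmem' i hi)).1.le
  · exact idxOf_lt_of_pairwise hpw (hmem' i hi) (hmem' q hq)
      (hP.respects i (hmem' i hi) q (hmem' q hq) hR)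
  · have hne : P.idxOf i ≠ P.idxOf q := fun h => hb (by
      rw [(List.idxOf_inj (hmem' i hi)).1 h])
    rcases lt_or_gt_of_ne hne with h | h
    · exact Or.inr (idxOf_lt_of_pairwise hpw (hmem' i hi) (hmem' q hq) h)
    · exact Or.inl (idxOf_lt_of_pairwise hpw (hmem' q hq) (hmem' i hi) h)

/-- Every feasible choice of velocities defines an order of passage, whose optimal velocities do not
cost more. -/
theorem Regular.exists_isOrder_le {w : ι → ℝ} (hw : S.Feasible w) :
    ∃ P, S.IsOrder P ∧ S.orderCost P ≤ S.cost w := by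
  classical
  let r : ι → ι → Prop := fun i q => S.timeOf i (w i) ≤ S.timeOf q (w q)
  have : Std.Total r := ⟨fun i q => le_total _ _⟩
  have : IsTrans ι r := ⟨fun i j q => le_trans⟩
  set P := S.bubbles.insertionSort r with hPdef
  have hperm : P.Perm S.bubbles := List.perm_insertionSort r _
  have hnd : P.Nodup := hperm.nodup_iff.2 hS.nodup
  have hmem : ∀ i ∈ P, i ∈ S.bubbles := fun i hi => hperm.mem_iff.1 hi
  have hsort : P.Pairwise r := List.pairwise_insertionSort r _
  have hbranch : ∀ i ∈ S.bubbles, ∀ q ∈ S.bubbles, S.branch i = S.branch q → S.pos q < S.pos i →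
      S.timeOf i (w i) + S.occ i ≤ S.timeOf q (w q) := fun i hi q hq hb hpos =>
    of_pos_lt (r := fun i q => S.timeOf i (w i) + S.occ i ≤ S.timeOf q (w q))
      (fun i _ j hj q _ h1 h2 => by linarith [hS.occ_pos j hj]) hw.same_branch hi hq hb hpos
  have hdich : ∀ i ∈ S.bubbles, ∀ q ∈ S.bubbles, i ≠ q →
      S.timeOf q (w q) + S.occ q ≤ S.timeOf i (w i) ∨
      S.timeOf i (w i) + S.occ i ≤ S.timeOf q (w q) := fun i hi q hq hne => by
    by_cases hb : S.branch i = S.branch q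
    · rcases lt_trichotomy (S.pos i) (S.pos q) with h | h | h
      · exact Or.inl (hbranch q hq i hi hb.symm h)
      · exact absurd (hS.pos_inj i hi q hq hb h) hne
      · exact Or.inr (hbranch i hi q hq hb h)
    · exact hw.diff_branch i hi q hq hb
  have hpw : P.Pairwise fun i q => S.timeOf i (w i) + S.occ i ≤ S.timeOf q (w q) := by
    refine (hsort.and hnd).imp_of_mem fun {i q} hi hq h => ?_
    rcases hdich i (hmem i hi) q (hmem q hq) h.2 with h1 | h1
    · have := h.1
      have := hS.occ_pos q (hmem q hq)
      simp only [r] at *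
      linarith
    · exact h1
  refine ⟨P, ⟨hperm, fun i hi q hq hR => ?_⟩, ?_⟩
  · by_contra! hle
    have h1 := hw.same_branch i (hmem i hi) q (hmem q hq) hR
    have h2 := hS.occ_pos i (hmem i hi)
    rcases hle.lt_or_eq with h | h
    · have h3 := idxOf_lt_of_pairwise hpw hq hi h
      have h4 := hS.occ_pos q (hmem q hq)
      linarith
    · rw [(List.idxOf_inj hq).1 h] at h1
      linarith
  · have := hS.listCost_le_of_pairwise (o := none) trivial hmem (w := w)
      (fun i hi => hw.pos_vel i (hmem i hi))
      (fun i hi => (hS.le_vCap_iff (hmem i hi) (hw.pos_vel i (hmem i hi))).2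
        ⟨(hw.bounds i (hmem i hi)).2, hw.after_min i (hmem i hi)⟩)
      (fun i hi => by
        have := div_pos (hS.d_pos i (hmem i hi)) (hw.pos_vel i (hmem i hi))
        simp only [release, timeOf]; linarith) hpw
    refine le_of_le_of_eq this ?_
    exact (hperm.map _).sum_eq

end SchedProblem
end Intersection
namespace Intersection
namespace SchedProblem

/-! ### Branch and bound -/

variable {ι : Type} {S : SchedProblem ι} {vM : ℝ}

theorem perm_queue (k : Fin 4) :
    (S.queue k).Perm (S.bubbles.filter fun i => S.branch i = k) := by
  unfold queue
  exact List.perm_insertionSort _ _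

theorem mem_queue {k : Fin 4} {i : ι} : i ∈ S.queue k ↔ i ∈ S.bubbles ∧ S.branch i = k := by
  rw [(perm_queue k).mem_iff, List.mem_filter, decide_eq_true_eq]

theorem Regular.queue_nodup (hS : S.Regular vM) (k : Fin 4) : (S.queue k).Nodup :=
  (perm_queue k).nodup_iff.2 (hS.nodup.filter _)

theorem Regular.queue_pairwise (hS : S.Regular vM) (k : Fin 4) :
    (S.queue k).Pairwise fun i j => S.pos j < S.pos i := by
  classical
  have h : (S.queue k).Pairwise fun i j => S.pos j ≤ S.pos i := by
    unfold queue
    have : Std.Total fun i j => S.pos j ≤ S.pos i := ⟨fun i j => le_total _ _⟩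
    have : IsTrans ι fun i j => S.pos j ≤ S.pos i := ⟨fun i j q h1 h2 => h2.trans h1⟩
    exact List.pairwise_insertionSort _ _
  refine (h.and (hS.queue_nodup k)).imp_of_mem fun {i j} hi hj hij => ?_
  rw [mem_queue] at hi hj
  exact lt_of_le_of_ne hij.1 fun he =>
    hij.2 (hS.pos_inj i hi.1 j hj.1 (hi.2.trans hj.2.symm) he.symm)

variable [DecidableEq ι]

variable (S) in
/-- The nodes of the search tree: the partial orders of passage that respect the queues. -/
structure Valid (P : List ι) : Prop where
  nodup : P.Nodup
  mem : ∀ i ∈ P, i ∈ S.bubbles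
  prefix_queue : ∀ k, (P.filter fun i => S.branch i = k) <+: S.queue k

omit [DecidableEq ι] in
theorem valid_nil : S.Valid [] := ⟨List.nodup_nil, by simp, by simp⟩

theorem IsOrder.filter_eq_queue (hS : S.Regular vM) {P : List ι} (hP : S.IsOrder P) (k : Fin 4) :
    (P.filter fun i => S.branch i = k) = S.queue k := by
  have hnd : P.Nodup := hP.perm.nodup_iff.2 hS.nodup
  have hpw : P.Pairwise fun i q => S.branch i = S.branch q → S.pos q < S.pos i := by
    rw [List.pairwise_iff_getElem]
    intro a b ha hb hab hbr
    have hA := hP.perm.mem_iff.1 (List.getElem_mem ha)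
    have hB := hP.perm.mem_iff.1 (List.getElem_mem hb)
    rcases lt_trichotomy (S.pos P[a]) (S.pos P[b]) with h | h | h
    · have := hP.idxOf_lt hB hA hbr.symm h
      rw [hnd.idxOf_getElem, hnd.idxOf_getElem] at this
      omega
    · have := hS.pos_inj _ hA _ hB hbr h
      rw [hnd.getElem_inj_iff] at this
      omega
    · exact h
  have hpw' : (P.filter fun i => S.branch i = k).Pairwise fun i q => S.pos q < S.pos i :=
    (hpw.filter _).imp_of_mem fun {i q} hi hq h => by
      rw [List.mem_filter, decide_eq_true_eq] at hi hq
      exact h (hi.2.trans hq.2.symm)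
  refine List.Perm.eq_of_pairwise (fun i q _ _ h1 h2 => absurd h1 h2.le.not_gt) hpw'
    (hS.queue_pairwise k) ?_
  exact (hP.perm.filter _).trans (perm_queue k).symm

theorem Valid.isOrder (hS : S.Regular vM) {P : List ι} (hP : S.Valid P)
    (hperm : P.Perm S.bubbles) : S.IsOrder P := by
  refine ⟨hperm, fun i hi q hq hR => ?_⟩
  by_contra! hle
  have hne : P.idxOf q ≠ P.idxOf i := fun h => by
    have := (List.idxOf_inj hq).1 h
    exact absurd hR.2.1 (by rw [this]; exact lt_irrefl _)
  have h1 := (hS.queue_pairwise (S.branch q)).sublist (hP.prefix_queue (S.branch q)).sublist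
  rw [List.pairwise_filter] at h1
  have h2 := idxOf_lt_of_pairwise h1 hq hi (lt_of_le_of_ne hle hne)
  exact lt_asymm hR.2.1 (h2 (by simp) (by simp [hR.1]))

theorem Valid.queue_eq (hS : S.Regular vM) {P : List ι} (hP : S.Valid P) (k : Fin 4) :
    S.queue k = (P.filter fun i => S.branch i = k) ++ S.remaining P k := by
  obtain ⟨t, ht⟩ := hP.prefix_queue k
  have hnd := hS.queue_nodup k
  have hq : ∀ i ∈ S.queue k, S.branch i = k := fun i hi => (mem_queue.1 hi).2
  unfold remaining
  rw [← ht] at hnd hq ⊢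
  rw [List.filter_append]
  have h1 : ((P.filter fun i => S.branch i = k).filter fun i => i ∉ P) = [] := by
    rw [List.filter_eq_nil_iff]
    intro i hi
    simpa using (List.mem_filter.1 hi).1
  have h2 : (t.filter fun i => i ∉ P) = t := by
    rw [List.filter_eq_self]
    intro i hi
    have hb := hq i (List.mem_append_right _ hi)
    rw [decide_eq_true_eq]
    intro hiP
    exact (List.disjoint_of_nodup_append hnd) (List.mem_filter.2 ⟨hiP, by simpa using hb⟩) hi
  rw [h1, h2, List.nil_append]

theorem Valid.of_prefix (hS : S.Regular vM) {P Q : List ι} (h : S.IsOrder (P ++ Q)) :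
    S.Valid P ∧ ∀ k, S.remaining P k = Q.filter fun i => S.branch i = k := by
  have hnd : (P ++ Q).Nodup := h.perm.nodup_iff.2 hS.nodup
  have hv : S.Valid P := by
    refine ⟨(List.nodup_append.1 hnd).1, fun i hi => h.perm.mem_iff.1 (List.mem_append_left _ hi),
      fun k => ?_⟩
    rw [← h.filter_eq_queue hS k, List.filter_append]
    exact List.prefix_append _ _
  refine ⟨hv, fun k => ?_⟩
  have := hv.queue_eq hS k
  rw [← h.filter_eq_queue hS k, List.filter_append] at this
  exact (List.append_cancel_left this).symm

theorem mem_children {P P' : List ι} :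
    P' ∈ S.children P ↔ ∃ k i, (S.remaining P k).head? = some i ∧ P' = P ++ [i] := by
  unfold children
  rw [Multiset.mem_sum]
  simp only [Finset.mem_univ, true_and, Multiset.mem_coe, Option.mem_toList, Option.map_eq_some_iff]
  exact exists_congr fun k => exists_congr fun i => and_congr_right fun _ => eq_comm

theorem Valid.child (hS : S.Regular vM) {P P' : List ι} (hP : S.Valid P) (h : P' ∈ S.children P) :
    S.Valid P' := by
  obtain ⟨k, i, hi, rfl⟩ := mem_children.1 h
  obtain ⟨t, ht⟩ := List.head?_eq_some_iff.1 hi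
  have hmem : i ∈ S.remaining P k := by rw [ht]; exact List.mem_cons_self
  rw [remaining, List.mem_filter, decide_eq_true_eq, mem_queue] at hmem
  obtain ⟨⟨hib, hbr⟩, hiP⟩ := hmem
  refine ⟨?_, ?_, fun k' => ?_⟩
  · rw [List.nodup_append]
    refine ⟨hP.nodup, by simp, fun a ha b hb => ?_⟩
    rw [List.mem_singleton] at hb
    rintro rfl
    exact hiP (hb ▸ ha)
  · intro j hj
    rcases List.mem_append.1 hj with hj | hj
    · exact hP.mem j hj
    · rw [List.mem_singleton] at hj
      rw [hj]; exact hib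
  · rw [List.filter_append]
    by_cases hk : k = k'
    · subst hk
      rw [hP.queue_eq hS k, ht]
      refine ⟨t, ?_⟩
      simp [hbr]
    · have : (List.filter (fun i => decide (S.branch i = k')) [i]) = [] := by
        simp [hbr, hk]
      rw [this, List.append_nil]
      exact hP.prefix_queue k'

theorem exists_child_prefix (hS : S.Regular vM) {P P' : List ι} (hP' : S.IsOrder P')
    (h : P <+: P') (hne : P ≠ P') : ∃ C ∈ S.children P, C <+: P' := by
  obtain ⟨Q, rfl⟩ := h
  obtain ⟨hv, hrem⟩ := Valid.of_prefix hS hP'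
  rcases Q with _ | ⟨i, Q⟩
  · simp at hne
  · refine ⟨P ++ [i], mem_children.2 ⟨S.branch i, i, ?_, rfl⟩, Q, by simp⟩
    rw [hrem]
    simp

omit [DecidableEq ι] in
theorem sum_listCost_filter (l : List (ι × ℝ)) :
    ∑ k, S.listCost (l.filter fun y => S.branch y.1 = k) = S.listCost l := by
  induction l with
  | nil => simp [listCost]
  | cons y l ih =>
    rw [listCost_cons, ← ih]
    have : ∀ k, S.listCost ((y :: l).filter fun y => S.branch y.1 = k) =
        (if S.branch y.1 = k then S.phi y.1 y.2 else 0) +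
          S.listCost (l.filter fun y => S.branch y.1 = k) := fun k => by
      rw [List.filter_cons]
      by_cases h : S.branch y.1 = k
      · simp [h, listCost_cons]
      · simp [h]
    rw [Finset.sum_congr rfl fun k _ => this k, Finset.sum_add_distrib, Finset.sum_ite_eq]
    simp

/-- Dropping the bubbles of the other branches lets the remaining bubbles of a branch pass earlier, so
that the lower bound of a node does not exceed the cost of any complete order that extends it. -/
theorem lowerBound_le (hS : S.Regular vM) {P P' : List ι} (hP' : S.IsOrder P') (h : P <+: P') :
    S.lowerBound P ≤ S.orderCost P' := by
  obtain ⟨Q, rfl⟩ := h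
  obtain ⟨hv, hrem⟩ := Valid.of_prefix hS hP'
  have hQ : ∀ i ∈ Q, i ∈ S.bubbles := fun i hi => hP'.perm.mem_iff.1 (List.mem_append_right _ hi)
  have hok : S.Ok (S.velList P).getLast? := by
    rcases hl : (S.velList P).getLast? with _ | y
    · trivial
    · have hy : y ∈ S.velAux none P := List.mem_of_getLast? hl
      refine ⟨hv.mem _ ?_, (hS.velAux_mem (o := none) trivial hv.mem y hy).1⟩
      rw [← velAux_map_fst (S := S) none P]
      exact List.mem_map_of_mem hy
  have h1 : S.orderCost (P ++ Q) =
      S.orderCost P + S.listCost (S.velAux (S.velList P).getLast? Q) := by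
    rw [orderCost, velList, velAux_append, listCost_append, Option.or_none]; rfl
  rw [h1, lowerBound, ← sum_listCost_filter (S.velAux (S.velList P).getLast? Q)]
  refine add_le_add_right (Finset.sum_le_sum fun k _ => ?_) _
  rw [hrem]
  exact hS.listCost_filter_le hok hok le_rfl hQ _

variable (S) in
/-- The invariant of the search: every order either does not improve on the best one or extends an
open node. -/
structure SearchInv (a : List ι × Multiset (List ι)) : Prop where
  best : S.IsOrder a.1
  valid : ∀ P ∈ a.2, S.Valid P
  cover : ∀ P', S.IsOrder P' → S.orderCost a.1 ≤ S.orderCost P' ∨ ∃ P ∈ a.2, P <+: P'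

theorem searchInv_init {P₀ : List ι} (h : S.IsOrder P₀) : S.SearchInv (P₀, {[]}) :=
  ⟨h, fun P hP => by rw [Multiset.mem_singleton.1 hP]; exact valid_nil,
    fun P' _ => Or.inr ⟨[], Multiset.mem_singleton_self _, List.nil_prefix⟩⟩

theorem SearchInv.step (hS : S.Regular vM) {a a' : List ι × Multiset (List ι)}
    (h : S.SearchInv a) (hst : S.Step a a') : S.SearchInv a' := by
  have heq : ∀ {P P' : List ι}, P.Perm S.bubbles → S.IsOrder P' → P <+: P' → P = P' :=
    fun hP hP' hpre => hpre.eq_of_length (hP.length_eq.trans hP'.perm.length_eq.symm)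
  cases hst with
  | improve best P rest hP hlt =>
    refine ⟨(h.valid P (Multiset.mem_cons_self _ _)).isOrder hS hP,
      fun Q hQ => h.valid Q (Multiset.mem_cons_of_mem hQ), fun P' hP' => ?_⟩
    rcases h.cover P' hP' with h1 | ⟨Q, hQ, hpre⟩
    · exact Or.inl (hlt.le.trans h1)
    · rcases Multiset.mem_cons.1 hQ with rfl | hQ
      · exact Or.inl (by rw [heq hP hP' hpre])
      · exact Or.inr ⟨Q, hQ, hpre⟩
  | reject best P rest hP hle =>
    refine ⟨h.best, fun Q hQ => h.valid Q (Multiset.mem_cons_of_mem hQ), fun P' hP' => ?_⟩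
    rcases h.cover P' hP' with h1 | ⟨Q, hQ, hpre⟩
    · exact Or.inl h1
    · rcases Multiset.mem_cons.1 hQ with rfl | hQ
      · exact Or.inl (by rw [← heq hP hP' hpre]; exact hle)
      · exact Or.inr ⟨Q, hQ, hpre⟩
  | prune best P rest hP hne hlt =>
    refine ⟨h.best, fun Q hQ => h.valid Q (Multiset.mem_cons_of_mem hQ), fun P' hP' => ?_⟩
    rcases h.cover P' hP' with h1 | ⟨Q, hQ, hpre⟩
    · exact Or.inl h1
    · rcases Multiset.mem_cons.1 hQ with rfl | hQ
      · exact Or.inl (hlt.le.trans (lowerBound_le hS hP' hpre))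
      · exact Or.inr ⟨Q, hQ, hpre⟩
  | expand best P rest hP _ =>
    refine ⟨h.best, fun Q hQ => ?_, fun P' hP' => ?_⟩
    · rcases Multiset.mem_add.1 hQ with hQ | hQ
      · exact (h.valid P (Multiset.mem_cons_self _ _)).child hS hQ
      · exact h.valid Q (Multiset.mem_cons_of_mem hQ)
    · rcases h.cover P' hP' with h1 | ⟨Q, hQ, hpre⟩
      · exact Or.inl h1
      · rcases Multiset.mem_cons.1 hQ with rfl | hQ
        · obtain ⟨C, hC, hC'⟩ := exists_child_prefix hS hP' hpre
            (fun he => hP (he ▸ hP'.perm))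
          exact Or.inr ⟨C, Multiset.mem_add.2 (Or.inl hC), hC'⟩
        · exact Or.inr ⟨Q, Multiset.mem_add.2 (Or.inr hQ), hpre⟩

theorem Regular.isOrder_of_isOutput (hS : S.Regular vM) {P : List ι} (h : S.IsOutput P) :
    S.IsOrder P ∧ ∀ P', S.IsOrder P' → S.orderCost P ≤ S.orderCost P' := by
  obtain ⟨P₀, h0, hst⟩ := h
  have hinv : ∀ b, Relation.ReflTransGen S.Step (P₀, {[]}) b → S.SearchInv b := fun b hb => by
    induction hb with
    | refl => exact searchInv_init h0
    | tail _ h1 ih => exact ih.step hS h1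
  have := hinv _ hst
  exact ⟨this.best, fun P' hP' => (this.cover P' hP').resolve_right (by simp)⟩

/-- The schedule computed by the search is optimal. -/
theorem Regular.cost_velOpt_le (hS : S.Regular vM) {P : List ι} (h : S.IsOutput P) {w : ι → ℝ}
    (hw : S.Feasible w) : S.cost (S.velOpt P) ≤ S.cost w := by
  obtain ⟨h1, h2⟩ := hS.isOrder_of_isOutput h
  obtain ⟨P', hP', hle⟩ := hS.exists_isOrder_le hw
  rw [cost_velOpt h1.perm (h1.perm.nodup_iff.2 hS.nodup)]
  exact (h2 P' hP').trans hle

variable (S) in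
/-- Total weight of the open nodes. The base exceeds the number of children of a node, which is at
most four, so that a node weighs more than all its children together. -/
def weight (Q : Multiset (List ι)) : ℕ :=
  (Q.map fun P => 5 ^ (S.bubbles.length + 1 - P.length)).sum

omit [DecidableEq ι] in
theorem weight_cons (P : List ι) (Q : Multiset (List ι)) :
    S.weight (P ::ₘ Q) = 5 ^ (S.bubbles.length + 1 - P.length) + S.weight Q := by
  simp [weight]

theorem card_children_le (P : List ι) : (S.children P).card ≤ 4 := by
  unfold children
  rw [Multiset.card_sum]
  refine (Finset.sum_le_card_nsmul _ _ 1 fun k _ => ?_).trans (by simp)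
  rw [Multiset.coe_card]
  cases (Option.map (fun i => P ++ [i]) (S.remaining P k).head?) <;> simp

theorem weight_children_lt {P : List ι} (hP : S.Valid P) :
    S.weight (S.children P) < 5 ^ (S.bubbles.length + 1 - P.length) := by
  have hlen : P.length ≤ S.bubbles.length := (hP.nodup.subperm hP.mem).length_le
  have h : S.weight (S.children P) ≤ 4 * 5 ^ (S.bubbles.length - P.length) := by
    unfold weight
    refine (Multiset.sum_le_card_nsmul _ (5 ^ (S.bubbles.length - P.length)) fun x hx => ?_).trans ?_
    · obtain ⟨C, hC, rfl⟩ := Multiset.mem_map.1 hx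
      obtain ⟨k, i, -, rfl⟩ := mem_children.1 hC
      exact Nat.pow_le_pow_right (by norm_num) (by simp)
    · rw [Multiset.card_map, smul_eq_mul]
      exact Nat.mul_le_mul_right _ (card_children_le P)
  refine h.trans_lt ?_
  rw [Nat.sub_add_comm hlen, pow_succ, mul_comm]
  exact Nat.mul_lt_mul_of_pos_left (by norm_num) (by positivity)

theorem SearchInv.weight_lt {a a' : List ι × Multiset (List ι)} (h : S.SearchInv a)
    (hst : S.Step a a') : S.weight a'.2 < S.weight a.2 := by
  cases hst with
  | improve best P rest _ _ => simp only [weight_cons]; exact Nat.lt_add_of_pos_left (by positivity)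
  | reject best P rest _ _ => simp only [weight_cons]; exact Nat.lt_add_of_pos_left (by positivity)
  | prune best P rest _ _ _ => simp only [weight_cons]; exact Nat.lt_add_of_pos_left (by positivity)
  | expand best P rest _ _ =>
    have h1 := weight_children_lt (h.valid P (Multiset.mem_cons_self _ _))
    have h2 : S.weight (S.children P + rest) = S.weight (S.children P) + S.weight rest := by
      simp [weight]
    simp only [weight_cons]
    omega

theorem Regular.searchTerminates (hS : S.Regular vM) : S.SearchTerminates := by
  rintro P₀ h0 ⟨a, ha0, ha⟩
  have hinv : ∀ n, S.SearchInv (a n) := fun n => by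
    induction n with
    | zero => rw [ha0]; exact searchInv_init h0
    | succ n ih => exact ih.step hS (ha n)
  have hw : ∀ n, S.weight (a n).2 + n ≤ S.weight (a 0).2 := fun n => by
    induction n with
    | zero => simp
    | succ n ih => have := (hinv n).weight_lt (ha n); omega
  have := hw (S.weight (a 0).2 + 1)
  omega

end SchedProblem
end Intersection
namespace Intersection

/-! ### Vehicles: entry into a bubble, bounds on the motion, safety -/

namespace Params

variable {p : Params}

theorem instant_mono : Monotone p.instant := fun a b h => by
  have := p.Tcs_pos
  unfold instant
  gcongr

theorem instant_succ (s : ℕ) : p.instant (s + 1) = p.instant s + p.Tcs := by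
  unfold instant; push_cast; ring

theorem instant_strictMono : StrictMono p.instant :=
  strictMono_nat_of_lt_succ fun s => by rw [instant_succ]; linarith [p.Tcs_pos]

theorem instant_nonneg (s : ℕ) : 0 ≤ p.instant s := by
  have := p.Tcs_pos
  unfold instant; positivity

theorem localControl_spec {C : Prop} {τ t x v v₁ σ u₁ u : ℝ}
    (hg : C → p.uMin ≤ p.gus v₁ v σ u₁) (hu : u = p.localControl C τ t x v v₁ σ u₁) :
    u ∈ Icc p.uMin p.uMax ∧ (p.guc τ t x v = p.uMin → u = p.uMin) ∧
      (¬C → v < p.vMax → u = p.guc τ t x v) ∧ (C → u ≤ max p.uMin (p.gus v₁ v σ u₁)) := by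
  have h1 := p.guc_mem τ t x v
  have h2 := p.uMin_neg
  have h3 := p.uMax_pos
  have hsat : ∀ g, p.uMin ≤ g → sat p.uMin 0 g = min 0 g := fun g hg => by
    unfold sat; exact max_eq_right (le_min h2.le hg)
  rw [hu]
  unfold localControl gsf
  by_cases hC : C
  · have h4 := hg hC
    have h5 : p.uMin ≤ min (p.guc τ t x v) (p.gus v₁ v σ u₁) := le_min h1.1 h4
    have h6 : min (p.guc τ t x v) (p.gus v₁ v σ u₁) ≤ p.uMax := (min_le_left _ _).trans h1.2
    simp only [hC, if_true, not_true, false_imp_iff, true_and, forall_const]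
    split_ifs with h
    · exact ⟨⟨h5, h6⟩, fun h => by rw [h]; exact min_eq_left h4,
        (min_le_right _ _).trans (le_max_right _ _)⟩
    · rw [hsat _ h5]
      exact ⟨⟨le_min h2.le h5, (min_le_left _ _).trans h3.le⟩,
        fun h => by rw [h, min_eq_left h4]; exact min_eq_right h2.le,
        (min_le_right _ _).trans ((min_le_right _ _).trans (le_max_right _ _))⟩
  · simp only [hC, if_false, not_false_iff, forall_const, false_imp_iff, and_true]
    split_ifs with h
    · exact ⟨h1, fun h => h, fun _ => rfl⟩
    · rw [hsat _ h1.1]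
      exact ⟨⟨le_min h2.le h1.1, (min_le_left _ _).trans h3.le⟩,
        fun h => by rw [h]; exact min_eq_right h2.le, fun h' => absurd h' h⟩

theorem localControl_nonneg {C : Prop} {τ t x v v₁ σ u₁ : ℝ} (hv : v < 0) (hC : ¬C) :
    0 ≤ p.localControl C τ t x v v₁ σ u₁ := by
  unfold localControl
  rw [if_pos (hv.trans p.vMax_pos), if_neg hC]
  exact p.guc_nonneg_of_nonpos hv.le

theorem localControl_nonpos {C : Prop} {τ t x v v₁ σ u₁ : ℝ} (hv : p.vMax ≤ v) :
    p.localControl C τ t x v v₁ σ u₁ ≤ 0 := by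
  unfold localControl
  rw [if_neg hv.not_gt]
  unfold sat
  exact max_le p.uMin_neg.le (min_le_left _ _)

end Params

namespace Evolution

variable {e : Evolution} {p : Params} {T : ℝ} {F : ℕ → Bubble → ℝ → ℝ}

variable (e p) in
/-- The first clustering instance that is not before the appearance of the vehicle. -/
noncomputable def inst (k : Fin 4) (n : ℕ) : ℕ := ⌈e.spawn k n / p.Tcs⌉₊

variable (e p) in
/-- The time at which the vehicle is clustered. -/
noncomputable def joinTime (k : Fin 4) (n : ℕ) : ℝ := p.instant (e.inst p k n)

theorem spawn_le_instant_iff {k : Fin 4} {n s : ℕ} :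
    e.spawn k n ≤ p.instant s ↔ e.inst p k n ≤ s := by
  rw [inst, Nat.ceil_le, Params.instant, div_le_iff₀ p.Tcs_pos]

theorem spawn_le_joinTime (k : Fin 4) (n : ℕ) : e.spawn k n ≤ e.joinTime p k n :=
  spawn_le_instant_iff.2 le_rfl

theorem mem_newBubbles {s : ℕ} {b : Bubble} :
    b ∈ e.newBubbles s ↔ b.members ∈ e.clusters s b.branch := by
  simp only [newBubbles, Finset.mem_biUnion, Finset.mem_univ, true_and, Finset.mem_image]
  constructor
  · rintro ⟨k, B, hB, rfl⟩; exact hB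
  · intro h; exact ⟨b.branch, b.members, h, rfl⟩

theorem coupled_iff {k : Fin 4} {n : ℕ} {t : ℝ} :
    e.Coupled p k n t ↔ 1 ≤ n ∧ e.v k (n - 1) t ≤ e.v k n t ∧
      p.safeDist (e.v k (n - 1) t) (e.v k n t) ≤ e.x k (n - 1) t - e.x k n t ∧
      e.x k (n - 1) t - e.x k n t ≤ p.σ₀ * p.safeDist (e.v k (n - 1) t) (e.v k n t) := by
  have := p.safeDist_pos (e.v k (n - 1) t) (e.v k n t)
  unfold Coupled Params.couplingSet safetyRatio
  rw [mem_ofPred_eq, mem_Icc, le_div_iff₀ this, div_le_iff₀ this, one_mul]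

variable (e p) in
/-- New vehicles are at a safe distance from their predecessors. -/
def SafeStart : Prop :=
  ∀ s, ∀ b ∈ e.newBubbles s, ∀ n ∈ b.members, 1 ≤ n →
    1 ≤ e.safetyRatio p b.branch n (p.instant s)

namespace IsClosedLoop

variable (he : e.IsClosedLoop p T F)
include he

theorem spawn_nonneg {k : Fin 4} {n : ℕ} (hn : (n : ℕ∞) < e.count k) : 0 ≤ e.spawn k n := by
  rcases he.spawn_pos k n hn with h | h
  · exact h.1.ge
  · exact h.1.le

theorem traj {k : Fin 4} {n : ℕ} (hn : (n : ℕ∞) < e.count k) :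
    Traj (e.x k n) (e.v k n) (e.u k n) (e.spawn k n) :=
  ⟨fun t ht => (he.dynamics k n hn t ht).1, fun t ht => (he.dynamics k n hn t ht).2.1,
    fun t ht => (he.dynamics k n hn t ht).2.2⟩

theorem mem_cluster_iff {s : ℕ} {k : Fin 4} {n : ℕ} :
    (∃ B ∈ e.clusters s k, n ∈ B) ↔ n ∈ e.newVehicles p s k := by
  obtain ⟨A, C, hA, hC, -⟩ := he.clustering s k
  rw [← hA, ← hC, Finset.mem_coe]
  constructor
  · rintro ⟨B, hB, hn⟩; exact C.le hB hn
  · exact fun hn => C.exists_mem hn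

theorem joinTime_lt {k : Fin 4} {n : ℕ} (hn : (n : ℕ∞) < e.count k) :
    e.joinTime p k n < e.spawn k n + p.Tcs := by
  have h := Nat.ceil_lt_add_one (div_nonneg (he.spawn_nonneg hn) p.Tcs_pos.le)
  have h1 := mul_lt_mul_of_pos_right h p.Tcs_pos
  rw [add_mul, div_mul_cancel₀ _ p.Tcs_pos.ne', one_mul] at h1
  exact h1

/-- No vehicle is clustered before the first instance after its appearance. -/
theorem not_clustered_of_lt {k : Fin 4} {n s : ℕ} (h : s < e.inst p k n) :
    ¬∃ B ∈ e.clusters s k, n ∈ B := by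
  rw [he.mem_cluster_iff]
  intro hn
  exact absurd (spawn_le_instant_iff.1 hn.2.1) h.not_ge

theorem free_before_joinTime {k : Fin 4} {n : ℕ} (hn : (n : ℕ∞) < e.count k) {t : ℝ}
    (h0 : e.spawn k n ≤ t) (ht : t < e.joinTime p k n) :
    e.v k n t ∈ Icc 0 p.vMax ∧ e.u k n t ∈ Icc p.uMin p.uMax :=
  he.unclustered k n hn t h0 fun _ hs =>
    he.not_clustered_of_lt (Params.instant_strictMono.lt_iff_lt.1 (hs.trans_lt ht))

theorem vel_mem_of_le_joinTime {k : Fin 4} {n : ℕ} (hn : (n : ℕ∞) < e.count k) {t : ℝ}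
    (h0 : e.spawn k n ≤ t) (ht : t ≤ e.joinTime p k n) : e.v k n t ∈ Icc 0 p.vMax := by
  rcases ht.lt_or_eq with h | h
  · exact (he.free_before_joinTime hn h0 h).1
  rcases h0.lt_or_eq with h1 | h1
  · have hc := (he.traj hn).cont_v (b := t) le_rfl t ⟨h0, le_rfl⟩
    have hcl : t ∈ closure (Ico (e.spawn k n) t) := by
      rw [closure_Ico h1.ne]; exact ⟨h0, le_rfl⟩
    refine isClosed_Icc.closure_subset_iff.2 (image_subset_iff.2 fun r hr => ?_)
      ((hc.mono Ico_subset_Icc_self).mem_closure_image hcl)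
    exact (he.free_before_joinTime hn hr.1 (hr.2.trans_eq h)).1
  · rw [← h1]; exact he.spawn_vel k n hn

theorem mem_newVehicles {k : Fin 4} {n s : ℕ} :
    n ∈ e.newVehicles p s k ↔ (n : ℕ∞) < e.count k ∧ e.inst p k n = s := by
  have hnew : ∀ n : ℕ, (n : ℕ∞) < e.count k → n ∈ e.newVehicles p (e.inst p k n) k := fun n hn => by
    refine ⟨hn, spawn_le_joinTime k n, ?_, fun ⟨r, hr, hB⟩ => he.not_clustered_of_lt hr hB⟩
    change e.x k n (e.joinTime p k n) ∈ _
    have h1 := spawn_le_joinTime (e := e) (p := p) k n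
    have h2 := he.joinTime_lt hn
    rcases he.spawn_pos k n hn with ⟨h0, hx⟩ | ⟨h0, hx⟩
    · have : e.joinTime p k n = 0 := by
        unfold joinTime inst; rw [h0]; simp [Params.instant]
      rw [this]; exact hx
    · have hv := fun r (hr : r ∈ Icc (e.spawn k n) (e.joinTime p k n)) =>
        he.vel_mem_of_le_joinTime hn hr.1 hr.2
      have h3 := (he.traj hn).pos_mono le_rfl h1 fun r hr => (hv r hr).1
      have h4 := (he.traj hn).pos_sub_le_const le_rfl h1 fun r hr => (hv r hr).2
      have h5 := p.vMax_pos
      have h6 := (lt_div_iff₀ h5).1 p.Tcs_lt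
      rw [hx] at h3 h4
      refine ⟨h3, ?_⟩
      unfold Params.start at *
      nlinarith
  constructor
  · intro h
    refine ⟨h.1, le_antisymm (spawn_le_instant_iff.1 h.2.1) ?_⟩
    by_contra! hlt
    exact h.2.2.2 ⟨_, hlt, he.mem_cluster_iff.2 (hnew n h.1)⟩
  · rintro ⟨hn, rfl⟩
    exact hnew n hn

theorem of_mem {s : ℕ} {b : Bubble} (hb : b ∈ e.newBubbles s) {n : ℕ} (hn : n ∈ b.members) :
    (n : ℕ∞) < e.count b.branch ∧ e.inst p b.branch n = s :=
  he.mem_newVehicles.1 (he.mem_cluster_iff.1 ⟨_, mem_newBubbles.1 hb, hn⟩)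

theorem exists_bubble {k : Fin 4} {n : ℕ} (hn : (n : ℕ∞) < e.count k) :
    ∃ b ∈ e.newBubbles (e.inst p k n), b.branch = k ∧ n ∈ b.members := by
  obtain ⟨B, hB, hnB⟩ := he.mem_cluster_iff.2 (he.mem_newVehicles.2 ⟨hn, rfl⟩)
  exact ⟨⟨k, B⟩, mem_newBubbles.2 hB, rfl, hnB⟩

/-- A vehicle belongs to one bubble only. -/
theorem bubble_unique {s s' : ℕ} {b b' : Bubble} (hb : b ∈ e.newBubbles s)
    (hb' : b' ∈ e.newBubbles s') (hk : b.branch = b'.branch) {n : ℕ} (hn : n ∈ b.members)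
    (hn' : n ∈ b'.members) : b = b' := by
  have h1 := (he.of_mem hb hn).2
  have h2 := (he.of_mem hb' hn').2
  rw [← hk, h1] at h2
  subst h2
  obtain ⟨A, C, hA, hC, -⟩ := he.clustering s b.branch
  have m1 := mem_newBubbles.1 hb
  have m2 := mem_newBubbles.1 hb'
  rw [← hk] at m2
  rw [← hC] at m1 m2
  exact Bubble.ext hk (C.eq_of_mem_parts m1 m2 hn hn')

theorem nonempty {s : ℕ} {b : Bubble} (hb : b ∈ e.newBubbles s) : b.members.Nonempty := by
  obtain ⟨A, C, hA, hC, -⟩ := he.clustering s b.branch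
  have m1 := mem_newBubbles.1 hb
  rw [← hC] at m1
  exact C.nonempty_of_mem_parts m1

omit he in
theorem pred_lt {k : Fin 4} {n m : ℕ} (h : m ≤ n) (hn : (n : ℕ∞) < e.count k) :
    (m : ℕ∞) < e.count k := lt_of_le_of_lt (by exact_mod_cast h) hn

theorem inst_mono (k : Fin 4) : Monotone (e.inst p k) := fun a b h => by
  have := p.Tcs_pos
  unfold inst
  exact Nat.ceil_le_ceil (by have := he.spawn_mono k h; gcongr)

theorem joinTime_mono (k : Fin 4) : Monotone (e.joinTime p k) := fun _ _ h =>
  Params.instant_mono (he.inst_mono k h)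

/-- The control law in pointwise form. -/
theorem law {s : ℕ} {b : Bubble} (hb : b ∈ e.newBubbles s) {n : ℕ} (hn : n ∈ b.members) {t : ℝ}
    (ht : p.instant s ≤ t) :
    e.u b.branch n t = p.localControl (e.Coupled p b.branch n t) (e.vehicleTau p T F b n t) t
      (e.x b.branch n t) (e.v b.branch n t) (e.v b.branch (n - 1) t)
      (e.safetyRatio p b.branch n t) (e.u b.branch (n - 1) t) := by
  obtain ⟨ε, hε, h⟩ := he.control s b hb n hn t ht
  exact h t ⟨le_rfl, by linarith⟩

/-- The bounds on the speed and the acceleration carry over from the predecessor, on whose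
acceleration the safe-following control depends. -/
theorem vel_acc_mem_of_pred {k : Fin 4} {n : ℕ} (hn : (n : ℕ∞) < e.count k)
    (hpred : 1 ≤ n → ∀ t ≥ e.spawn k (n - 1),
      e.v k (n - 1) t ∈ Icc 0 p.vMax ∧ e.u k (n - 1) t ∈ Icc p.uMin p.uMax) :
    ∀ t ≥ e.spawn k n, e.v k n t ∈ Icc 0 p.vMax ∧ e.u k n t ∈ Icc p.uMin p.uMax := by
  intro t ht
  rcases lt_or_ge t (e.joinTime p k n) with h | h
  · exact he.free_before_joinTime hn ht h
  obtain ⟨b, hb, rfl, hnb⟩ := he.exists_bubble hn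
  have hlaw : ∀ r ≥ e.joinTime p b.branch n, _ := fun r hr => he.law hb hnb hr
  have h0 := spawn_le_joinTime (e := e) (p := p) b.branch n
  have hsp := he.spawn_mono b.branch (Nat.sub_le n 1)
  have htr := he.traj hn
  have hj := he.vel_mem_of_le_joinTime hn h0 le_rfl
  have hnn : 0 ≤ e.v b.branch n t := by
    by_contra! hlt
    obtain ⟨c, hc, hc0, hc1⟩ := exists_last_nonneg h (htr.cont_v h0) hj.1 hlt
    have := htr.le_vel_sub (c := 0) (h0.trans hc.1) hc.2.le fun r hr => by
      rw [hlaw r (hc.1.trans hr.1.le)]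
      refine Params.localControl_nonneg (hc1 r ⟨hr.1, hr.2.le⟩) fun hC => ?_
      have h3 := coupled_iff.1 hC
      have h4 := (hpred h3.1 r (hsp.trans (h0.trans (hc.1.trans hr.1.le)))).1.1
      linarith [h3.2.1, hc1 r ⟨hr.1, hr.2.le⟩]
    linarith
  have hle : e.v b.branch n t ≤ p.vMax := by
    by_contra! hlt
    obtain ⟨c, hc, hc0, hc1⟩ := exists_last_nonneg (f := fun r => p.vMax - e.v b.branch n r) h
      (continuousOn_const.sub (htr.cont_v h0)) (by linarith [hj.2]) (by linarith)
    have := htr.vel_sub_le (c := 0) (h0.trans hc.1) hc.2.le fun r hr => by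
      rw [hlaw r (hc.1.trans hr.1.le)]
      exact Params.localControl_nonpos (by linarith [hc1 r ⟨hr.1, hr.2.le⟩])
    linarith
  refine ⟨⟨hnn, hle⟩, (Params.localControl_spec (fun hC => ?_) (hlaw t h)).1⟩
  have h4 := hpred hC.1 t (hsp.trans ht)
  exact Intersection.uMin_le_gus h4.1.1 (coupled_iff.1 hC).2.1 hC.2.2.1 h4.2.1

/-- Speeds and accelerations stay within their limits. -/
theorem vel_acc_mem {k : Fin 4} {n : ℕ} (hn : (n : ℕ∞) < e.count k) :
    ∀ t ≥ e.spawn k n, e.v k n t ∈ Icc 0 p.vMax ∧ e.u k n t ∈ Icc p.uMin p.uMax := by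
  induction n with
  | zero => exact he.vel_acc_mem_of_pred hn (by simp)
  | succ n ih => exact he.vel_acc_mem_of_pred hn fun _ => ih (pred_lt n.le_succ hn)

theorem vel_mem {k : Fin 4} {n : ℕ} (hn : (n : ℕ∞) < e.count k) {t : ℝ} (ht : e.spawn k n ≤ t) :
    e.v k n t ∈ Icc 0 p.vMax := (he.vel_acc_mem hn t ht).1

theorem acc_mem {k : Fin 4} {n : ℕ} (hn : (n : ℕ∞) < e.count k) {t : ℝ} (ht : e.spawn k n ≤ t) :
    e.u k n t ∈ Icc p.uMin p.uMax := (he.vel_acc_mem hn t ht).2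

theorem pos_mono {k : Fin 4} {n : ℕ} (hn : (n : ℕ∞) < e.count k) {a b : ℝ}
    (ha : e.spawn k n ≤ a) (hab : a ≤ b) : e.x k n a ≤ e.x k n b :=
  (he.traj hn).pos_mono ha hab fun _ hr => (he.vel_mem hn (ha.trans hr.1)).1

theorem uMin_le_gus {k : Fin 4} {n : ℕ} (hn : (n : ℕ∞) < e.count k) {t : ℝ}
    (ht : e.spawn k n ≤ t) (hC : e.Coupled p k n t) : p.uMin ≤
      p.gus (e.v k (n - 1) t) (e.v k n t) (e.safetyRatio p k n t) (e.u k (n - 1) t) := by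
  have hsp := (he.spawn_mono k (Nat.sub_le n 1)).trans ht
  have hn' := pred_lt (Nat.sub_le n 1) hn
  exact Intersection.uMin_le_gus (he.vel_mem hn' hsp).1 (coupled_iff.1 hC).2.1 hC.2.2.1
    (he.acc_mem hn' hsp).1

theorem eq_uMin_of_guc {s : ℕ} {b : Bubble} (hb : b ∈ e.newBubbles s) {n : ℕ}
    (hn : n ∈ b.members) {t : ℝ} (ht : p.instant s ≤ t)
    (h : p.guc (e.vehicleTau p T F b n t) t (e.x b.branch n t) (e.v b.branch n t) = p.uMin) :
    e.u b.branch n t = p.uMin := by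
  obtain ⟨hc, hs⟩ := he.of_mem hb hn
  exact (Params.localControl_spec (he.uMin_le_gus hc (spawn_le_instant_iff.2 (hs.le.trans le_rfl)
    |>.trans ht)) (he.law hb hn ht)).2.1 h

theorem eq_guc {s : ℕ} {b : Bubble} (hb : b ∈ e.newBubbles s) {n : ℕ}
    (hn : n ∈ b.members) {t : ℝ} (ht : p.instant s ≤ t) (hC : ¬e.Coupled p b.branch n t)
    (hv : e.v b.branch n t < p.vMax) : e.u b.branch n t =
      p.guc (e.vehicleTau p T F b n t) t (e.x b.branch n t) (e.v b.branch n t) := by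
  obtain ⟨hc, hs⟩ := he.of_mem hb hn
  exact (Params.localControl_spec (he.uMin_le_gus hc (spawn_le_instant_iff.2 (hs.le.trans le_rfl)
    |>.trans ht)) (he.law hb hn ht)).2.2.1 hC hv

/-- Vehicles keep their safe distance. -/
theorem safeDist_le (hsafe : e.SafeStart p) {k : Fin 4} {n : ℕ} (hn : (n : ℕ∞) < e.count k)
    (h1 : 1 ≤ n) {t : ℝ} (ht : e.joinTime p k n ≤ t) :
    p.safeDist (e.v k (n - 1) t) (e.v k n t) ≤ e.x k (n - 1) t - e.x k n t := by
  obtain ⟨b, hb, rfl, hnb⟩ := he.exists_bubble hn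
  have hn' := pred_lt (Nat.sub_le n 1) hn
  have h0 := spawn_le_joinTime (e := e) (p := p) b.branch n
  have h0' := (he.spawn_mono b.branch (Nat.sub_le n 1)).trans h0
  refine Intersection.safeDist_le_of_law ((he.traj hn').mono h0') ((he.traj hn).mono h0)
    (fun r hr => (he.vel_mem hn' (h0'.trans hr)).1) (fun r hr => (he.vel_mem hn (h0.trans hr)).1)
    (fun r hr => (he.acc_mem hn' (h0'.trans hr)).1) ?_ (fun r hr hv hx => ?_) t ht
  · have := hsafe _ b hb n hnb h1
    rwa [safetyRatio, le_div_iff₀ (p.safeDist_pos _ _), one_mul] at this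
  · obtain ⟨ε, hε, h⟩ := he.control _ b hb n hnb r hr
    have hC : e.Coupled p b.branch n r := by
      have := p.safeDist_pos (e.v b.branch (n - 1) r) (e.v b.branch n r)
      refine coupled_iff.2 ⟨h1, hv, hx.ge, ?_⟩
      rw [hx]
      nlinarith [p.one_lt_σ₀]
    refine ⟨ε, hε, fun q hq => ?_⟩
    have hlaw := h q hq
    rw [hlaw]
    have h2 := p.uMin_neg
    unfold Params.localControl Params.gsf Params.sat
    simp only [hC, if_true]
    split_ifs
    · exact (min_le_right _ _).trans (le_max_right _ _)
    · exact max_le_max le_rfl ((min_le_right _ _).trans (min_le_right _ _))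

theorem pos_add_le (hsafe : e.SafeStart p) {k : Fin 4} {n m : ℕ} (hn : (n : ℕ∞) < e.count k)
    (hmn : m ≤ n) {t : ℝ} (ht : e.joinTime p k n ≤ t) :
    e.x k n t + (n - m) * p.L ≤ e.x k m t := by
  induction n, hmn using Nat.le_induction with
  | base => simp
  | succ n hmn ih =>
    have h1 := ih (pred_lt n.le_succ hn) ((he.joinTime_mono k n.le_succ).trans ht)
    have h2 := he.safeDist_le hsafe hn (Nat.le_add_left 1 n) ht
    have h3 := p.L_le_safeDist (e.v k n t) (e.v k (n + 1) t)
    rw [Nat.add_sub_cancel] at h2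
    push_cast
    linarith

theorem pos_lt_pos (hsafe : e.SafeStart p) {k : Fin 4} {n m : ℕ} (hn : (n : ℕ∞) < e.count k)
    (hmn : m < n) {t : ℝ} (ht : e.joinTime p k n ≤ t) : e.x k n t < e.x k m t := by
  have h1 := he.pos_add_le hsafe hn hmn.le ht
  have h2 : (0 : ℝ) < n - m := by
    rw [sub_pos]; exact_mod_cast hmn
  nlinarith [mul_pos h2 p.L_pos]

theorem isCompact_coupled {k : Fin 4} {n : ℕ} (hn : (n : ℕ∞) < e.count k) {a b : ℝ}
    (ha : e.spawn k n ≤ a) : IsCompact (Icc a b ∩ {t | e.Coupled p k n t}) := by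
  rcases Nat.eq_zero_or_pos n with h0 | h0
  · have : Icc a b ∩ {t | e.Coupled p k n t} = ∅ := by
      ext t
      simp only [mem_inter_iff, mem_ofPred_eq, mem_empty_iff_false, iff_false, not_and]
      rintro - hC
      have := hC.1
      omega
    rw [this]; exact isCompact_empty
  have hn' := pred_lt (Nat.sub_le n 1) hn
  have ha' := (he.spawn_mono k (Nat.sub_le n 1)).trans ha
  have c1 := (he.traj hn).cont_v (b := b) ha
  have c2 := (he.traj hn').cont_v (b := b) ha'
  have c3 := (he.traj hn).cont_x (b := b) ha
  have c4 := (he.traj hn').cont_x (b := b) ha'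
  have c5 : ContinuousOn (fun t => p.safeDist (e.v k (n - 1) t) (e.v k n t)) (Icc a b) := by
    unfold Params.safeDist
    fun_prop
  have e1 : Icc a b ∩ {t | e.Coupled p k n t} =
      (Icc a b ∩ (fun t => e.v k n t - e.v k (n - 1) t) ⁻¹' Ici 0) ∩
      ((Icc a b ∩ (fun t => e.x k (n - 1) t - e.x k n t -
          p.safeDist (e.v k (n - 1) t) (e.v k n t)) ⁻¹' Ici 0) ∩
        (Icc a b ∩ (fun t => p.σ₀ * p.safeDist (e.v k (n - 1) t) (e.v k n t) -
          (e.x k (n - 1) t - e.x k n t)) ⁻¹' Ici 0)) := by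
    ext t
    simp only [mem_inter_iff, mem_ofPred_eq, mem_preimage, mem_Ici, coupled_iff, sub_nonneg]
    constructor
    · rintro ⟨h, -, h1, h2, h3⟩; exact ⟨⟨h, h1⟩, ⟨h, h2⟩, h, h3⟩
    · rintro ⟨⟨h, h1⟩, ⟨-, h2⟩, -, h3⟩; exact ⟨h, h0, h1, h2, h3⟩
  rw [e1]
  refine isCompact_Icc.of_isClosed_subset ?_ (inter_subset_left.trans inter_subset_left)
  exact (ContinuousOn.preimage_isClosed_of_isClosed (by fun_prop) isClosed_Icc isClosed_Ici).inter
    ((ContinuousOn.preimage_isClosed_of_isClosed (by fun_prop) isClosed_Icc isClosed_Ici).inter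
      (ContinuousOn.preimage_isClosed_of_isClosed (by fun_prop) isClosed_Icc isClosed_Ici))

end IsClosedLoop
end Evolution
end Intersection
namespace Intersection

/-! ### Clusters are intervals of vehicles -/

/-- The contribution of one cluster to the sum of squares. -/
noncomputable def blockCost (pos : ℕ → ℝ) (B : Finset ℕ) : ℝ :=
  ∑ n ∈ B, (pos n - (∑ l ∈ B, pos l) / (B.card : ℝ)) ^ 2

theorem blockCost_eq (pos : ℕ → ℝ) {B : Finset ℕ} (hB : B.Nonempty) :
    blockCost pos B = ∑ n ∈ B, pos n ^ 2 - (∑ n ∈ B, pos n) ^ 2 / (B.card : ℝ) := by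
  have h : (B.card : ℝ) ≠ 0 := by
    have := hB.card_pos
    positivity
  unfold blockCost
  simp only [sub_sq, Finset.sum_add_distrib, Finset.sum_sub_distrib, Finset.sum_const,
    nsmul_eq_mul, ← Finset.sum_mul, ← Finset.mul_sum]
  field_simp
  ring

theorem sum_swap_left {a b : ℕ} {B : Finset ℕ} (ha : a ∈ B) (hb : b ∉ B) (g : ℕ → ℝ) :
    ∑ n ∈ B, g (Equiv.swap a b n) = ∑ n ∈ B, g n + g b - g a := by
  have : ∑ n ∈ B, (g (Equiv.swap a b n) - g n) = g b - g a := by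
    rw [Finset.sum_eq_single a]
    · rw [Equiv.swap_apply_left]
    · intro n hn hna
      rw [Equiv.swap_apply_of_ne_of_ne hna (ne_of_mem_of_not_mem hn hb), sub_self]
    · exact fun h => absurd ha h
  rw [Finset.sum_sub_distrib] at this
  linarith

/-- The action of a permutation on finite sets, as an order isomorphism. -/
def permFinset (σ : Equiv.Perm ℕ) : Finset ℕ ≃o Finset ℕ where
  toEquiv := σ.finsetCongr
  map_rel_iff' := Finset.map_subset_map

theorem blockCost_permFinset (pos : ℕ → ℝ) (σ : Equiv.Perm ℕ) (B : Finset ℕ) :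
    blockCost pos (permFinset σ B) = blockCost (fun n => pos (σ n)) B := by
  change blockCost pos (B.map σ.toEmbedding) = _
  simp [blockCost]

theorem blockCost_swap {pos : ℕ → ℝ} {a b : ℕ} {B : Finset ℕ} (ha : a ∈ B) (hb : b ∉ B) :
    blockCost (fun n => pos (Equiv.swap a b n)) B - blockCost pos B = pos b ^ 2 - pos a ^ 2 -
      ((pos b - pos a) ^ 2 / B.card + 2 * (pos b - pos a) * ((∑ n ∈ B, pos n) / B.card)) := by
  rw [blockCost_eq _ ⟨a, ha⟩, blockCost_eq _ ⟨a, ha⟩,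
    sum_swap_left ha hb fun n => pos n ^ 2, sum_swap_left ha hb]
  ring

/-- In an optimal partition, exchanging two points of different clusters does not help. -/
theorem mean_sub_mean_of_optimal {pos : ℕ → ℝ} {A : Finset ℕ} {C : Finpartition A}
    (hopt : ∀ C' : Finpartition A, C'.parts.card = C.parts.card →
      sumOfSquares pos C.parts ≤ sumOfSquares pos C'.parts)
    {B B' : Finset ℕ} (hB : B ∈ C.parts) (hB' : B' ∈ C.parts) (hne : B ≠ B') {a b : ℕ}
    (ha : a ∈ B) (hb : b ∈ B') :
    (pos a - pos b) ^ 2 * (1 / B.card + 1 / B'.card) ≤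
      2 * (pos a - pos b) * ((∑ n ∈ B, pos n) / B.card - (∑ n ∈ B', pos n) / B'.card) := by
  have haB' : a ∉ B' := fun h => hne (C.eq_of_mem_parts hB hB' ha h)
  have hbB : b ∉ B := fun h => hne (C.eq_of_mem_parts hB hB' h hb)
  have haA := C.le hB ha
  have hbA := C.le hB' hb
  have hA : permFinset (Equiv.swap a b) A = A := by
    change A.map (Equiv.swap a b).toEmbedding = A
    ext n
    rw [Finset.mem_map_equiv, Equiv.symm_swap]
    by_cases h1 : n = a
    · subst h1; simp [haA, hbA]
    by_cases h2 : n = b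
    · subst h2; simp [haA, hbA]
    rw [Equiv.swap_apply_of_ne_of_ne h1 h2]
  have h := hopt ((C.map (permFinset (Equiv.swap a b))).copy hA) (by simp)
  have h1 : sumOfSquares pos ((C.map (permFinset (Equiv.swap a b))).copy hA).parts =
      ∑ X ∈ C.parts, blockCost (fun n => pos (Equiv.swap a b n)) X := by
    rw [Finpartition.copy_parts, Finpartition.parts_map]
    unfold sumOfSquares
    rw [Finset.sum_map]
    exact Finset.sum_congr rfl fun X _ => blockCost_permFinset pos _ X
  have h2 : sumOfSquares pos C.parts = ∑ X ∈ C.parts, blockCost pos X := rfl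
  rw [h1, h2, ← sub_nonneg, ← Finset.sum_sub_distrib, Finset.sum_eq_add B B' hne] at h
  · rw [blockCost_swap ha hbB, Equiv.swap_comm, blockCost_swap hb haB'] at h
    linear_combination h
  · intro X hX hXne
    have haX : a ∉ X := fun h => hXne.1 (C.eq_of_mem_parts hX hB h ha)
    have hbX : b ∉ X := fun h => hXne.2 (C.eq_of_mem_parts hX hB' h hb)
    have : ∀ n ∈ X, pos (Equiv.swap a b n) = pos n := fun n hn => by
      rw [Equiv.swap_apply_of_ne_of_ne (ne_of_mem_of_not_mem hn haX)
        (ne_of_mem_of_not_mem hn hbX)]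
    unfold blockCost
    rw [Finset.sum_congr rfl this, sub_eq_zero]
    exact Finset.sum_congr rfl fun n hn => by simp only [this n hn]
  · exact fun h => absurd hB h
  · exact fun h => absurd hB' h

/-- The clusters of an optimal partition are intervals: by `mean_sub_mean_of_optimal`, a point to the
left or right of another one belongs to the cluster whose mean lies further to the left or right, so
that a point of another cluster cannot lie between two points of `B`. -/
theorem mem_of_between_of_optimal {pos : ℕ → ℝ} {A : Finset ℕ} {C : Finpartition A}
    (hopt : ∀ C' : Finpartition A, C'.parts.card = C.parts.card →
      sumOfSquares pos C.parts ≤ sumOfSquares pos C'.parts)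
    {B : Finset ℕ} (hB : B ∈ C.parts) {a b c : ℕ} (ha : a ∈ B) (hc : c ∈ B) (hb : b ∈ A)
    (hab : pos b < pos a) (hbc : pos c < pos b) : b ∈ B := by
  obtain ⟨B', hB', hbB'⟩ := C.exists_mem hb
  by_cases hne : B = B'
  · rw [hne]; exact hbB'
  exfalso
  have h1 := mean_sub_mean_of_optimal hopt hB hB' hne ha hbB'
  have h2 := mean_sub_mean_of_optimal hopt hB hB' hne hc hbB'
  have k1 : (0 : ℝ) < 1 / B.card + 1 / B'.card := by
    have := Finset.card_pos.2 ⟨a, ha⟩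
    have := Finset.card_pos.2 ⟨b, hbB'⟩
    positivity
  set μ := (∑ n ∈ B, pos n) / (B.card : ℝ) - (∑ n ∈ B', pos n) / (B'.card : ℝ)
  have h3 : 0 < μ := by
    have : 0 < (pos a - pos b) * μ := by
      have : 0 < (pos a - pos b) ^ 2 * (1 / B.card + 1 / B'.card : ℝ) :=
        mul_pos (pow_pos (sub_pos.2 hab) 2) k1
      linarith
    exact (mul_pos_iff_of_pos_left (sub_pos.2 hab)).1 this
  have h4 : 0 < (pos c - pos b) ^ 2 * (1 / B.card + 1 / B'.card : ℝ) :=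
    mul_pos (sq_pos_of_neg (sub_neg.2 hbc)) k1
  nlinarith [mul_pos (sub_pos.2 hbc) h3]

namespace Evolution
namespace IsClosedLoop

variable {e : Evolution} {p : Params} {T : ℝ} {F : ℕ → Bubble → ℝ → ℝ}
variable (he : e.IsClosedLoop p T F) (hsafe : e.SafeStart p) {s s' : ℕ} {b b' : Bubble}
include he

theorem lead_mem (hb : b ∈ e.newBubbles s) : b.lead ∈ b.members := by
  have : b.lead ∈ (b.members : Set ℕ) := Nat.sInf_mem (by exact_mod_cast he.nonempty hb)
  exact_mod_cast this

theorem card_pos (hb : b ∈ e.newBubbles s) : 0 < b.members.card := (he.nonempty hb).card_pos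

omit he in
theorem lead_le {n : ℕ} (hn : n ∈ b.members) : b.lead ≤ n := Nat.sInf_le (by exact_mod_cast hn)

include hsafe

/-- Clusters are intervals of positions, hence of indices. -/
theorem mem_of_between (hb : b ∈ e.newBubbles s) {a m c : ℕ} (ha : a ∈ b.members)
    (hc : c ∈ b.members) (ham : a ≤ m) (hmc : m ≤ c) : m ∈ b.members := by
  rcases ham.lt_or_eq with ham | rfl
  swap
  · exact ha
  rcases hmc.lt_or_eq with hmc | rfl
  swap
  · exact hc
  obtain ⟨A, C, hA, hC, -, hopt⟩ := he.clustering s b.branch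
  have a1 := he.of_mem hb ha
  have c1 := he.of_mem hb hc
  have m1 : (m : ℕ∞) < e.count b.branch := pred_lt hmc.le c1.1
  have m2 : e.inst p b.branch m = s :=
    le_antisymm (c1.2 ▸ he.inst_mono _ hmc.le) (a1.2.symm.le.trans (he.inst_mono _ ham.le))
  have hmA : m ∈ A := by
    rw [← Finset.mem_coe, hA]; exact he.mem_newVehicles.2 ⟨m1, m2⟩
  have hB := mem_newBubbles.1 hb
  rw [← hC] at hB
  refine mem_of_between_of_optimal hopt hB ha hc hmA ?_ ?_
  · exact he.pos_lt_pos hsafe m1 ham (by rw [joinTime, m2])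
  · exact he.pos_lt_pos hsafe c1.1 hmc (by rw [joinTime, c1.2])

/-- A bubble consists of consecutive vehicles. -/
theorem members_eq (hb : b ∈ e.newBubbles s) :
    b.members = Finset.Ico b.lead (b.lead + b.members.card) := by
  have hne := he.nonempty hb
  have h : b.members = Finset.Icc b.lead (b.members.max' hne) := by
    ext n
    rw [Finset.mem_Icc]
    exact ⟨fun hn => ⟨lead_le hn, Finset.le_max' _ _ hn⟩, fun hn =>
      he.mem_of_between hsafe hb (he.lead_mem hb) (Finset.max'_mem _ hne) hn.1 hn.2⟩
  have hc : b.members.card = b.members.max' hne + 1 - b.lead := by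
    conv_lhs => rw [h]
    rw [Nat.card_Icc]
  have hl := lead_le (Finset.max'_mem _ hne)
  conv_lhs => rw [h]
  ext n
  rw [Finset.mem_Icc, Finset.mem_Ico, hc]
  omega

theorem mem_members_iff (hb : b ∈ e.newBubbles s) {n : ℕ} :
    n ∈ b.members ↔ b.lead ≤ n ∧ n < b.lead + b.members.card := by
  conv_lhs => rw [he.members_eq hsafe hb]
  exact Finset.mem_Ico

theorem rank_eq (hb : b ∈ e.newBubbles s) {n : ℕ} (hn : n ∈ b.members) :
    b.rank n = n - b.lead := by
  have : b.members.filter (fun l => l < n) = Finset.Ico b.lead n := by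
    have hn' := (he.mem_members_iff hsafe hb).1 hn
    ext l
    rw [Finset.mem_filter, he.mem_members_iff hsafe hb, Finset.mem_Ico]
    omega
  rw [Bubble.rank, this, Nat.card_Ico]

omit hsafe in
theorem eq_of_lead_eq (hb : b ∈ e.newBubbles s) (hb' : b' ∈ e.newBubbles s')
    (hk : b.branch = b'.branch) (h : b.lead = b'.lead) : b = b' :=
  he.bubble_unique hb hb' hk (he.lead_mem hb) (h ▸ he.lead_mem hb')

end IsClosedLoop
end Evolution
end Intersection
namespace Intersection

/-! ### The sequence of schedules -/

namespace Params

variable (p : Params)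

theorem neg_start_pos : 0 < -p.start := by
  have := p.Ls_pos
  have := p.Lm_pos
  have := p.Le_pos
  unfold start
  linarith

/-- Bound on the time to the earliest approach. -/
noncomputable def approachBound : ℝ := p.vMax / p.uMax + -p.start / p.vMax

theorem approachBound_pos : 0 < p.approachBound := by
  have := p.vMax_pos
  have := p.uMax_pos
  have := p.neg_start_pos
  unfold approachBound
  positivity

end Params

namespace Evolution

variable {e : Evolution} {p : Params} {T : ℝ} {F : ℕ → Bubble → ℝ → ℝ}

variable (e p T F) in
/-- A closed-loop evolution under the hypotheses on the exit zones, on the bound on the inter-approach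
times, on the cost functions and on the initial distances. -/
structure Admissible : Prop where
  loop : e.IsClosedLoop p T F
  safe : e.SafeStart p
  exit_le : p.vMax ^ 2 / (-2 * p.uMin) + p.νnom ^ 2 / (2 * p.uMax) ≤ p.Le
  Tiat_le : p.Tiat ≤ T
  anti : ∀ s b, AntitoneOn (F s b) (Icc 0 p.vMax)

variable (e) in
/-- The bubble has been formed at or before the `s`-th instance. -/
def Formed (s : ℕ) (b : Bubble) : Prop := ∃ r ≤ s, b ∈ e.newBubbles r

variable (p T) in
/-- The bound on the occupancy time of a bubble. -/
noncomputable def occ (b : Bubble) : ℝ := p.occBound T b.members.card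

variable (e p T F) in
/-- The earliest approach time used in the `s`-th scheduling. -/
noncomputable def tauMin (s : ℕ) : ℝ := (e.scheduleState p T F s).2

theorem retained_succ (s : ℕ) : ∃ (f : Bubble → Bool) (m : ℕ),
    (∀ b, f b = true ↔ e.bubblePos b (p.instant (s + 1)) ∈ p.stagingZone ∪ p.midZone) ∧
      e.retained p (s + 1) = ((e.order s).filter f).drop m := by
  classical
  exact ⟨_, _, fun _ => decide_eq_true_iff, rfl⟩

theorem mem_retained {s : ℕ} {b : Bubble} (hb : b ∈ e.retained p (s + 1)) :
    b ∈ e.order s ∧ e.bubblePos b (p.instant (s + 1)) ∈ p.stagingZone ∪ p.midZone := by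
  obtain ⟨f, m, hf, hm⟩ := e.retained_succ (p := p) s
  rw [hm] at hb
  have h := List.mem_of_mem_drop hb
  rw [List.mem_filter, hf] at h
  exact h

theorem mem_bubbles {s : ℕ} {b : Bubble} :
    b ∈ (e.problem p T F s).bubbles ↔ b ∈ e.retained p s ∨ b ∈ e.newBubbles s := by
  change b ∈ e.retained p s ++ (e.newBubbles s).toList ↔ _
  rw [List.mem_append, Finset.mem_toList]

theorem tau_of_mem {s : ℕ} {b : Bubble} (hb : b ∈ e.order s) : e.tau p T F s b =
    (e.problem p T F s).timeOf b ((e.problem p T F s).velOpt (e.order s) b) := by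
  cases s with
  | zero => rfl
  | succ s => exact if_pos hb

theorem tau_of_notMem {s : ℕ} {b : Bubble} (hb : b ∉ e.order (s + 1)) :
    e.tau p T F (s + 1) b = e.tau p T F s b := if_neg hb

theorem foldr_max_spec (f : Bubble → ℝ) (c : ℝ) (l : List Bubble) :
    c ≤ l.foldr (fun b a => max (f b) a) c ∧ (∀ b ∈ l, f b ≤ l.foldr (fun b a => max (f b) a) c) ∧
      ∀ M, c ≤ M → (∀ b ∈ l, f b ≤ M) → l.foldr (fun b a => max (f b) a) c ≤ M := by
  induction l with
  | nil => simp
  | cons b l ih =>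
    obtain ⟨h1, h2, h3⟩ := ih
    refine ⟨h1.trans (le_max_right _ _), fun q hq => ?_, fun M hc hM => ?_⟩
    · rcases List.mem_cons.1 hq with rfl | hq
      · exact le_max_left _ _
      · exact (h2 q hq).trans (le_max_right _ _)
    · exact max_le (hM b List.mem_cons_self) (h3 M hc fun q hq => hM q (List.mem_cons_of_mem _ hq))

theorem tauMin_succ (s : ℕ) : e.tauMin p T F (s + 1) =
    ((e.order s).filter fun b => b ∉ e.retained p (s + 1)).foldr
      (fun b a => max (e.tau p T F s b + occ p T b) a) (e.tauMin p T F s) := rfl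

theorem tauMin_le_succ (s : ℕ) : e.tauMin p T F s ≤ e.tauMin p T F (s + 1) :=
  (foldr_max_spec _ _ _).1

theorem tau_add_occ_le_tauMin {s : ℕ} {b : Bubble} (hb : b ∈ e.order s)
    (hr : b ∉ e.retained p (s + 1)) : e.tau p T F s b + occ p T b ≤ e.tauMin p T F (s + 1) := by
  have : b ∈ (e.order s).filter fun b => b ∉ e.retained p (s + 1) := by simp [hb, hr]
  rw [tauMin_succ]
  exact (foldr_max_spec (fun b => e.tau p T F s b + occ p T b) _ _).2.1 b this

theorem tauMin_succ_le {s : ℕ} {M : ℝ} (h0 : e.tauMin p T F s ≤ M)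
    (h : ∀ b ∈ e.order s, b ∉ e.retained p (s + 1) → e.tau p T F s b + occ p T b ≤ M) :
    e.tauMin p T F (s + 1) ≤ M :=
  (foldr_max_spec _ _ _).2.2 M h0 fun b hb => by
    rw [List.mem_filter] at hb
    exact h b hb.1 (by simpa using hb.2)

namespace Admissible

variable (h : e.Admissible p T F) {s : ℕ} {b i q : Bubble}
include h

theorem T_pos : 0 < T := p.Tiat_pos.trans_le h.Tiat_le

theorem occ_pos (hb : b ∈ e.newBubbles s) : 0 < occ p T b := by
  have h1 : (1 : ℝ) ≤ b.members.card := by exact_mod_cast h.loop.card_pos hb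
  have h2 := h.T_pos
  have := mul_nonneg (sub_nonneg.2 h1) h2.le
  have := le_max_right ((p.L + p.Δ) / p.νnom) T
  unfold occ Params.occBound
  linarith

/-- Vehicles do not leave their branch backwards. -/
theorem start_le {k : Fin 4} {n : ℕ} (hn : (n : ℕ∞) < e.count k) {t : ℝ} (ht : e.spawn k n ≤ t) :
    p.start ≤ e.x k n t := by
  refine le_trans ?_ (h.loop.pos_mono hn le_rfl ht)
  rcases h.loop.spawn_pos k n hn with h1 | h1
  · rw [h1.1]; exact h1.2.1
  · exact h1.2.ge

theorem spawn_le (hb : Formed e s b) {n : ℕ} (hn : n ∈ b.members) :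
    (n : ℕ∞) < e.count b.branch ∧ e.joinTime p b.branch n ≤ p.instant s ∧
      e.spawn b.branch n ≤ p.instant s := by
  obtain ⟨r, hr, hb⟩ := hb
  obtain ⟨h1, h2⟩ := h.loop.of_mem hb hn
  have h3 : e.joinTime p b.branch n ≤ p.instant s := by
    rw [joinTime, h2]; exact Params.instant_mono hr
  exact ⟨h1, h3, (spawn_le_joinTime _ _).trans h3⟩

theorem lead_pos_lt_iff (hi : Formed e s i) (hq : Formed e s q) (hk : i.branch = q.branch) :
    e.bubblePos q (p.instant s) < e.bubblePos i (p.instant s) ↔ i.lead < q.lead := by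
  obtain ⟨r, hr, hi'⟩ := id hi
  obtain ⟨r', hr', hq'⟩ := id hq
  have h1 := h.spawn_le hi (h.loop.lead_mem hi')
  have h2 := h.spawn_le hq (h.loop.lead_mem hq')
  unfold bubblePos
  rw [hk] at h1 ⊢
  refine ⟨fun hlt => ?_, fun hlt => h.loop.pos_lt_pos h.safe h2.1 hlt h2.2.1⟩
  by_contra! hle
  rcases hle.lt_or_eq with h3 | h3
  · exact lt_asymm hlt (h.loop.pos_lt_pos h.safe h1.1 h3 h1.2.1)
  · rw [h3] at hlt; exact lt_irrefl _ hlt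

theorem member_pos_le (hb : Formed e s b) {n : ℕ} (hn : n ∈ b.members) :
    e.x b.branch n (p.instant s) ≤ e.bubblePos b (p.instant s) := by
  rcases (IsClosedLoop.lead_le hn).lt_or_eq with h1 | h1
  · have h2 := h.spawn_le hb hn
    exact (h.loop.pos_lt_pos h.safe h2.1 h1 h2.2.1).le
  · rw [← h1]; rfl

/-- The data of a bubble that is handed to the scheduler. -/
theorem bounds_of_pos_lt (hb : Formed e s b) (hx : e.bubblePos b (p.instant s) < -p.Le) :
    (e.problem p T F s).vLo b = 0 ∧ 0 < (e.problem p T F s).vHi b ∧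
      (e.problem p T F s).vHi b ≤ p.vMax ∧
      (e.problem p T F s).d b / (e.problem p T F s).vHi b ≤ p.approachBound ∧
      ∀ n ∈ b.members, p.earliestDuration (-e.x b.branch n (p.instant s))
        (e.v b.branch n (p.instant s)) ≤
          (e.problem p T F s).d b / (e.problem p T F s).vHi b + b.rank n * p.Tnom := by
  have hLe := p.Le_pos
  have hvM := p.vMax_pos
  have hd : 0 < -e.bubblePos b (p.instant s) := by linarith
  have hdn : ∀ n ∈ b.members, p.Le < -e.x b.branch n (p.instant s) := fun n hn => by
    linarith [h.member_pos_le hb hn]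
  have hvn : ∀ n ∈ b.members, e.v b.branch n (p.instant s) ∈ Icc 0 p.vMax := fun n hn =>
    h.loop.vel_mem (h.spawn_le hb hn).1 (h.spawn_le hb hn).2.2
  have hspec := fun n hn => p.earliestDuration_spec (hLe.le.trans (hdn n hn).le) (hvn n hn)
  set E := ⨆ n : {n // n ∈ b.members},
      (p.earliestDuration (-e.x b.branch n (p.instant s)) (e.v b.branch n (p.instant s)) -
        b.rank n * p.Tnom) with hE
  have hvHi : (e.problem p T F s).vHi b = -e.bubblePos b (p.instant s) / E := rfl
  have hdd : (e.problem p T F s).d b = -e.bubblePos b (p.instant s) := rfl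
  have hbdd : BddAbove (range fun n : {n // n ∈ b.members} =>
      (p.earliestDuration (-e.x b.branch n (p.instant s)) (e.v b.branch n (p.instant s)) -
        b.rank n * p.Tnom)) := (finite_range _).bddAbove
  have hge : ∀ n ∈ b.members, p.earliestDuration (-e.x b.branch n (p.instant s))
      (e.v b.branch n (p.instant s)) - b.rank n * p.Tnom ≤ E := fun n hn => le_ciSup hbdd ⟨n, hn⟩
  obtain ⟨r, hr, hbr⟩ := id hb
  have hlead := h.loop.lead_mem hbr
  have hne : Nonempty {n // n ∈ b.members} := ⟨⟨_, hlead⟩⟩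
  have hEle : E ≤ p.approachBound := ciSup_le fun ⟨n, hn⟩ => by
    have h1 := (hspec n hn).2.2
    have h2 : 0 ≤ b.rank n * p.Tnom := mul_nonneg (Nat.cast_nonneg _) p.Tnom_pos.le
    have h3 := h.start_le (h.spawn_le hb hn).1 (h.spawn_le hb hn).2.2
    have h4 : -e.x b.branch n (p.instant s) / p.vMax ≤ -p.start / p.vMax := by gcongr
    unfold Params.approachBound
    simp only
    linarith
  have hEge : -e.bubblePos b (p.instant s) / p.vMax ≤ E := by
    refine le_trans ?_ (hge _ hlead)
    have h1 := (hspec _ hlead).2.1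
    rw [h.loop.rank_eq h.safe hbr hlead, Nat.sub_self, Nat.cast_zero, zero_mul, sub_zero]
    exact h1
  have hEpos : 0 < E := (div_pos hd hvM).trans_le hEge
  have hdE : (e.problem p T F s).d b / (e.problem p T F s).vHi b = E := by
    rw [hvHi, hdd, div_div_cancel₀ hd.ne']
  refine ⟨?_, ?_, ?_, ?_, fun n hn => ?_⟩
  · have htop : (⨅ n : {n // n ∈ b.members},
        (p.latestDuration (-e.x b.branch n (p.instant s)) (e.v b.branch n (p.instant s)) -
          ((b.rank n * p.Tnom : ℝ) : EReal))) = ⊤ := by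
      refine iInf_eq_top.2 fun ⟨n, hn⟩ => ?_
      have h1 : p.latestDuration (-e.x b.branch n (p.instant s))
          (e.v b.branch n (p.instant s)) = ⊤ := by
        refine if_pos (lt_of_le_of_lt ?_ (hdn n hn))
        have h2 : 0 < -2 * p.uMin := by linarith [p.uMin_neg]
        have h3 : e.v b.branch n (p.instant s) ^ 2 / (-2 * p.uMin) ≤
            p.vMax ^ 2 / (-2 * p.uMin) := by
          have := (hvn n hn).1
          have := (hvn n hn).2
          gcongr
        have h4 : 0 ≤ p.νnom ^ 2 / (2 * p.uMax) := by
          have := p.uMax_pos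
          positivity
        linarith [h.exit_le]
      simp only [h1]
      exact EReal.top_sub_coe _
    change (((-e.bubblePos b (p.instant s) : ℝ) : EReal) / _).toReal = 0
    rw [htop, EReal.div_top, EReal.toReal_zero]
  · rw [hvHi]; exact div_pos hd hEpos
  · rw [hvHi, div_le_iff₀ hEpos]
    rw [div_le_iff₀ hvM] at hEge
    linarith
  · rw [hdE]; exact hEle
  · rw [hdE]; linarith [hge n hn]

theorem regular_of (hnd : (e.retained p s).Nodup)
    (hr : ∀ b ∈ e.retained p s, (∃ r < s, b ∈ e.newBubbles r) ∧
      e.bubblePos b (p.instant s) < -p.Le) :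
    (e.problem p T F s).Regular p.vMax ∧ ∀ b ∈ (e.problem p T F s).bubbles,
      Formed e s b ∧ e.bubblePos b (p.instant s) < -p.Le := by
  have hmem : ∀ b ∈ (e.problem p T F s).bubbles,
      Formed e s b ∧ e.bubblePos b (p.instant s) < -p.Le := fun b hb => by
    rcases mem_bubbles.1 hb with hb | hb
    · obtain ⟨⟨r, hrs, hb'⟩, hx⟩ := hr b hb
      exact ⟨⟨r, hrs.le, hb'⟩, hx⟩
    · refine ⟨⟨s, le_rfl, hb⟩, ?_⟩
      have h1 := h.loop.lead_mem hb
      have h2 := h.loop.mem_newVehicles.2 (h.loop.of_mem hb h1)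
      have h3 := h2.2.2.1.2
      have := p.Lm_pos
      unfold bubblePos
      linarith
  refine ⟨⟨?_, fun i hi => ?_, fun i hi => ?_, fun i hi => ?_, fun i hi => ?_, fun i hi => ?_,
    fun i hi q hq hk hpos => ?_, p.WT_nonneg, fun i => h.anti s i⟩, hmem⟩
  · change (e.retained p s ++ (e.newBubbles s).toList).Nodup
    refine List.nodup_append.2 ⟨hnd, Finset.nodup_toList _, fun a ha c hc hac => ?_⟩
    obtain ⟨⟨r, hrs, ha'⟩, -⟩ := hr a ha
    rw [Finset.mem_toList, ← hac] at hc
    have h1 := (h.loop.of_mem ha' (h.loop.lead_mem ha')).2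
    have h2 := (h.loop.of_mem hc (h.loop.lead_mem ha')).2
    omega
  · have := (hmem i hi).2
    have := p.Le_pos
    change 0 < -e.bubblePos i (p.instant s)
    linarith
  · exact (h.bounds_of_pos_lt (hmem i hi).1 (hmem i hi).2).1
  · exact (h.bounds_of_pos_lt (hmem i hi).1 (hmem i hi).2).2.1
  · exact (h.bounds_of_pos_lt (hmem i hi).1 (hmem i hi).2).2.2.1
  · obtain ⟨r, -, hi'⟩ := (hmem i hi).1
    exact h.occ_pos hi'
  · have h1 := h.lead_pos_lt_iff (hmem i hi).1 (hmem q hq).1 hk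
    have h2 := h.lead_pos_lt_iff (hmem q hq).1 (hmem i hi).1 hk.symm
    change e.bubblePos i (p.instant s) = e.bubblePos q (p.instant s) at hpos
    rw [hpos] at h1 h2
    obtain ⟨r, -, hi'⟩ := (hmem i hi).1
    obtain ⟨r', -, hq'⟩ := (hmem q hq).1
    refine h.loop.eq_of_lead_eq hi' hq' hk ?_
    have h3 := mt h1.2 (lt_irrefl _)
    have h4 := mt h2.2 (lt_irrefl _)
    omega

omit h in
theorem zone_lt {y : ℝ} (hy : y ∈ p.stagingZone ∪ p.midZone) : y < -p.Le := by
  have := p.Lm_pos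
  rcases hy with hy | hy
  · linarith [hy.2]
  · exact hy.2

omit h in
theorem zone_mem {y : ℝ} (h0 : p.start ≤ y) (h1 : y < -p.Le) : y ∈ p.stagingZone ∪ p.midZone := by
  rcases lt_or_ge y (-(p.Lm + p.Le)) with h2 | h2
  · exact Or.inl ⟨h0, h2⟩
  · exact Or.inr ⟨h2, h1⟩

/-- All scheduling problems are regular. The proof is by induction, since a problem contains the
bubbles retained from the preceding schedule. -/
theorem regular_and_formed (s : ℕ) :
    (e.problem p T F s).Regular p.vMax ∧ ∀ b ∈ (e.problem p T F s).bubbles,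
      Formed e s b ∧ e.bubblePos b (p.instant s) < -p.Le := by
  induction s with
  | zero => exact h.regular_of List.nodup_nil (by intro b hb; simp [retained] at hb)
  | succ s ih =>
    have hperm := (ih.1.isOrder_of_isOutput (h.loop.scheduling s)).1.perm
    refine h.regular_of ?_ fun b hb => ?_
    · obtain ⟨f, m, -, hm⟩ := e.retained_succ (p := p) s
      rw [hm]
      exact ((hperm.nodup_iff.2 ih.1.nodup).filter _).sublist (List.drop_sublist _ _)
    · obtain ⟨h1, h2⟩ := mem_retained hb
      obtain ⟨r, hr, h3⟩ := (ih.2 b (hperm.mem_iff.1 h1)).1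
      exact ⟨⟨r, by omega, h3⟩, zone_lt h2⟩

theorem regular (s : ℕ) : (e.problem p T F s).Regular p.vMax := (h.regular_and_formed s).1

theorem isOrder (s : ℕ) : (e.problem p T F s).IsOrder (e.order s) :=
  ((h.regular s).isOrder_of_isOutput (h.loop.scheduling s)).1

theorem mem_order_iff : b ∈ e.order s ↔ b ∈ (e.problem p T F s).bubbles :=
  (h.isOrder s).perm.mem_iff

theorem order_nodup (s : ℕ) : (e.order s).Nodup := (h.isOrder s).perm.nodup_iff.2 (h.regular s).nodup

theorem formed_of_mem (hb : b ∈ e.order s) : Formed e s b :=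
  ((h.regular_and_formed s).2 b (h.mem_order_iff.1 hb)).1

theorem pos_lt_of_mem (hb : b ∈ e.order s) : e.bubblePos b (p.instant s) < -p.Le :=
  ((h.regular_and_formed s).2 b (h.mem_order_iff.1 hb)).2

theorem mem_order_of_new (hb : b ∈ e.newBubbles s) : b ∈ e.order s :=
  h.mem_order_iff.2 (mem_bubbles.2 (Or.inr hb))

theorem mem_order_of_retained (hb : b ∈ e.retained p s) : b ∈ e.order s :=
  h.mem_order_iff.2 (mem_bubbles.2 (Or.inl hb))

theorem formed_of_succ (hf : Formed e (s + 1) b) (hb : b ∉ e.order (s + 1)) : Formed e s b := by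
  obtain ⟨r, hr, hf⟩ := hf
  rcases hr.lt_or_eq with h1 | rfl
  · exact ⟨r, by omega, hf⟩
  · exact absurd (h.mem_order_of_new hf) hb

/-- Bubbles scheduled again are retained. -/
theorem retained_of_mem (hf : Formed e s b) (hb : b ∈ e.order (s + 1)) :
    b ∈ e.retained p (s + 1) := by
  rcases mem_bubbles.1 (h.mem_order_iff.1 hb) with h1 | h1
  · exact h1
  · obtain ⟨r, hr, hf⟩ := hf
    have h2 := (h.loop.of_mem hf (h.loop.lead_mem hf)).2
    have h3 := (h.loop.of_mem h1 (h.loop.lead_mem hf)).2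
    omega

theorem mem_order_of_succ (hf : Formed e s b) (hb : b ∈ e.order (s + 1)) : b ∈ e.order s :=
  (mem_retained (h.retained_of_mem hf hb)).1

omit h in
theorem Formed.mono {s s' : ℕ} (hs : s ≤ s') (hf : Formed e s b) : Formed e s' b := by
  obtain ⟨r, hr, hf⟩ := hf
  exact ⟨r, hr.trans hs, hf⟩

/-- A bubble that is not scheduled is never scheduled again, and keeps its approach time. -/
theorem removed_persist (hf : Formed e s b) (hb : b ∉ e.order s) {s' : ℕ} (hs : s ≤ s') :
    b ∉ e.order s' ∧ e.tau p T F s' b = e.tau p T F s b := by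
  induction s', hs using Nat.le_induction with
  | base => exact ⟨hb, rfl⟩
  | succ s' hs ih =>
    have h1 : b ∉ e.order (s' + 1) := fun h1 =>
      ih.1 (h.mem_order_of_succ (Formed.mono hs hf) h1)
    exact ⟨h1, by rw [tau_of_notMem h1, ih.2]⟩

theorem tauMin_le_tau (hb : b ∈ e.order s) : e.tauMin p T F s ≤ e.tau p T F s b := by
  rw [tau_of_mem hb]
  exact ((h.regular s).feasible_of_isOrder (h.isOrder s)).after_min b (h.mem_order_iff.1 hb)

/-- The windows of the bubbles that are not rescheduled are over by `tauMin`. -/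
theorem tau_ge_of_removed (hf : Formed e s b) (hb : b ∉ e.order s) :
    e.tau p T F s b + occ p T b ≤ e.tauMin p T F s := by
  induction s with
  | zero =>
    obtain ⟨r, hr, hf⟩ := hf
    obtain rfl : r = 0 := by omega
    exact absurd (h.mem_order_of_new hf) hb
  | succ s ih =>
    rw [tau_of_notMem hb]
    by_cases h1 : b ∈ e.order s
    · exact tau_add_occ_le_tauMin h1 fun h2 => hb (h.mem_order_of_retained h2)
    · exact (ih (h.formed_of_succ hf hb) h1).trans (tauMin_le_succ s)

theorem order_pairwise (s : ℕ) : (e.order s).Pairwise fun i q =>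
    e.tau p T F s i + occ p T i ≤ e.tau p T F s q := by
  have h1 := (h.regular s).velOpt_pairwise (P := e.order s) (fun i hi => h.mem_order_iff.1 hi)
    (h.order_nodup s)
  refine h1.imp_of_mem fun {i q} hi hq hle => ?_
  rw [tau_of_mem hi, tau_of_mem hq]
  exact hle

theorem same_branch_of_mem (hi : i ∈ e.order s) (hq : q ∈ e.order s) (hk : i.branch = q.branch)
    (hlt : i.lead < q.lead) : e.tau p T F s i + occ p T i ≤ e.tau p T F s q :=
  SchedProblem.idxOf_lt_of_pairwise (h.order_pairwise s) hi hq
    ((h.isOrder s).idxOf_lt (h.mem_order_iff.1 hi) (h.mem_order_iff.1 hq) hk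
      ((h.lead_pos_lt_iff (h.formed_of_mem hi) (h.formed_of_mem hq) hk).2 hlt))

/-- The bubbles in front of a bubble that is not rescheduled are not rescheduled either. -/
theorem removed_of_front (hi : Formed e s i) (hq : Formed e s q) (hk : i.branch = q.branch)
    (hlt : i.lead < q.lead) (hrem : q ∉ e.order s) : i ∉ e.order s := by
  induction s with
  | zero =>
    obtain ⟨r, hr, hq⟩ := hq
    obtain rfl : r = 0 := by omega
    exact absurd (h.mem_order_of_new hq) hrem
  | succ s ih =>
    intro hmem
    have hq' := h.formed_of_succ hq hrem
    have hi' : Formed e s i := by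
      obtain ⟨r, hr, hi⟩ := hi
      obtain ⟨r', hr', hq'⟩ := hq'
      have h1 := (h.loop.of_mem hi (h.loop.lead_mem hi)).2
      have h2 := (h.loop.of_mem hq' (h.loop.lead_mem hq')).2
      have h3 := h.loop.inst_mono i.branch hlt.le
      rw [h1, hk, h2] at h3
      exact ⟨r, by omega, hi⟩
    have hret := h.retained_of_mem hi' hmem
    obtain ⟨hmem', hzone⟩ := mem_retained hret
    by_cases hqs : q ∈ e.order s
    swap
    · exact ih hi' hq' hqs hmem'
    have hqz : e.bubblePos q (p.instant (s + 1)) ∈ p.stagingZone ∪ p.midZone := by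
      obtain ⟨r', hr', hq''⟩ := hq'
      have h1 := h.spawn_le hq (h.loop.lead_mem hq'')
      exact zone_mem (h.start_le h1.1 h1.2.2)
        (((h.lead_pos_lt_iff hi hq hk).2 hlt).trans (zone_lt hzone))
    have hqr : q ∉ e.retained p (s + 1) := fun h2 => hrem (h.mem_order_of_retained h2)
    obtain ⟨f, m, hf, hm⟩ := e.retained_succ (p := p) s
    have hql : q ∈ (e.order s).filter f := List.mem_filter.2 ⟨hqs, (hf q).2 hqz⟩
    have hpw := (h.order_pairwise s).filter f
    rw [hm] at hqr hret
    rw [← List.take_append_drop m ((e.order s).filter f), List.mem_append] at hql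
    rw [← List.take_append_drop m ((e.order s).filter f), List.pairwise_append] at hpw
    have h1 := hpw.2.2 q (hql.resolve_right hqr) i hret
    have h2 := h.same_branch_of_mem hmem' hqs hk hlt
    obtain ⟨r, hr, hi''⟩ := hi'
    obtain ⟨r', hr', hq''⟩ := hq'
    linarith [h.occ_pos hi'', h.occ_pos hq'']

/-- The bubbles on a branch use the intersection one after the other. -/
theorem same_branch (hi : Formed e s i) (hq : Formed e s q) (hk : i.branch = q.branch)
    (hlt : i.lead < q.lead) : e.tau p T F s i + occ p T i ≤ e.tau p T F s q := by
  induction s with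
  | zero =>
    obtain ⟨r, hr, hi⟩ := hi
    obtain ⟨r', hr', hq⟩ := hq
    obtain rfl : r = 0 := by omega
    obtain rfl : r' = 0 := by omega
    exact h.same_branch_of_mem (h.mem_order_of_new hi) (h.mem_order_of_new hq) hk hlt
  | succ s ih =>
    by_cases hqs : q ∈ e.order (s + 1)
    · by_cases his : i ∈ e.order (s + 1)
      · exact h.same_branch_of_mem his hqs hk hlt
      · exact (h.tau_ge_of_removed hi his).trans (h.tauMin_le_tau hqs)
    · have his := h.removed_of_front hi hq hk hlt hqs
      rw [tau_of_notMem his, tau_of_notMem hqs]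
      exact ih (h.formed_of_succ hi his) (h.formed_of_succ hq hqs)

theorem windows_of_mem (hi : i ∈ e.order s) (hq : q ∈ e.order s) (hne : i ≠ q) :
    e.tau p T F s q + occ p T q ≤ e.tau p T F s i ∨
      e.tau p T F s i + occ p T i ≤ e.tau p T F s q := by
  rcases lt_trichotomy ((e.order s).idxOf i) ((e.order s).idxOf q) with h1 | h1 | h1
  · exact Or.inr (SchedProblem.idxOf_lt_of_pairwise (h.order_pairwise s) hi hq h1)
  · exact absurd ((List.idxOf_inj hi).1 h1) hne
  · exact Or.inl (SchedProblem.idxOf_lt_of_pairwise (h.order_pairwise s) hq hi h1)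

/-- The occupancy windows of different bubbles are disjoint. -/
theorem windows (hi : Formed e s i) (hq : Formed e s q) (hne : i ≠ q) :
    e.tau p T F s q + occ p T q ≤ e.tau p T F s i ∨
      e.tau p T F s i + occ p T i ≤ e.tau p T F s q := by
  induction s with
  | zero =>
    obtain ⟨r, hr, hi⟩ := hi
    obtain ⟨r', hr', hq⟩ := hq
    obtain rfl : r = 0 := by omega
    obtain rfl : r' = 0 := by omega
    exact h.windows_of_mem (h.mem_order_of_new hi) (h.mem_order_of_new hq) hne
  | succ s ih =>
    by_cases his : i ∈ e.order (s + 1) <;> by_cases hqs : q ∈ e.order (s + 1)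
    · exact h.windows_of_mem his hqs hne
    · exact Or.inl ((h.tau_ge_of_removed hq hqs).trans (h.tauMin_le_tau his))
    · exact Or.inr ((h.tau_ge_of_removed hi his).trans (h.tauMin_le_tau hqs))
    · rw [tau_of_notMem his, tau_of_notMem hqs]
      exact ih (h.formed_of_succ hi his) (h.formed_of_succ hq hqs)

/-- The earliest possible arrival of every vehicle is respected by the schedule. -/
theorem earliest_le (hb : b ∈ e.order s) {n : ℕ} (hn : n ∈ b.members) :
    p.instant s + p.earliestDuration (-e.x b.branch n (p.instant s)) (e.v b.branch n (p.instant s))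
      ≤ e.tau p T F s b + b.rank n * p.Tnom := by
  have hmem := h.mem_order_iff.1 hb
  have h1 := (h.bounds_of_pos_lt (h.formed_of_mem hb) (h.pos_lt_of_mem hb)).2.2.2.2 n hn
  have hreg := h.regular s
  have h2 := hreg.velOpt_spec (P := e.order s) (fun i hi => h.mem_order_iff.1 hi)
    (h.order_nodup s) b hb
  have h3 := ((hreg.le_vCap_iff hmem h2.1).1 h2.2).1
  have h4 := (SchedProblem.timeOf_le_timeOf_iff (hreg.d_pos b hmem) (hreg.vHi_pos b hmem) h2.1).2 h3
  rw [← tau_of_mem hb] at h4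
  have h5 : (e.problem p T F s).timeOf b ((e.problem p T F s).vHi b) = p.instant s +
    (e.problem p T F s).d b / (e.problem p T F s).vHi b := rfl
  linarith

end Admissible
end Evolution
end Intersection
namespace Intersection
namespace Evolution

/-! ### Arrival of the bubbles that are not rescheduled any more -/

variable {e : Evolution} {p : Params} {T : ℝ} {F : ℕ → Bubble → ℝ → ℝ}

variable (e) in
/-- The `s`-th instance is the last one at which the bubble is scheduled. -/
def LastAt (s : ℕ) (b : Bubble) : Prop := b ∈ e.order s ∧ ∀ r > s, b ∉ e.order r

variable (e p) in
/-- The vehicle reaches the intersection at time `A`, and has at least the nominal speed from then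
on. -/
structure Arrives (k : Fin 4) (n : ℕ) (A : ℝ) : Prop where
  spawn_le : e.spawn k n ≤ A
  pos_eq : e.x k n A = 0
  neg : ∀ t, e.spawn k n ≤ t → t < A → e.x k n t < 0
  vel : ∀ t ≥ A, p.νnom ≤ e.v k n t

namespace Admissible

variable (h : e.Admissible p T F) {s : ℕ} {b : Bubble}
include h

theorem lastAt_iff : LastAt e s b ↔ b ∈ e.order s ∧ b ∉ e.order (s + 1) := by
  refine ⟨fun hl => ⟨hl.1, hl.2 _ (Nat.lt_succ_self s)⟩, fun hl => ⟨hl.1, fun r hr => ?_⟩⟩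
  exact (h.removed_persist (Formed.mono s.le_succ (h.formed_of_mem hl.1)) hl.2 hr).1

theorem exists_lastAt (hf : Formed e s b) (hb : b ∉ e.order s) : ∃ r < s, LastAt e r b := by
  induction s with
  | zero =>
    obtain ⟨r, hr, hf⟩ := hf
    obtain rfl : r = 0 := by omega
    exact absurd (h.mem_order_of_new hf) hb
  | succ s ih =>
    by_cases h1 : b ∈ e.order s
    · exact ⟨s, s.lt_succ_self, h.lastAt_iff.2 ⟨h1, hb⟩⟩
    · obtain ⟨r, hr, hl⟩ := ih (h.formed_of_succ hf hb) h1
      exact ⟨r, hr.trans s.lt_succ_self, hl⟩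

theorem tau_eq_of_lastAt (hl : LastAt e s b) {r : ℕ} (hr : s ≤ r) :
    e.tau p T F r b = e.tau p T F s b := by
  rcases hr.lt_or_eq with hr | rfl
  · rw [(h.removed_persist (Formed.mono s.le_succ (h.formed_of_mem hl.1))
      (hl.2 _ s.lt_succ_self) hr).2, tau_of_notMem (hl.2 _ s.lt_succ_self)]
  · rfl

omit h in
theorem le_floor {t : ℝ} (ht : p.instant s ≤ t) : s ≤ ⌊t / p.Tcs⌋₊ :=
  Nat.le_floor ((le_div_iff₀ p.Tcs_pos).2 ht)

theorem vehicleTau_eq (hl : LastAt e s b) (n : ℕ) {t : ℝ} (ht : p.instant s ≤ t) :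
    e.vehicleTau p T F b n t = e.tau p T F s b + b.rank n * p.Tnom := by
  rw [vehicleTau, h.tau_eq_of_lastAt hl (le_floor ht)]

/-- At every scheduling of its bubble, a vehicle can still arrive in time, and it has room to stop and
to speed up again. -/
theorem not_late (hb : b ∈ e.order s) {n : ℕ} (hn : n ∈ b.members) :
    ¬p.Late (e.tau p T F s b + b.rank n * p.Tnom - p.instant s) (-e.x b.branch n (p.instant s))
        (e.v b.branch n (p.instant s)) ∧
      0 ≤ p.slack (e.tau p T F s b + b.rank n * p.Tnom - p.instant s)
        (e.v b.branch n (p.instant s)) ∧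
      0 < p.stopMargin (-e.x b.branch n (p.instant s)) (e.v b.branch n (p.instant s)) ∧
      p.instant s ≤ e.tau p T F s b + b.rank n * p.Tnom := by
  have hf := h.formed_of_mem hb
  have h1 := h.spawn_le hf hn
  have hv := h.loop.vel_mem h1.1 h1.2.2
  have hx := (h.member_pos_le hf hn).trans_lt (h.pos_lt_of_mem hb)
  have hLe := p.Le_pos
  have hum := p.uMax_pos
  have hd : 0 ≤ -e.x b.branch n (p.instant s) := by linarith
  have hspec := p.earliestDuration_spec hd hv
  have hE := h.earliest_le hb hn
  have h2 := hspec.1 (e.tau p T F s b + b.rank n * p.Tnom - p.instant s) (by linarith)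
  have hA : 0 ≤ p.vMax ^ 2 / (-2 * p.uMin) := by
    have : 0 < -2 * p.uMin := by linarith [p.uMin_neg]
    positivity
  have hs := h2.2 (by linarith [h.exit_le])
  refine ⟨?_, hs, ?_, ?_⟩
  · rw [Params.Late, not_or, not_lt, not_lt]
    exact ⟨h2.1, hs⟩
  · have h3 : e.v b.branch n (p.instant s) ^ 2 / (2 * -p.uMin) ≤ p.vMax ^ 2 / (-2 * p.uMin) := by
      rw [show 2 * -p.uMin = -2 * p.uMin by ring]
      have : 0 < -2 * p.uMin := by linarith [p.uMin_neg]
      have := hv.1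
      have := hv.2
      gcongr
    unfold Params.stopMargin
    linarith [h.exit_le]
  · have : 0 ≤ -e.x b.branch n (p.instant s) / p.vMax := div_nonneg hd p.vMax_pos.le
    linarith [hspec.2.1]

/-- The front vehicle of a branch, or one whose predecessor arrives before `B - T`, arrives between
its approach time and `B`. -/
theorem arrives_of_pred (hl : LastAt e s b) {n : ℕ} (hn : n ∈ b.members)
    {B : ℝ} (hB : e.tau p T F s b + b.rank n * p.Tnom ≤ B)
    (hpred : 1 ≤ n → ∃ A, Arrives e p b.branch (n - 1) A ∧ A + T ≤ B) :
    ∃ A, Arrives e p b.branch n A ∧ e.tau p T F s b + b.rank n * p.Tnom ≤ A ∧ A ≤ B := by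
  obtain ⟨hnl, hslack, hroom, h0τ⟩ := h.not_late hl.1 hn
  have hf := h.formed_of_mem hl.1
  obtain ⟨hc, hjoin, hsp⟩ := h.spawn_le hf hn
  obtain ⟨r₀, hr₀, hnew⟩ := id hf
  have hinst : ∀ t ≥ p.instant s, p.instant r₀ ≤ t := fun t ht => (Params.instant_mono hr₀).trans ht
  set τ := e.tau p T F s b + b.rank n * p.Tnom with hτ
  have htr := (h.loop.traj hc).mono hsp
  have hv : ∀ t ≥ p.instant s, e.v b.branch n t ∈ Icc 0 p.vMax := fun t ht =>
    h.loop.vel_mem hc (hsp.trans ht)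
  have hx0 : e.x b.branch n (p.instant s) < 0 := by
    have := (h.member_pos_le hf hn).trans_lt (h.pos_lt_of_mem hl.1)
    linarith [p.Le_pos]
  have hlaw : ∀ t ≥ p.instant s, ¬e.Coupled p b.branch n t → e.v b.branch n t < p.vMax →
      e.u b.branch n t = p.guc τ t (e.x b.branch n t) (e.v b.branch n t) := fun t ht hC hvt => by
    rw [h.loop.eq_guc hnew hn (hinst t ht) hC hvt, h.vehicleTau_eq hl n ht]
  have hneg := neg_of_lt_tau htr (fun t ht => (h.loop.acc_mem hc (hsp.trans ht)).2) hv
    (fun t ht hg => h.loop.eq_uMin_of_guc hnew hn (hinst t ht)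
      (by rw [h.vehicleTau_eq hl n ht]; exact hg)) hroom hslack
  have hdich := fun B' (hB' : τ ≤ B') => arrival_dichotomy (B := B') htr hv h0τ hB'
    (h.loop.isCompact_coupled hc hsp) hlaw hnl
  have hmono : ∀ a c, p.instant s ≤ a → a ≤ c → e.x b.branch n a ≤ e.x b.branch n c :=
    fun a c ha hac => h.loop.pos_mono hc (hsp.trans ha) hac
  -- the consequences of having been coupled to the predecessor
  have hcoup : ∀ B' c, c ∈ Icc (p.instant s) B' → e.Coupled p b.branch n c →
      (∀ t ∈ Icc c B', min p.vMax (e.v b.branch n c + p.uMax * (t - c)) ≤ e.v b.branch n t) →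
      ∃ A, Arrives e p b.branch (n - 1) A ∧ A + T ≤ B ∧ (A ≤ B' → p.νnom ≤ e.v b.branch n B') ∧
        (A + T ≤ B' → 0 ≤ e.x b.branch n B') := fun B' c hcI hC hlow => by
    obtain ⟨h1, h2, h3, h4⟩ := coupled_iff.1 hC
    obtain ⟨A, hA, hAT⟩ := hpred h1
    have hc' := IsClosedLoop.pred_lt (Nat.sub_le n 1) hc
    have hspc : e.spawn b.branch (n - 1) ≤ c :=
      (h.loop.spawn_mono _ (Nat.sub_le n 1)).trans (hsp.trans hcI.1)
    have key := arrival_of_coupled htr hv (h.loop.traj hc') (fun t ht => h.loop.vel_mem hc' ht)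
      (fun t ht => (h.loop.acc_mem hc' ht).2) hA.spawn_le hA.pos_eq hA.vel hcI.1 hspc hcI.2 h2 h4
      hlow
    exact ⟨A, hA, hAT, key.1, key.2 T h.Tiat_le⟩
  have hxB : 0 ≤ e.x b.branch n B := by
    rcases hdich B hB with h1 | ⟨c, hcI, hC, hlow⟩
    · exact h1.1.trans (hmono _ _ h0τ hB)
    · obtain ⟨A, -, hAT, -, h2⟩ := hcoup B c hcI hC hlow
      exact h2 hAT
  obtain ⟨A, hAI, hA0, hAneg⟩ := exists_first_nonpos (f := fun t => -e.x b.branch n t)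
    (h0τ.trans hB) (htr.cont_x le_rfl).neg (by linarith) (by linarith)
  have hA0 : e.x b.branch n A = 0 := by linarith
  have hτA : τ ≤ A := by
    by_contra! hlt
    have := hneg A ⟨hAI.1.le, hlt⟩
    linarith
  have hpredle : ∀ A', Arrives e p b.branch (n - 1) A' → 1 ≤ n → A' ≤ A := fun A' hA' h1 => by
    by_contra! hlt
    have h2 := h.loop.pos_lt_pos h.safe hc (m := n - 1) (by omega)
      (hjoin.trans (hAI.1.le.trans hlt.le))
    have h3 := hmono A A' hAI.1.le hlt.le
    rw [hA'.pos_eq] at h2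
    linarith
  have hvA : p.νnom ≤ e.v b.branch n A := by
    rcases hdich A hτA with h1 | ⟨c, hcI, hC, hlow⟩
    · rcases hτA.lt_or_eq with h2 | h2
      · have := hAneg τ ⟨h0τ, h2⟩
        linarith [h1.1]
      · rw [← h2]; exact h1.2
    · obtain ⟨A', hA', -, h2, -⟩ := hcoup A c hcI hC hlow
      exact h2 (hpredle A' hA' hC.1)
  refine ⟨A, ⟨hsp.trans hAI.1.le, hA0, fun t ht htA => ?_, fun t ht => ?_⟩, hτA, hAI.2⟩
  · rcases le_total (p.instant s) t with h1 | h1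
    · have := hAneg t ⟨h1, htA⟩
      linarith
    · exact (h.loop.pos_mono hc ht h1).trans_lt hx0
  · have := htr.min_le_vel (a := A) (b := t) (c := p.νnom) (m := 0) hAI.1.le (fun r hr hrv => by
      have hr0 : p.instant s ≤ r := hAI.1.le.trans hr.1.le
      have hnC : ¬e.Coupled p b.branch n r := fun hC => by
        obtain ⟨A', hA', -⟩ := hpred hC.1
        have h3 := hA'.vel r ((hpredle A' hA' hC.1).trans hr.1.le)
        linarith [(coupled_iff.1 hC).2.1]
      rw [hlaw r hr0 hnC (hrv.trans_le p.νnom_le), p.guc_of_le (hτA.trans hr.1.le)]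
      exact p.uMax_pos.le) le_rfl t ⟨ht, le_rfl⟩
    rw [zero_mul, add_zero, min_eq_left hvA] at this
    exact this

omit h in
theorem mul_T_le_occ : b.members.card * T ≤ occ p T b := by
  have := le_max_right ((p.L + p.Δ) / p.νnom) T
  unfold occ Params.occBound
  linarith

/-- The vehicles of a bubble arrive with delays of at most `T` after one another, and the lead
vehicle arrives exactly at the approach time of the bubble. -/
theorem arrives {k : Fin 4} (n : ℕ) : ∀ (s : ℕ) (b : Bubble), LastAt e s b → b.branch = k →
    n ∈ b.members → ∃ A, Arrives e p k n A ∧ e.tau p T F s b + b.rank n * p.Tnom ≤ A ∧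
      A ≤ e.tau p T F s b + b.rank n * T := by
  induction n with
  | zero =>
    rintro s b hl rfl hn
    obtain ⟨r, -, hnew⟩ := h.formed_of_mem hl.1
    have hr : b.rank 0 = 0 := by rw [h.loop.rank_eq h.safe hnew hn]; omega
    rw [hr, Nat.cast_zero, zero_mul]
    have := h.arrives_of_pred hl hn (B := e.tau p T F s b) (by rw [hr]; simp) (by simp)
    rw [hr, Nat.cast_zero, zero_mul] at this
    simpa using this
  | succ n ih =>
    rintro s b hl rfl hn
    have hf := h.formed_of_mem hl.1
    obtain ⟨r, hrs, hnew⟩ := id hf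
    have hcn := (h.loop.of_mem hnew hn).1
    have hT := h.Tiat_le
    have hTn := p.Tnom_le_Tiat
    have hrank := h.loop.rank_eq h.safe hnew hn
    have hrT : b.rank (n + 1) * p.Tnom ≤ b.rank (n + 1) * T := by
      gcongr
      linarith
    rcases (IsClosedLoop.lead_le hn).lt_or_eq with hlead | hlead
    · -- the predecessor belongs to the same bubble
      have hn' : n ∈ b.members := (h.loop.mem_members_iff h.safe hnew).2 (by
        have := (h.loop.mem_members_iff h.safe hnew).1 hn
        omega)
      obtain ⟨A, hA, -, hA2⟩ := ih s b hl rfl hn'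
      refine h.arrives_of_pred hl hn (B := e.tau p T F s b + b.rank (n + 1) * T) (by linarith)
        fun _ => ⟨A, hA, ?_⟩
      rw [h.loop.rank_eq h.safe hnew hn'] at hA2
      have h1 : b.rank (n + 1) = (n - b.lead) + 1 := by omega
      rw [h1, Nat.cast_add, Nat.cast_one]
      linarith
    · -- the predecessor is the last vehicle of the preceding bubble
      have hcn' := IsClosedLoop.pred_lt n.le_succ hcn
      obtain ⟨b', hnew', hk, hnb'⟩ := h.loop.exists_bubble hcn'
      have hlt : b'.lead < b.lead := by
        have := IsClosedLoop.lead_le hnb'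
        omega
      have hf' : Formed e s b' := by
        refine ⟨_, ?_, hnew'⟩
        have h1 := h.loop.inst_mono b.branch (Nat.le_add_right n 1)
        have h2 := (h.loop.of_mem hnew hn).2
        omega
      have hrem' := h.removed_of_front (Formed.mono s.le_succ hf') (Formed.mono s.le_succ hf) hk hlt
        (hl.2 _ s.lt_succ_self)
      obtain ⟨s', hs', hl'⟩ := h.exists_lastAt (Formed.mono s.le_succ hf') hrem'
      obtain ⟨A, hA, -, hA2⟩ := ih s' b' hl' hk hnb'
      have hr0 : b.rank (n + 1) = 0 := by omega
      have hsb := h.same_branch hf' hf hk hlt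
      rw [h.tau_eq_of_lastAt hl' (by omega)] at hsb
      have hr' : b'.rank n + 1 ≤ b'.members.card := by
        rw [h.loop.rank_eq h.safe hnew' hnb']
        have := (h.loop.mem_members_iff h.safe hnew').1 hnb'
        omega
      have hr'' : ((b'.rank n : ℝ) + 1) * T ≤ b'.members.card * T := by
        have := h.T_pos
        gcongr
        exact_mod_cast hr'
      refine h.arrives_of_pred hl hn (B := e.tau p T F s b + b.rank (n + 1) * T) (by linarith)
        fun _ => ⟨A, hA, ?_⟩
      rw [hr0, Nat.cast_zero, zero_mul, add_zero]
      have := mul_T_le_occ (p := p) (T := T) (b := b')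
      linarith

end Admissible
end Evolution
end Intersection
namespace Intersection

/-! ### Every bubble is scheduled a last time -/

namespace Params

variable (p : Params)

/-- Bound on the number of clustered vehicles in front of the intersection. -/
noncomputable def maxVehicles : ℝ := 4 * (-p.start / p.L + 1)

/-- Bound on the total occupancy time of the bubbles in front of the intersection. -/
noncomputable def maxOcc (T : ℝ) : ℝ := (T + (p.L + p.Δ) / p.νnom) * p.maxVehicles

end Params

namespace Evolution

variable {e : Evolution} {p : Params} {T : ℝ} {F : ℕ → Bubble → ℝ → ℝ}

namespace Admissible

variable (h : e.Admissible p T F) {s : ℕ} {b : Bubble}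
include h

/-- Vehicles on the same branch in front of the intersection are at least `L` apart. -/
theorem card_vehicles_le {k : Fin 4} {G : Finset ℕ} {t : ℝ} (hG : ∀ n ∈ G,
    (n : ℕ∞) < e.count k ∧ e.joinTime p k n ≤ t ∧ e.x k n t < 0) :
    (G.card : ℝ) ≤ -p.start / p.L + 1 := by
  have hL := p.L_pos
  rcases G.eq_empty_or_nonempty with rfl | hne
  · have : 0 < -p.start := by
      have := p.Ls_pos; have := p.Lm_pos; have := p.Le_pos
      unfold Params.start; linarith
    have := div_pos this hL
    simp only [Finset.card_empty, Nat.cast_zero]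
    linarith
  set a := G.min' hne
  set c := G.max' hne
  have hac : a ≤ c := G.min'_le _ (G.max'_mem hne)
  obtain ⟨c1, c2, -⟩ := hG c (G.max'_mem hne)
  have h1 := h.loop.pos_add_le h.safe c1 hac c2
  have h2 := h.start_le c1 ((spawn_le_joinTime k c).trans c2)
  have h3 := (hG a (G.min'_mem hne)).2.2
  have h4 : G.card ≤ c + 1 - a := by
    rw [← Nat.card_Icc]
    exact Finset.card_le_card fun n hn => Finset.mem_Icc.2 ⟨G.min'_le _ hn, G.le_max' _ hn⟩
  have h5 : (G.card : ℝ) ≤ c + 1 - a := by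
    have : G.card + a ≤ c + 1 := by omega
    have : (G.card : ℝ) + a ≤ c + 1 := by exact_mod_cast this
    linarith
  have h6 : (c : ℝ) - a ≤ -p.start / p.L := by
    rw [le_div_iff₀ hL]; linarith
  linarith

/-- Bubbles all of whose vehicles are in front of the intersection have at most `maxVehicles`
vehicles in total. -/
theorem sum_card_le {G : Finset Bubble} (hG : ∀ b ∈ G, Formed e s b ∧
    ∀ n ∈ b.members, e.x b.branch n (p.instant s) < 0) :
    ∑ b ∈ G, (b.members.card : ℝ) ≤ p.maxVehicles := by
  rw [← Finset.sum_fiberwise (s := G) (g := Bubble.branch)]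
  have : ∀ k, ∑ b ∈ G.filter (fun b => b.branch = k), (b.members.card : ℝ) ≤
      -p.start / p.L + 1 := fun k => by
    have hd : ((G.filter fun b => b.branch = k : Finset Bubble) : Set Bubble).PairwiseDisjoint
        Bubble.members := fun b hb b' hb' hne => by
      rw [Finset.mem_coe, Finset.mem_filter] at hb hb'
      obtain ⟨r, -, h1⟩ := (hG b hb.1).1
      obtain ⟨r', -, h2⟩ := (hG b' hb'.1).1
      exact Finset.disjoint_left.2 fun n hn hn' =>
        hne (h.loop.bubble_unique h1 h2 (hb.2.trans hb'.2.symm) hn hn')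
    have h1 := Finset.card_biUnion hd
    have h2 : (((G.filter fun b => b.branch = k).biUnion Bubble.members).card : ℝ) ≤
        -p.start / p.L + 1 := by
      refine h.card_vehicles_le (k := k) (t := p.instant s) fun n hn => ?_
      obtain ⟨b, hb, hnb⟩ := Finset.mem_biUnion.1 hn
      obtain ⟨hbG, rfl⟩ := Finset.mem_filter.1 hb
      have h3 := h.spawn_le (hG b hbG).1 hnb
      exact ⟨h3.1, h3.2.1, (hG b hbG).2 n hnb⟩
    rw [h1] at h2
    exact_mod_cast h2
  refine (Finset.sum_le_sum fun k _ => this k).trans (le_of_eq ?_)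
  rw [Finset.sum_const, Finset.card_univ, Fintype.card_fin, nsmul_eq_mul, Params.maxVehicles]
  norm_num

theorem occ_le (hb : Formed e s b) :
    occ p T b ≤ (T + (p.L + p.Δ) / p.νnom) * b.members.card := by
  obtain ⟨r, -, hb⟩ := hb
  have h1 : (1 : ℝ) ≤ b.members.card := by exact_mod_cast h.loop.card_pos hb
  have h2 : 0 ≤ (p.L + p.Δ) / p.νnom := by
    have := p.L_pos; have := p.Δ_pos; have := p.νnom_pos; positivity
  have h3 : max ((p.L + p.Δ) / p.νnom) T ≤ (p.L + p.Δ) / p.νnom + T :=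
    max_le (by linarith [h.T_pos]) (by linarith)
  unfold occ Params.occBound
  nlinarith [mul_nonneg h2 (sub_nonneg.2 h1)]

theorem neg_of_mem (hb : b ∈ e.order s) {n : ℕ} (hn : n ∈ b.members) :
    e.x b.branch n (p.instant s) < 0 := by
  have := (h.member_pos_le (h.formed_of_mem hb) hn).trans_lt (h.pos_lt_of_mem hb)
  linarith [p.Le_pos]

theorem maxOcc_nonneg_factor : 0 ≤ T + (p.L + p.Δ) / p.νnom := by
  have := p.L_pos; have := p.Δ_pos; have := p.νnom_pos; have := h.T_pos
  positivity

theorem sum_occ_le (s : ℕ) : ((e.order s).map (occ p T)).sum ≤ p.maxOcc T := by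
  rw [← List.sum_toFinset _ (h.order_nodup s)]
  have hm : ∀ b ∈ (e.order s).toFinset, b ∈ e.order s := fun b hb => List.mem_toFinset.1 hb
  refine (Finset.sum_le_sum fun b hb => h.occ_le (h.formed_of_mem (hm b hb))).trans ?_
  rw [← Finset.mul_sum, Params.maxOcc]
  exact mul_le_mul_of_nonneg_left (h.sum_card_le fun b hb =>
    ⟨h.formed_of_mem (hm b hb), fun n hn => h.neg_of_mem (hm b hb) hn⟩) h.maxOcc_nonneg_factor

/-- The windows of a schedule start without delay once the release times of its bubbles have passed,
and follow one another without gaps, at worst. -/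
theorem tau_add_occ_le (hb : b ∈ e.order s) : e.tau p T F s b + occ p T b ≤
    max (p.instant s + p.approachBound) (e.tauMin p T F s) + p.maxOcc T := by
  have hreg := h.regular s
  have hmem : ∀ i ∈ e.order s, i ∈ (e.problem p T F s).bubbles := fun i hi => h.mem_order_iff.1 hi
  have hcap : ∀ i ∈ e.order s, (e.problem p T F s).timeOf i ((e.problem p T F s).vCap i) ≤
      max (p.instant s + p.approachBound) (e.tauMin p T F s) := fun i hi => by
    refine (hreg.timeOf_vCap_le (hmem i hi)).trans (max_le_max ?_ le_rfl)
    have := (h.bounds_of_pos_lt (h.formed_of_mem hi) (h.pos_lt_of_mem hi)).2.2.2.1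
    have h5 : (e.problem p T F s).timeOf i ((e.problem p T F s).vHi i) = p.instant s +
      (e.problem p T F s).d i / (e.problem p T F s).vHi i := rfl
    linarith
  have happ := p.approachBound_pos
  have h1 := hreg.velOpt_time_le hmem (h.order_nodup s) hcap
    (le_trans (by change p.instant s ≤ _; linarith) (le_max_left _ _)) b hb
  rw [← tau_of_mem hb] at h1
  have h2 := h.sum_occ_le s
  change e.tau p T F s b + occ p T b ≤ _ + ((e.order s).map (occ p T)).sum at h1
  linarith

variable (e p T F) in
omit h in
/-- The bubbles that are not rescheduled and whose approach time is later than `y`. -/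
noncomputable def pending (s : ℕ) (y : ℝ) : Finset Bubble :=
  open Classical in
  ((Finset.range (s + 1)).biUnion e.newBubbles).filter fun b => b ∉ e.order s ∧ y < e.tau p T F s b

omit h in
theorem mem_pending {y : ℝ} : b ∈ pending e p T F s y ↔
    Formed e s b ∧ b ∉ e.order s ∧ y < e.tau p T F s b := by
  unfold pending
  rw [Finset.mem_filter, Finset.mem_biUnion]
  simp only [Finset.mem_range, Nat.lt_succ_iff]
  rfl

theorem pending_subset (s : ℕ) (y : ℝ) : pending e p T F s y ⊆ pending e p T F (s + 1) y :=
  fun b hb => by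
    obtain ⟨h1, h2, h3⟩ := mem_pending.1 hb
    obtain ⟨h4, h5⟩ := h.removed_persist h1 h2 s.le_succ
    exact mem_pending.2 ⟨Formed.mono s.le_succ h1, h4, by rw [h5]; exact h3⟩

theorem maxOcc_nonneg : 0 ≤ p.maxOcc T := by
  have := h.sum_card_le (s := 0) (G := ∅) (by simp)
  rw [Finset.sum_empty] at this
  exact mul_nonneg h.maxOcc_nonneg_factor this

/-- A bubble with an approach time later than `y` that is rescheduled no more raises the bound on
`tauMin` by at most `maxOcc`. For `y` the present time, such bubbles are still in front of the
intersection, so that there are few of them. -/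
theorem tauMin_le_pending (s : ℕ) : ∀ y ≥ p.instant s, e.tauMin p T F s ≤
    y + p.approachBound + p.maxOcc T + p.maxOcc T * (pending e p T F s y).card := by
  have hO := h.maxOcc_nonneg
  have happ := p.approachBound_pos
  induction s with
  | zero =>
    intro y hy
    have h0 : e.tauMin p T F 0 = 0 := rfl
    have h1 : p.instant 0 = 0 := by simp [Params.instant]
    have h2 : 0 ≤ p.maxOcc T * (pending e p T F 0 y).card := by positivity
    linarith
  | succ s ih =>
    intro y hy
    have hy' : p.instant s ≤ y := (Params.instant_mono s.le_succ).trans hy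
    have hcard : ((pending e p T F s y).card : ℝ) ≤ (pending e p T F (s + 1) y).card := by
      exact_mod_cast Finset.card_le_card (h.pending_subset s y)
    have hmul := mul_le_mul_of_nonneg_left hcard hO
    refine tauMin_succ_le ((ih y hy').trans (by linarith)) fun b hb hr => ?_
    have hf := h.formed_of_mem hb
    have hrem : b ∉ e.order (s + 1) := fun hb' => hr (h.retained_of_mem hf hb')
    rcases le_or_gt (e.tau p T F s b) y with h1 | h1
    · have h2 : occ p T b ≤ p.maxOcc T := by
        refine (List.single_le_sum (l := (e.order s).map (occ p T)) (fun x hx => ?_) _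
          (List.mem_map_of_mem hb)).trans (h.sum_occ_le s)
        obtain ⟨i, hi, rfl⟩ := List.mem_map.1 hx
        obtain ⟨r, -, hi⟩ := h.formed_of_mem hi
        exact (h.occ_pos hi).le
      have h3 : 0 ≤ p.maxOcc T * (pending e p T F (s + 1) y).card := by positivity
      linarith
    · have h2 : b ∉ pending e p T F s y := fun h2 => (mem_pending.1 h2).2.1 hb
      have h3 : insert b (pending e p T F s y) ⊆ pending e p T F (s + 1) y :=
        Finset.insert_subset (mem_pending.2 ⟨Formed.mono s.le_succ hf, hrem, by
          rw [tau_of_notMem hrem]; exact h1⟩) (h.pending_subset s y)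
      have h4 := Finset.card_le_card h3
      rw [Finset.card_insert_of_notMem h2] at h4
      have h5 : ((pending e p T F s y).card : ℝ) + 1 ≤ (pending e p T F (s + 1) y).card := by
        exact_mod_cast h4
      have h6 := mul_le_mul_of_nonneg_left h5 hO
      have h7 := h.tau_add_occ_le hb
      have h8 := ih y hy'
      have h9 : 0 ≤ p.maxOcc T * (pending e p T F s y).card := by positivity
      have h10 : max (p.instant s + p.approachBound) (e.tauMin p T F s) ≤
          y + p.approachBound + p.maxOcc T + p.maxOcc T * (pending e p T F s y).card :=
        max_le (by linarith) h8
      linarith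

theorem card_pending_le (s : ℕ) :
    ((pending e p T F s (p.instant s)).card : ℝ) ≤ p.maxVehicles := by
  refine le_trans ?_ (h.sum_card_le (s := s) (G := pending e p T F s (p.instant s)) fun b hb => ?_)
  · rw [Finset.cast_card]
    refine Finset.sum_le_sum fun b hb => ?_
    obtain ⟨r, -, hb⟩ := (mem_pending.1 hb).1
    exact_mod_cast h.loop.card_pos hb
  · obtain ⟨h1, h2, h3⟩ := mem_pending.1 hb
    refine ⟨h1, fun n hn => ?_⟩
    obtain ⟨r, hr, hl⟩ := h.exists_lastAt h1 h2
    obtain ⟨A, hA, hA1, -⟩ := h.arrives n r b hl rfl hn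
    rw [h.tau_eq_of_lastAt hl hr.le] at h3
    have : 0 ≤ b.rank n * p.Tnom := mul_nonneg (Nat.cast_nonneg _) p.Tnom_pos.le
    exact hA.neg _ (h.spawn_le h1 hn).2.2 (by linarith)

/-- The approach times lie at most a fixed time ahead. -/
theorem exists_tau_le : ∃ C > 0, ∀ s, ∀ b ∈ e.order s, e.tau p T F s b ≤ p.instant s + C := by
  have hO := h.maxOcc_nonneg
  have happ := p.approachBound_pos
  have hV : 0 ≤ p.maxVehicles := (Nat.cast_nonneg _).trans (h.card_pending_le 0)
  have hOV := mul_nonneg hO hV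
  refine ⟨p.approachBound + 2 * p.maxOcc T + p.maxOcc T * p.maxVehicles, by linarith,
    fun s b hb => ?_⟩
  have h1 := h.tau_add_occ_le hb
  have h2 := h.tauMin_le_pending s _ le_rfl
  have h3 := mul_le_mul_of_nonneg_left (h.card_pending_le s) hO
  have h4 : max (p.instant s + p.approachBound) (e.tauMin p T F s) ≤
      p.instant s + p.approachBound + p.maxOcc T + p.maxOcc T * p.maxVehicles :=
    max_le (by linarith) (by linarith)
  obtain ⟨r, -, hb'⟩ := h.formed_of_mem hb
  linarith [h.occ_pos hb']

/-- If the predecessor of its lead vehicle has reached the intersection, a bubble is not rescheduled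
for ever: a slow lead vehicle has more room than its approach time requires, and accelerates. -/
theorem exists_not_mem_order (hb : b ∈ e.newBubbles s)
    (hpred : 1 ≤ b.lead → ∃ A, Arrives e p b.branch (b.lead - 1) A) : ∃ r ≥ s, b ∉ e.order r := by
  by_contra! hall
  have hlead := h.loop.lead_mem hb
  obtain ⟨C, hC, hτ⟩ := h.exists_tau_le
  have hf : Formed e s b := ⟨s, le_rfl, hb⟩
  obtain ⟨hc, -, hsp⟩ := h.spawn_le hf hlead
  have hum := p.uMax_pos
  have hvM := p.vMax_pos
  have hn := p.νnom_pos
  have hK : 0 < -2 * p.uMin := by linarith [p.uMin_neg]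
  have hr0 : b.rank b.lead = 0 := by rw [h.loop.rank_eq h.safe hb hlead, Nat.sub_self]
  have hfloor : ∀ t ≥ p.instant s, p.instant ⌊t / p.Tcs⌋₊ ≤ t := fun t ht => by
    have h1 : 0 ≤ t / p.Tcs := div_nonneg ((Params.instant_nonneg s).trans ht) p.Tcs_pos.le
    have h2 := Nat.floor_le h1
    rwa [le_div_iff₀ p.Tcs_pos] at h2
  have hx : ∀ t ≥ p.instant s, e.x b.branch b.lead t ≤ -p.Le := fun t ht => by
    obtain ⟨m, hm⟩ := exists_nat_ge (t / p.Tcs)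
    rw [div_le_iff₀ p.Tcs_pos] at hm
    have h1 : t ≤ p.instant (max m s) := le_trans hm (Params.instant_mono (le_max_left m s))
    exact (h.loop.pos_mono hc (hsp.trans ht) h1).trans (h.pos_lt_of_mem (hall _ (le_max_right m s))).le
  obtain ⟨A, hA0, hA⟩ : ∃ A ≥ p.instant s, ∀ t ≥ A, 1 ≤ b.lead →
      p.νnom ≤ e.v b.branch (b.lead - 1) t := by
    by_cases h1 : 1 ≤ b.lead
    · obtain ⟨A, hA⟩ := hpred h1
      exact ⟨max A (p.instant s), le_max_right _ _, fun t ht _ => hA.vel t ((le_max_left _ _).trans ht)⟩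
    · exact ⟨p.instant s, le_rfl, fun t _ h2 => absurd h2 h1⟩
  -- below the speed `w`, holding the speed for the time `C` covers less than the room to spare in
  -- front of the intersection
  set w := min (p.vMax ^ 2 / (-2 * p.uMin) / C) p.νnom with hw
  have hw0 : 0 < w := lt_min (by positivity) hn
  have htr := h.loop.traj hc
  have hacc : ∀ r ≥ A, e.v b.branch b.lead r < w → p.uMax ≤ e.u b.branch b.lead r := fun r hr hv => by
    have hrs : p.instant s ≤ r := hA0.trans hr
    have hvm := h.loop.vel_mem hc (hsp.trans hrs)
    have hvn : e.v b.branch b.lead r < p.νnom := hv.trans_le (min_le_right _ _)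
    have hnC : ¬e.Coupled p b.branch b.lead r := fun hC => by
      linarith [hA r hr hC.1, (coupled_iff.1 hC).2.1]
    rw [h.loop.eq_guc hb hlead hrs hnC (hvn.trans_le p.νnom_le)]
    refine (p.guc_of_holdDist_lt hvm ?_).ge
    have h1 : e.vehicleTau p T F b b.lead r - r ≤ C := by
      have h2 := hτ _ b (hall ⌊r / p.Tcs⌋₊ (le_floor hrs))
      have h3 := hfloor r hrs
      unfold vehicleTau
      rw [hr0, Nat.cast_zero, zero_mul, add_zero]
      linarith
    have h2 : e.v b.branch b.lead r * C < p.vMax ^ 2 / (-2 * p.uMin) := by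
      rw [← lt_div_iff₀ hC]
      exact hv.trans_le (min_le_left _ _)
    have h3 : e.v b.branch b.lead r * (e.vehicleTau p T F b b.lead r - r) ≤
        e.v b.branch b.lead r * C := mul_le_mul_of_nonneg_left h1 hvm.1
    have h4 : max (p.νnom - e.v b.branch b.lead r) 0 ^ 2 / (2 * p.uMax) ≤
        p.νnom ^ 2 / (2 * p.uMax) := by
      have : max (p.νnom - e.v b.branch b.lead r) 0 ≤ p.νnom := max_le (by linarith [hvm.1]) hn.le
      gcongr
    have h5 := hx r hrs
    unfold Params.holdDist
    linarith [h.exit_le]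
  have hAs : e.spawn b.branch b.lead ≤ A := hsp.trans hA0
  have hvw : ∀ t ≥ A + w / p.uMax, w ≤ e.v b.branch b.lead t := fun t ht => by
    have hAt : A ≤ t := by linarith [div_pos hw0 hum]
    have h1 := htr.min_le_vel (a := A) (b := t) (c := w) (m := p.uMax) hAs
      (fun r hr hv => hacc r hr.1.le hv) hum.le t ⟨hAt, le_rfl⟩
    have h2 := (h.loop.vel_mem hc hAs).1
    have h3 : w ≤ p.uMax * (t - A) := by
      rw [← div_le_iff₀' hum]; linarith
    rw [min_eq_left (by linarith)] at h1
    exact h1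
  set B := A + w / p.uMax with hB
  have hAB : A ≤ B := by linarith [div_pos hw0 hum]
  have hD : 0 < -p.start / w := by
    have := p.neg_start_pos
    positivity
  have h1 := htr.const_le_pos_sub (a := B) (b := B + -p.start / w) (c := w) (hAs.trans hAB)
    (by linarith) fun r hr => hvw r hr.1
  rw [add_sub_cancel_left, mul_div_cancel₀ _ hw0.ne'] at h1
  have h2 := h.start_le hc (hAs.trans hAB)
  have h3 := hx (B + -p.start / w) (by linarith)
  linarith [p.Le_pos]

/-- Every bubble is scheduled a last time, by induction along the branch. -/
theorem exists_lastAt_of_new {k : Fin 4} (m : ℕ) : ∀ s, ∀ b ∈ e.newBubbles s, b.branch = k →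
    b.lead = m → ∃ r ≥ s, LastAt e r b := by
  induction m using Nat.strong_induction_on with
  | _ m ih =>
    rintro s b hb rfl rfl
    obtain ⟨r, hr, hbr⟩ := h.exists_not_mem_order hb fun h1 => by
      have hc := (h.loop.of_mem hb (h.loop.lead_mem hb)).1
      obtain ⟨b', hb', hk, hn⟩ := h.loop.exists_bubble (IsClosedLoop.pred_lt (Nat.sub_le b.lead 1) hc)
      have hlt : b'.lead < b.lead := by
        have := IsClosedLoop.lead_le hn
        omega
      obtain ⟨r, -, hl⟩ := ih _ hlt _ b' hb' hk rfl
      obtain ⟨A, hA, -⟩ := h.arrives _ r b' hl hk hn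
      exact ⟨A, hA⟩
    obtain ⟨r', hr', hl⟩ := h.exists_lastAt ⟨s, hr, hb⟩ hbr
    refine ⟨r', ?_, hl⟩
    by_contra! hlt
    exact hl.2 s hlt (h.mem_order_of_new hb)

end Admissible
end Evolution
end Intersection
namespace Intersection
namespace Evolution

/-! ### Use of the intersection -/

variable {e : Evolution} {p : Params} {T : ℝ} {F : ℕ → Bubble → ℝ → ℝ}

namespace Arrives

variable {k : Fin 4} {n : ℕ} {A : ℝ} (hA : Arrives e p k n A)
include hA

theorem le_of_nonneg {t : ℝ} (ht : e.spawn k n ≤ t) (hx : 0 ≤ e.x k n t) : A ≤ t := by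
  by_contra! hlt
  exact (hA.neg t ht hlt).not_ge hx

theorem mul_le_pos (he : e.IsClosedLoop p T F) (hn : (n : ℕ∞) < e.count k) {t : ℝ} (ht : A ≤ t) :
    p.νnom * (t - A) ≤ e.x k n t := by
  have := (he.traj hn).const_le_pos_sub hA.spawn_le ht fun r hr => hA.vel r hr.1
  rwa [hA.pos_eq, sub_zero] at this

theorem exists_crossed (he : e.IsClosedLoop p T F) (hn : (n : ℕ∞) < e.count k) :
    ∃ t ≥ e.spawn k n, e.x k n t = p.Δ + p.L := by
  have hν := p.νnom_pos
  have hD : 0 < p.Δ + p.L := add_pos p.Δ_pos p.L_pos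
  have hAB : A ≤ A + (p.Δ + p.L) / p.νnom := by linarith [div_pos hD hν]
  have h1 := hA.mul_le_pos he hn hAB
  rw [add_sub_cancel_left, mul_div_cancel₀ _ hν.ne'] at h1
  obtain ⟨t, ht, hx⟩ := intermediate_value_Icc hAB ((he.traj hn).cont_x hA.spawn_le)
    ⟨by rw [hA.pos_eq]; exact hD.le, h1⟩
  exact ⟨t, hA.spawn_le.trans ht.1, hx⟩

end Arrives

namespace Admissible

variable (h : e.Admissible p T F) {s : ℕ} {b : Bubble}
include h

/-- The lead vehicle has rank zero, so that the bounds of `arrives` on its arrival coincide. -/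
theorem isLeast_occupancy (hl : LastAt e s b) :
    e.bubblePos b (e.tau p T F s b) = 0 ∧ IsLeast (e.occupancy p b) (e.tau p T F s b) := by
  obtain ⟨r, -, hnew⟩ := h.formed_of_mem hl.1
  have hlead := h.loop.lead_mem hnew
  obtain ⟨A, hA, h1, h2⟩ := h.arrives _ s b hl rfl hlead
  rw [h.loop.rank_eq h.safe hnew hlead, Nat.sub_self, Nat.cast_zero, zero_mul, add_zero] at h1 h2
  obtain rfl : A = e.tau p T F s b := le_antisymm h2 h1
  refine ⟨hA.pos_eq, ⟨_, hlead, hA.spawn_le, ?_⟩, ?_⟩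
  · rw [hA.pos_eq]
    exact ⟨le_rfl, (add_pos p.Δ_pos p.L_pos).le⟩
  · rintro t ⟨n, hn, ht, hx⟩
    obtain ⟨A', hA', h3, -⟩ := h.arrives n s b hl rfl hn
    have h4 := hA'.le_of_nonneg ht hx.1
    have : 0 ≤ b.rank n * p.Tnom := mul_nonneg (Nat.cast_nonneg _) p.Tnom_pos.le
    linarith

theorem occupancy_subset (hl : LastAt e s b) : e.occupancy p b ⊆
    Icc (e.tau p T F s b) (e.tau p T F s b + occ p T b) := by
  obtain ⟨r, -, hnew⟩ := h.formed_of_mem hl.1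
  refine fun t ht => ⟨(h.isLeast_occupancy hl).2.2 ht, ?_⟩
  obtain ⟨n, hn, ht, hx⟩ := ht
  obtain ⟨A, hA, -, h1⟩ := h.arrives n s b hl rfl hn
  have h2 := hA.mul_le_pos h.loop (h.loop.of_mem hnew hn).1 (hA.le_of_nonneg ht hx.1)
  have h3 : t - A ≤ (p.L + p.Δ) / p.νnom := by
    rw [le_div_iff₀ p.νnom_pos]; linarith [hx.2]
  have h4 : b.rank n + 1 ≤ b.members.card := by
    rw [h.loop.rank_eq h.safe hnew hn]
    have := (h.loop.mem_members_iff h.safe hnew).1 hn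
    omega
  have h5 : (b.rank n : ℝ) ≤ b.members.card - 1 := by
    rw [le_sub_iff_add_le]; exact_mod_cast h4
  have h6 := mul_le_mul_of_nonneg_right h5 h.T_pos.le
  have h7 := le_max_left ((p.L + p.Δ) / p.νnom) T
  unfold occ Params.occBound
  linarith

theorem isCompact_occupancy (hl : LastAt e s b) : IsCompact (e.occupancy p b) := by
  obtain ⟨r, -, hnew⟩ := h.formed_of_mem hl.1
  have heq : e.occupancy p b = ⋃ n ∈ b.members,
      Icc (e.spawn b.branch n) (e.tau p T F s b + occ p T b) ∩
        e.x b.branch n ⁻¹' Icc 0 (p.Δ + p.L) := by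
    ext t
    simp only [mem_iUnion, exists_prop]
    constructor
    · intro ht
      have h1 := (h.occupancy_subset hl ht).2
      obtain ⟨n, hn, ht, hx⟩ := ht
      exact ⟨n, hn, ⟨ht, h1⟩, hx⟩
    · rintro ⟨n, hn, ht, hx⟩
      exact ⟨n, hn, ht.1, hx⟩
  rw [heq]
  refine b.members.isCompact_biUnion fun n hn => ?_
  have hc := (h.loop.traj (h.loop.of_mem hnew hn).1).cont_x
    (b := e.tau p T F s b + occ p T b) le_rfl
  exact isCompact_Icc.of_isClosed_subset
    (hc.preimage_isClosed_of_isClosed isClosed_Icc isClosed_Icc) inter_subset_left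

end Admissible
end Evolution
end Intersection
theorem mainTheorem1 (p : Intersection.Params)
    (hLe : p.vMax ^ 2 / (-2 * p.uMin) + p.νnom ^ 2 / (2 * p.uMax) ≤ p.Le)
    (T : ℝ) (hT : p.Tiat ≤ T)
    (F : ℕ → Intersection.Bubble → ℝ → ℝ)
    (hF : ∀ s b, AntitoneOn (F s b) (Set.Icc 0 p.vMax))
    (e : Intersection.Evolution) (he : e.IsClosedLoop p T F)
    (hsafe : ∀ s, ∀ b ∈ e.newBubbles s, ∀ n ∈ b.members, 1 ≤ n →
      1 ≤ e.safetyRatio p b.branch n (p.instant s)) :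
    -- (i) clustering, and optimality of the schedules
    ((∀ k (n : ℕ), (n : ℕ∞) < e.count k → ∃ s, ∃ b ∈ e.newBubbles s, b.branch = k ∧ n ∈ b.members) ∧
      (∀ s, ∀ b ∈ e.newBubbles s, ∃ s', b ∈ e.order s') ∧
      (∀ s, (e.order s).Perm (e.problem p T F s).bubbles ∧
        (e.problem p T F s).SearchTerminates ∧
        (e.problem p T F s).Feasible ((e.problem p T F s).velOpt (e.order s)) ∧
        ∀ w, (e.problem p T F s).Feasible w →
          (e.problem p T F s).cost ((e.problem p T F s).velOpt (e.order s)) ≤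
            (e.problem p T F s).cost w)) ∧
    -- (ii) no-collision constraints for all bubbles formed so far, and occupancy times
    ((∀ s, ∀ i ∈ {b | ∃ r ≤ s, b ∈ e.newBubbles r}, ∀ q ∈ {b | ∃ r ≤ s, b ∈ e.newBubbles r},
        (Intersection.ImmediatelyPrecedes {b | ∃ r ≤ s, b ∈ e.newBubbles r}
            Intersection.Bubble.branch (fun b => e.bubblePos b (p.instant s)) i q →
          e.tau p T F s i + p.occBound T i.members.card ≤ e.tau p T F s q) ∧
        (i.branch ≠ q.branch →
          e.tau p T F s q + p.occBound T q.members.card ≤ e.tau p T F s i ∨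
            e.tau p T F s i + p.occBound T i.members.card ≤ e.tau p T F s q)) ∧
      (∀ s, ∀ b ∈ e.newBubbles s, ∃ tIn tOut, IsLeast (e.occupancy p b) tIn ∧
        IsGreatest (e.occupancy p b) tOut ∧ tOut - tIn ≤ p.occBound T b.members.card)) ∧
    -- (iii) inter-vehicle safety
    (∀ s, ∀ b ∈ e.newBubbles s, ∀ n ∈ b.members, 1 ≤ n → ∀ t ≥ p.instant s,
      1 ≤ e.safetyRatio p b.branch n t) ∧
    -- (iv) every bubble has a last schedule, and it is kept
    (∀ s, ∀ b ∈ e.newBubbles s, ∃ s' ≥ s, b ∈ e.order s' ∧ (∀ r > s', b ∉ e.order r) ∧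
      e.bubblePos b (e.tau p T F s' b) = 0 ∧
      IsLeast (e.occupancy p b) (e.tau p T F s' b) ∧
      e.occupancy p b ⊆ Set.Icc (e.tau p T F s' b)
        (e.tau p T F s' b + p.occBound T b.members.card) ∧
      ∀ n ∈ b.members,
        (∃ t ≥ e.spawn b.branch n, e.x b.branch n t = p.Δ + p.L) ∧
        ∀ t ≥ e.spawn b.branch n, 0 ≤ e.x b.branch n t → p.νnom ≤ e.v b.branch n t) := by
  have h : e.Admissible p T F := ⟨he, hsafe, hLe, hT, hF⟩
  have hlast : ∀ s, ∀ b ∈ e.newBubbles s, ∃ r ≥ s, Intersection.Evolution.LastAt e r b :=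
    fun s b hb => h.exists_lastAt_of_new _ s b hb rfl rfl
  refine ⟨⟨fun k n hn => ?_, fun s b hb => ⟨s, h.mem_order_of_new hb⟩, fun s => ?_⟩,
    ⟨fun s i hi q hq => ⟨fun hiq => ?_, fun hk => ?_⟩, fun s b hb => ?_⟩,
    fun s b hb n hn h1 t ht => ?_, fun s b hb => ?_⟩
  · obtain ⟨b, hb, hk, hn⟩ := he.exists_bubble hn
    exact ⟨_, b, hb, hk, hn⟩
  · exact ⟨(h.isOrder s).perm, (h.regular s).searchTerminates,
      (h.regular s).feasible_of_isOrder (h.isOrder s),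
      fun w hw => (h.regular s).cost_velOpt_le (he.scheduling s) hw⟩
  · exact h.same_branch hi hq hiq.1 ((h.lead_pos_lt_iff hi hq hiq.1).1 hiq.2.1)
  · exact h.windows hi hq fun hiq => hk (congrArg _ hiq)
  · obtain ⟨r, -, hl⟩ := hlast s b hb
    have h1 := (h.isLeast_occupancy hl).2
    obtain ⟨tOut, hOut⟩ := (h.isCompact_occupancy hl).exists_isGreatest ⟨_, h1.1⟩
    have h2 := (h.occupancy_subset hl hOut.1).2
    exact ⟨_, tOut, h1, hOut, by rw [Intersection.Evolution.occ] at h2; linarith⟩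
  · obtain ⟨hc, hs⟩ := he.of_mem hb hn
    have h2 := he.safeDist_le hsafe hc h1 (t := t) (by
      rw [Intersection.Evolution.joinTime, hs]; exact ht)
    rwa [Intersection.Evolution.safetyRatio, le_div_iff₀ (p.safeDist_pos _ _), one_mul]
  · obtain ⟨r, hr, hl⟩ := hlast s b hb
    refine ⟨r, hr, hl.1, hl.2, (h.isLeast_occupancy hl).1, (h.isLeast_occupancy hl).2,
      h.occupancy_subset hl, fun n hn => ?_⟩
    obtain ⟨A, hA, -⟩ := h.arrives n r b hl rfl hn
    exact ⟨hA.exists_crossed he (he.of_mem hb hn).1, fun t ht hx => hA.vel t (hA.le_of_nonneg ht hx)⟩
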